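/- Fix a constant $c\in\mathbb N$. We work on a deterministic unit-cost word RAM whose words have $w\ge K\lceil\lg(n+1)\rceil$ bits for a suitable constant $K=K(c)$ (so $w=\Theta(\lg n)$ suffices; $\lg=\log_2$), and measure space in words. A string $S=S[1]\cdots S[n]$ of length $n\ge 1$ has characters in $\{1,\dots,(n+1)^c\}$; $S[i,j]$ is the substring $S[i]\cdots S[j]$, empty if $i>j$. The LZ77 parse of $S$ is the sequence of phrases $Z[1],\dots,Z[z]$ with $S=Z[1]\cdots Z[z]$ obtained greedily from left to right: if $S[1,k]$ has been parsed and $k<n$, then the next phrase is $S[k+1,k+\ell+1]$, where $\ell\ge 0$ is maximal such that $k+\ell\le n-1$ and $S[k+1,k+\ell]$ is a substring of $S[1,k+\ell-1]$ (with $\ell=0$ always allowed). The phrase is represented by the triple $(\mathit{start},\ell,S[k+\ell+1])$, where $\mathit{start}\le k$ is a starting position of an occurrence of $S[k+1,k+\ell]$ in $S[1,k+\ell-1]$ if $\ell>0$, and $\mathit{start}=0$ if $\ell=0$. For a prime $p\le(n+1)^c$ and $0\le r<p$, the Karp–Rabin fingerprint of a string $X$ is $\phi(X)=\sum_{t=1}^{|X|}X[t]\,r^{t-1}\bmod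 p$. **Lemma.** There are three fixed programs (construction, extraction, fingerprinting) and a constant $C$, all depending only on $c$, such that the following holds for all such $n$, $S$, $p$, $r$. Given $z$, $p$, $r$ and the $z$ triples of an LZ77 parse $Z$ of $S$, the construction program outputs in at most $C\,n$ steps a data structure $D$ of at most $C\,z\,(1+\lg(n/z))$ words. For all $1\le i\le n+1$ and $0\le j\le n$, given only $D$, $i$ and $j$, - the extraction program outputs the characters of $S[i,j]$ in order in at most $C\,(1+\lg(n/z)+\max(j-i,0))$ steps, and - the fingerprinting program outputs $\phi(S[i,j])$ in at most $C\,(1+\lg(n/z))$ steps. -/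

import Mathlib

/-! ### Strings, the LZ77 parse and Karp-Rabin fingerprints -/

namespace LZ

/-- The substring `S[i, j] = S[i] ⋯ S[j]` with positions counted from `1` (so `1 ≤ i`);
it is the empty string when `i > j`. -/
def substr (S : List ℕ) (i j : ℕ) : List ℕ := (S.take j).drop (i - 1)

/-- A phrase represented as a triple: starting position (from `1`) of its source, length of the
source, and the trailing character (the phrase border). -/
structure Phrase where
  start : ℕ
  len : ℕ
  border : ℕ

/-- `q` is the greedy phrase following the already parsed prefix `S[1, k]`. Its source part is
`S[k + 1, k + len]`, the longest prefix of `S[k + 1, n - 1]` that is also a substring of the string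
`S[1, k + len - 1]` (so source and phrase may overlap), and the phrase is `S[k + 1, k + len + 1]`.
A phrase with an empty source is represented by `(0, 0, c)`. -/
structure IsNextPhrase (S : List ℕ) (k : ℕ) (q : Phrase) : Prop where
  /-- The border is the character `S[k + len + 1]`. -/
  border_eq : S[k + q.len]? = some q.border
  source_eq :
    (q.len = 0 ∧ q.start = 0) ∨
      (0 < q.len ∧ 1 ≤ q.start ∧ q.start + q.len - 1 ≤ k + q.len - 1 ∧
        substr S q.start (q.start + q.len - 1) = substr S (k + 1) (k + q.len))
  longest : ∀ l, q.len < l → k + l ≤ S.length - 1 →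
    ¬ substr S (k + 1) (k + l) <:+: substr S 1 (k + l - 1)

/-- The phrases in the list are the remaining phrases of the parse of `S` once `S[1, k]` has
been parsed. -/
def IsLZ77ParseFrom (S : List ℕ) : ℕ → List Phrase → Prop
  | k, [] => k = S.length
  | k, q :: Z => IsNextPhrase S k q ∧ IsLZ77ParseFrom S (k + q.len + 1) Z

/-- `Z` is (a representation of) the LZ77 parse of `S`. -/
def IsLZ77Parse (S : List ℕ) (Z : List Phrase) : Prop := IsLZ77ParseFrom S 0 Z

/-- The Karp-Rabin fingerprint `φ(S) = ∑_{i = 1}^{|S|} S[i] r^{i - 1} mod p`. -/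
def fingerprint (p r : ℕ) (S : List ℕ) : ℕ :=
  (∑ t ∈ Finset.range S.length, S.getD t 0 * r ^ t) % p

/-- The words given to the construction algorithm: the number `z` of phrases, the modulus `p` and
the base `r` of the fingerprint function, and then the `z` triples of the parse. -/
def inputWords (p r : ℕ) (Z : List Phrase) : List ℕ :=
  [Z.length, p, r] ++ Z.flatMap (fun q => [q.start, q.len, q.border])

end LZ

/-! ### The unit-cost word RAM

A program works on a fixed finite set of registers (those that it mentions), on a memory of words
addressed indirectly through registers, and on a write-only output. A word is a natural number
below `2 ^ w`, and an instruction whose result is not a word has no execution at all, so that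
executions that exist never overflow. Control flow is structured (sequence, branching, loop);
every instruction and every evaluation of a test takes one step. -/

namespace RAM

/-- Word operations: subtraction is truncated at `0`, division rounds down, `x / 0 = 0`
and `x mod 0 = x`. -/
inductive BinOp
  | add | sub | mul | div | mod | and | or | xor | shl | shr

def BinOp.eval : BinOp → ℕ → ℕ → ℕ
  | .add, x, y => x + y
  | .sub, x, y => x - y
  | .mul, x, y => x * y
  | .div, x, y => x / y
  | .mod, x, y => x % y
  | .and, x, y => x &&& y
  | .or, x, y => x ||| y
  | .xor, x, y => x ^^^ y
  | .shl, x, y => x <<< y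
  | .shr, x, y => x >>> y

/-- Tests comparing the contents of two registers. -/
inductive Test
  | lt (a b : ℕ)
  | le (a b : ℕ)
  | eq (a b : ℕ)
  | ne (a b : ℕ)

def Test.Holds (reg : ℕ → ℕ) : Test → Prop
  | .lt a b => reg a < reg b
  | .le a b => reg a ≤ reg b
  | .eq a b => reg a = reg b
  | .ne a b => reg a ≠ reg b

/-- Programs. -/
inductive Prog
  /-- do nothing -/
  | skip
  /-- `reg d := v` -/
  | const (d v : ℕ)
  /-- `reg d := reg a ∘ reg b` -/
  | op (o : BinOp) (d a b : ℕ)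
  /-- `reg d := mem (reg a)` -/
  | load (d a : ℕ)
  /-- `mem (reg a) := reg b` -/
  | store (a b : ℕ)
  /-- append `reg a` to the output -/
  | emit (a : ℕ)
  | seq (P Q : Prog)
  | ite (b : Test) (P Q : Prog)
  | loop (b : Test) (P : Prog)

structure State where
  reg : ℕ → ℕ
  mem : ℕ → ℕ
  out : List ℕ

def State.setReg (s : State) (d v : ℕ) : State := { s with reg := Function.update s.reg d v }

def State.setMem (s : State) (a v : ℕ) : State := { s with mem := Function.update s.mem a v }

/-- `Exec w P s t s₂`: with word length `w`, the program `P` started in the state `s` halts in the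
state `s₂` after exactly `t` steps, and every word it computes or reads is below `2 ^ w`. -/
inductive Exec (w : ℕ) : Prog → State → ℕ → State → Prop
  | skip (s : State) : Exec w .skip s 1 s
  | const (s : State) (d v : ℕ) (h : v < 2 ^ w) : Exec w (.const d v) s 1 (s.setReg d v)
  | op (s : State) (o : BinOp) (d a b : ℕ) (h : o.eval (s.reg a) (s.reg b) < 2 ^ w) :
      Exec w (.op o d a b) s 1 (s.setReg d (o.eval (s.reg a) (s.reg b)))
  | load (s : State) (d a : ℕ) (h : s.mem (s.reg a) < 2 ^ w) :
      Exec w (.load d a) s 1 (s.setReg d (s.mem (s.reg a)))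
  | store (s : State) (a b : ℕ) : Exec w (.store a b) s 1 (s.setMem (s.reg a) (s.reg b))
  | emit (s : State) (a : ℕ) : Exec w (.emit a) s 1 { s with out := s.out ++ [s.reg a] }
  | seq {P Q : Prog} {s s₁ s₂ : State} {t₁ t₂ : ℕ}
      (h₁ : Exec w P s t₁ s₁) (h₂ : Exec w Q s₁ t₂ s₂) : Exec w (.seq P Q) s (t₁ + t₂) s₂
  | ite_true {b : Test} {P Q : Prog} {s s₁ : State} {t : ℕ} (hb : b.Holds s.reg)
      (h : Exec w P s t s₁) : Exec w (.ite b P Q) s (t + 1) s₁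
  | ite_false {b : Test} {P Q : Prog} {s s₁ : State} {t : ℕ} (hb : ¬ b.Holds s.reg)
      (h : Exec w Q s t s₁) : Exec w (.ite b P Q) s (t + 1) s₁
  | loop_true {b : Test} {P : Prog} {s s₁ s₂ : State} {t₁ t₂ : ℕ} (hb : b.Holds s.reg)
      (h₁ : Exec w P s t₁ s₁) (h₂ : Exec w (.loop b P) s₁ t₂ s₂) :
      Exec w (.loop b P) s (t₁ + t₂ + 1) s₂
  | loop_false {b : Test} {P : Prog} {s : State} (hb : ¬ b.Holds s.reg) :
      Exec w (.loop b P) s 1 s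

/-- The initial state with the words `M` in the memory cells `0, 1, …`, the words `args` in the
registers `0, 1, …`, zero everywhere else, and empty output. -/
def initState (M args : List ℕ) : State where
  reg := fun a => args.getD a 0
  mem := fun a => M.getD a 0
  out := []

/-- With word length `w`, on memory `M` and arguments `args`, the program `P` halts after exactly
`t` steps and the sequence of words it has output is `o`. All the words in `M` and `args` are
required to be words, i.e. below `2 ^ w`. -/
def Outputs (w : ℕ) (P : Prog) (M args : List ℕ) (t : ℕ) (o : List ℕ) : Prop :=
  (∀ x ∈ M, x < 2 ^ w) ∧ (∀ x ∈ args, x < 2 ^ w) ∧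
    ∃ s : State, Exec w P (initState M args) t s ∧ s.out = o

end RAM

/-! The data structure is a variant of a block tree built around the phrase borders. Let `cl` be the
least positive number with n ≤ z·2^(cl-1), so that cl = ⌈lg(n/z)⌉ + 1, let `m` be least with n ≤
z·cl·2^m, and put s_l = cl·2^(m-l). Level 0 covers the whole text by windows of length 2·s_0
starting every s_0 positions. Level l+1 covers, for each border E_q, only the neighbourhood [E_q -
2·s_l, E_q + 2·s_l), by eight windows of length 2·s_{l+1} starting s_{l+1} apart.

If the next border is at distance at least 2·s_l from the start `a` of a window, the window lies in
the copied part of a phrase. Following the copy pointers leads to an earlier start `y` at which the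
same 2·s_l characters occur and whose next border is less than 2·s_l away. The window stores `y`
relative to that border. A position in the first half of the window at `a` therefore has an equal
counterpart in a neighbourhood of level l+1. After m+1 ≤ cl such steps it lies in a neighbourhood of
radius 2·cl around a border, where everything is stored explicitly. There are 8z windows per level
and 4·cl·z leaves, hence O(z·cl) words (`Describes.length_D_le`, `Describes.cl_le`).

Queries. The second half of a window leaves room for `cl` further characters, so one descent gives
`cl` consecutive characters and extraction costs O(1) per character plus O(cl) (`wp_extract`). For
fingerprints let PF(x) be the sum of T(t)·r^t over t < x. If the text agrees at `a` and `y`, then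
PF(a+o) - PF(a) = r^(a-y)·(PF(y+o) - PF(y)), so one step of the descent is an affine map of PF. The
descent composes these maps, together with the powers of r⁻¹ needed to normalise the difference of
two prefixes (`Descent.step`, `fingerprint_substr`). The base r = 0 is treated apart (`wp_fprint`).

Construction in linear time. The parse is decoded into arrays, and r⁻¹ = r^(p-2) is found by
repeated squaring. The pointers `y` come from shortening copy chains in place, from left to right:
pointers go to the left, so the target has its final pointer already and a single jump suffices
(`SweepInv.step`). A level touches only its neighbourhoods, 8·z·s_l positions, and these numbers add
up geometrically to O(z·s_0) = O(n) (`Good.G_inv`, `wp_emitAll`).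

The programs are written with arithmetic expressions over variables and compiled to the machine; the
predicate `WP` gives rules for total correctness with an upper bound on time. -/

/-! ### Straight-line code with expressions, compiled to the word RAM -/

namespace RAM

/-- Registers below `numVars` hold program variables, the others intermediate results. -/
def numVars : ℕ := 24

/-- Arithmetic expressions over variables and memory. -/
inductive Ex
  | var (i : ℕ)
  | lit (v : ℕ)
  | bin (o : BinOp) (a b : Ex)
  | ld (a : Ex)

namespace Ex

instance : Add Ex := ⟨.bin .add⟩
instance : Sub Ex := ⟨.bin .sub⟩
instance : Mul Ex := ⟨.bin .mul⟩
instance : Div Ex := ⟨.bin .div⟩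
instance : Mod Ex := ⟨.bin .mod⟩

/-- The value of an expression. -/
def val (e : List ℕ) (m : ℕ → ℕ) : Ex → ℕ
  | var i => e.getD i 0
  | lit k => k
  | bin o a b => o.eval (a.val e m) (b.val e m)
  | ld a => m (a.val e m)

/-- All the values that arise in the evaluation are below `B`. -/
def Ok (B : ℕ) (e : List ℕ) (m : ℕ → ℕ) : Ex → Prop
  | var i => i < numVars ∧ e.getD i 0 < B
  | lit k => k < B
  | bin o a b => a.Ok B e m ∧ b.Ok B e m ∧ o.eval (a.val e m) (b.val e m) < B
  | ld a => a.Ok B e m ∧ m (a.val e m) < B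

/-- The number of steps of the evaluation. -/
def cost : Ex → ℕ
  | var _ => 1
  | lit _ => 1
  | bin _ a b => a.cost + b.cost + 1
  | ld a => a.cost + 1

/-- Code that evaluates an expression into register `d`, using the registers from `d` on. -/
def comp : Ex → ℕ → Prog
  | var i, d => .op .or d i i
  | lit k, d => .const d k
  | bin o a b, d => .seq (a.comp d) (.seq (b.comp (d + 1)) (.op o d d (d + 1)))
  | ld a, d => .seq (a.comp d) (.load d d)

section
variable (e : List ℕ) (m : ℕ → ℕ) (B : ℕ) (a b : Ex) (i k : ℕ)
@[simp] theorem val_var : (var i).val e m = e.getD i 0 := rfl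
@[simp] theorem val_lit : (lit k).val e m = k := rfl
@[simp] theorem val_add : (a + b).val e m = a.val e m + b.val e m := rfl
@[simp] theorem val_sub : (a - b).val e m = a.val e m - b.val e m := rfl
@[simp] theorem val_mul : (a * b).val e m = a.val e m * b.val e m := rfl
@[simp] theorem val_div : (a / b).val e m = a.val e m / b.val e m := rfl
@[simp] theorem val_mod : (a % b).val e m = a.val e m % b.val e m := rfl
@[simp] theorem val_ld : (ld a).val e m = m (a.val e m) := rfl
@[simp] theorem ok_var : (var i).Ok B e m ↔ i < numVars ∧ e.getD i 0 < B := Iff.rfl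
@[simp] theorem ok_lit : (lit k).Ok B e m ↔ k < B := Iff.rfl
@[simp] theorem ok_add : (a + b).Ok B e m ↔ a.Ok B e m ∧ b.Ok B e m ∧
    a.val e m + b.val e m < B := Iff.rfl
@[simp] theorem ok_mul : (a * b).Ok B e m ↔ a.Ok B e m ∧ b.Ok B e m ∧
    a.val e m * b.val e m < B := Iff.rfl
-- Truncated subtraction, like division and remainder below, does not exceed its first operand.
-- Hence only sums, products and loaded words leave a bound to check.
@[simp] theorem ok_sub : (a - b).Ok B e m ↔ a.Ok B e m ∧ b.Ok B e m := by
  refine ⟨fun h => ⟨h.1, h.2.1⟩, fun h => ⟨h.1, h.2, lt_of_le_of_lt (Nat.sub_le _ _) ?_⟩⟩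
  obtain ⟨h, -⟩ := h
  cases a with
  | var => exact h.2
  | lit => exact h
  | bin => exact h.2.2
  | ld => exact h.2
theorem Ok.val_lt {e : List ℕ} {m : ℕ → ℕ} {B : ℕ} {a : Ex} (h : a.Ok B e m) :
    a.val e m < B := by
  cases a with
  | var => exact h.2
  | lit => exact h
  | bin => exact h.2.2
  | ld => exact h.2
@[simp] theorem ok_div : (a / b).Ok B e m ↔ a.Ok B e m ∧ b.Ok B e m :=
  ⟨fun h => ⟨h.1, h.2.1⟩, fun h => ⟨h.1, h.2, lt_of_le_of_lt (Nat.div_le_self _ _) h.1.val_lt⟩⟩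
@[simp] theorem ok_mod : (a % b).Ok B e m ↔ a.Ok B e m ∧ b.Ok B e m :=
  ⟨fun h => ⟨h.1, h.2.1⟩, fun h => ⟨h.1, h.2, lt_of_le_of_lt (Nat.mod_le _ _) h.1.val_lt⟩⟩
@[simp] theorem ok_ld : (ld a).Ok B e m ↔ a.Ok B e m ∧ m (a.val e m) < B := Iff.rfl
@[simp] theorem cost_var : (var i).cost = 1 := rfl
@[simp] theorem cost_lit : (lit i).cost = 1 := rfl
@[simp] theorem cost_add : (a + b).cost = a.cost + b.cost + 1 := rfl
@[simp] theorem cost_sub : (a - b).cost = a.cost + b.cost + 1 := rfl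
@[simp] theorem cost_mul : (a * b).cost = a.cost + b.cost + 1 := rfl
@[simp] theorem cost_div : (a / b).cost = a.cost + b.cost + 1 := rfl
@[simp] theorem cost_mod : (a % b).cost = a.cost + b.cost + 1 := rfl
@[simp] theorem cost_ld : (ld a).cost = a.cost + 1 := rfl
end

/-- The code for target `d` leaves all registers below `d` alone. So the left operand survives in
`d` while the right one is evaluated into `d + 1`, and the variables survive because `numVars ≤ d`.
-/
theorem exec_comp {w : ℕ} {e : List ℕ} {m : ℕ → ℕ} (a : Ex) : ∀ (d : ℕ) (s : State),
    numVars ≤ d → (∀ i < numVars, s.reg i = e.getD i 0) → s.mem = m → a.Ok (2 ^ w) e m →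
    ∃ s', Exec w (a.comp d) s a.cost s' ∧ s'.reg d = a.val e m ∧
      (∀ i < d, s'.reg i = s.reg i) ∧ s'.mem = s.mem ∧ s'.out = s.out := by
  induction a with
  | var i =>
    intro d s hd hs hm h
    refine ⟨_, .op s .or d i i ?_, ?_, ?_, rfl, rfl⟩
    · simpa [BinOp.eval, hs i h.1] using h.2
    · simp [State.setReg, BinOp.eval, hs i h.1, val]
    · intro j hj
      simp [State.setReg, Function.update_of_ne hj.ne]
  | lit k =>
    intro d s hd hs hm h
    refine ⟨_, .const s d k h, ?_, ?_, rfl, rfl⟩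
    · simp [State.setReg, val]
    · intro j hj
      simp [State.setReg, Function.update_of_ne hj.ne]
  | bin o a b iha ihb =>
    intro d s hd hs hm ⟨ha, hb, hab⟩
    obtain ⟨s₁, E₁, v₁, r₁, m₁, o₁⟩ := iha d s hd hs hm ha
    obtain ⟨s₂, E₂, v₂, r₂, m₂, o₂⟩ := ihb (d + 1) s₁ (by omega)
      (fun i hi => by rw [r₁ i (by omega), hs i hi]) (by rw [m₁, hm]) hb
    have hd2 : s₂.reg d = a.val e m := by rw [r₂ d (by omega), v₁]
    have hE : Exec w (.op o d d (d + 1)) s₂ 1 _ := .op s₂ o d d (d + 1) (by rw [hd2, v₂]; exact hab)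
    have hE' := Exec.seq E₁ (Exec.seq E₂ hE)
    rw [← Nat.add_assoc] at hE'
    refine ⟨_, hE', ?_, ?_, ?_, ?_⟩
    · simp [State.setReg, val, hd2, v₂]
    · intro j hj
      simp [State.setReg, Function.update_of_ne hj.ne, r₂ j (by omega), r₁ j hj]
    · simp [State.setReg, m₂, m₁]
    · simp [State.setReg, o₂, o₁]
  | ld a iha =>
    intro d s hd hs hm ⟨ha, hab⟩
    obtain ⟨s₁, E₁, v₁, r₁, m₁, o₁⟩ := iha d s hd hs hm ha
    refine ⟨_, .seq E₁ (.load s₁ d d ?_), ?_, ?_, ?_, ?_⟩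
    · rw [m₁, hm, v₁]; exact hab
    · simp [State.setReg, m₁, hm, v₁, val]
    · intro j hj
      simp [State.setReg, Function.update_of_ne hj.ne, r₁ j hj]
    · simp [State.setReg, m₁]
    · simp [State.setReg, o₁]

end Ex

/-! ### Total correctness of structured programs, with time bounds -/

/-- The values of the variables, memory, output, and a bound for the number of steps so far. -/
structure Cfg where
  env : List ℕ
  mem : ℕ → ℕ
  out : List ℕ
  time : ℕ

/-- Basic commands. -/
inductive Instr
  | asg (x : ℕ) (a : Ex)
  | sto (a b : Ex)
  | emi (a : Ex)

namespace Instr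

/-- The machine has no move instruction; the bitwise `or` of a register with itself serves as one.
-/
def comp : Instr → Prog
  | asg x a => .seq (a.comp numVars) (.op .or x numVars numVars)
  | sto a b => .seq (a.comp numVars) (.seq (b.comp (numVars + 1)) (.store numVars (numVars + 1)))
  | emi a => .seq (a.comp numVars) (.emit numVars)

def run : Instr → Cfg → Cfg
  | asg x a, σ => ⟨σ.env.set x (a.val σ.env σ.mem), σ.mem, σ.out, σ.time + (a.cost + 1)⟩
  | sto a b, σ => ⟨σ.env, Function.update σ.mem (a.val σ.env σ.mem) (b.val σ.env σ.mem), σ.out,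
      σ.time + (a.cost + b.cost + 1)⟩
  | emi a, σ => ⟨σ.env, σ.mem, σ.out ++ [a.val σ.env σ.mem], σ.time + (a.cost + 1)⟩

def Ok (B : ℕ) : Instr → Cfg → Prop
  | asg x a, σ => (x < numVars ∧ x < σ.env.length) ∧ a.Ok B σ.env σ.mem
  | sto a b, σ => a.Ok B σ.env σ.mem ∧ b.Ok B σ.env σ.mem
  | emi a, σ => a.Ok B σ.env σ.mem

end Instr

/-- Compilation of a sequence of basic commands. -/
def block : List Instr → Prog
  | [] => .skip
  | i :: l => .seq i.comp (block l)

def runs : List Instr → Cfg → Cfg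
  | [], σ => ⟨σ.env, σ.mem, σ.out, σ.time + 1⟩
  | i :: l, σ => runs l (i.run σ)

def Oks (B : ℕ) : List Instr → Cfg → Prop
  | [], _ => True
  | i :: l, σ => i.Ok B σ ∧ Oks B l (i.run σ)

/-- The machine state `s` agrees with `σ` on the variables, the memory and the output. -/
structure Rep (s : State) (σ : Cfg) : Prop where
  reg : ∀ i < numVars, s.reg i = σ.env.getD i 0
  mem : s.mem = σ.mem
  out : s.out = σ.out

/-- Total correctness: started in `σ`, the program halts in a configuration satisfying `Q`. -/
def WP (w : ℕ) (P : Prog) (σ : Cfg) (Q : Cfg → Prop) : Prop :=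
  ∀ s, Rep s σ → ∃ t s' σ', Exec w P s t s' ∧ Rep s' σ' ∧ σ.time + t ≤ σ'.time ∧ Q σ'

namespace WP

variable {w : ℕ} {P P' : Prog} {σ : Cfg} {Q Q' : Cfg → Prop}

theorem mono (h : WP w P σ Q) (hQ : ∀ σ', Q σ' → Q' σ') : WP w P σ Q' := by
  intro s hs
  obtain ⟨t, s', σ', h1, h2, h3, h4⟩ := h s hs
  exact ⟨t, s', σ', h1, h2, h3, hQ _ h4⟩

theorem seq (h : WP w P σ (fun σ' => WP w P' σ' Q)) : WP w (.seq P P') σ Q := by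
  intro s hs
  obtain ⟨t, s', σ', h1, h2, h3, h4⟩ := h s hs
  obtain ⟨t', s'', σ'', g1, g2, g3, g4⟩ := h4 s' h2
  exact ⟨_, _, σ'', .seq h1 g1, g2, by omega, g4⟩

theorem instr {i : Instr} (h : i.Ok (2 ^ w) σ) (hQ : Q (i.run σ)) : WP w i.comp σ Q := by
  intro s hs
  cases i with
  | asg x a =>
    obtain ⟨⟨hx, hxl⟩, ha⟩ := h
    obtain ⟨s₁, E₁, v₁, r₁, m₁, o₁⟩ := a.exec_comp numVars s le_rfl hs.reg hs.mem ha
    refine ⟨_, _, _, .seq E₁ (.op s₁ .or x numVars numVars ?_), ⟨?_, ?_, ?_⟩, ?_, hQ⟩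
    · simpa [BinOp.eval, v₁] using ha.val_lt
    · intro i hi
      by_cases hix : i = x
      · subst hix
        simp [State.setReg, BinOp.eval, v₁, Instr.run, hxl]
      · simp [State.setReg, Function.update_of_ne hix, Instr.run, List.getD_eq_getElem?_getD,
          List.getElem?_set_ne (Ne.symm hix), r₁ i hi, hs.reg i hi]
    · simp [State.setReg, m₁, hs.mem, Instr.run]
    · simp [State.setReg, o₁, hs.out, Instr.run]
    · simp [Instr.run]
  | sto a b =>
    obtain ⟨ha, hb⟩ := h
    obtain ⟨s₁, E₁, v₁, r₁, m₁, o₁⟩ := a.exec_comp numVars s le_rfl hs.reg hs.mem ha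
    obtain ⟨s₂, E₂, v₂, r₂, m₂, o₂⟩ := b.exec_comp (numVars + 1) s₁ (by omega)
      (fun i hi => by rw [r₁ i hi, hs.reg i hi]) (by rw [m₁, hs.mem]) hb
    refine ⟨_, _, _, .seq E₁ (.seq E₂ (.store s₂ numVars (numVars + 1))), ⟨?_, ?_, ?_⟩, ?_, hQ⟩
    · intro i hi
      simp [State.setMem, Instr.run, r₂ i (by omega), r₁ i hi, hs.reg i hi]
    · simp [State.setMem, Instr.run, m₂, m₁, hs.mem, v₂, r₂ numVars (by omega), v₁]
    · simp [State.setMem, Instr.run, o₂, o₁, hs.out]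
    · simp [Instr.run]; omega
  | emi a =>
    obtain ⟨s₁, E₁, v₁, r₁, m₁, o₁⟩ := a.exec_comp numVars s le_rfl hs.reg hs.mem h
    refine ⟨_, _, _, .seq E₁ (.emit s₁ numVars), ⟨?_, ?_, ?_⟩, ?_, hQ⟩
    · intro i hi
      simp [Instr.run, r₁ i hi, hs.reg i hi]
    · simp [Instr.run, m₁, hs.mem]
    · simp [Instr.run, o₁, hs.out, v₁]
    · simp [Instr.run]

theorem block {l : List Instr} : ∀ {σ : Cfg}, Oks (2 ^ w) l σ → Q (runs l σ) → WP w (block l) σ Q := by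
  induction l with
  | nil =>
    intro σ _ h s hs
    exact ⟨1, s, runs [] σ, .skip s, ⟨hs.reg, hs.mem, hs.out⟩, le_rfl, h⟩
  | cons i l ih =>
    intro σ h hQ
    exact seq (instr h.1 (ih h.2 hQ))

/-- The effect of a test on the variables. -/
def TestOn (b : Test) (e : List ℕ) : Prop := b.Holds (fun i => e.getD i 0)

/-- The variables compared by a test. -/
def TestVars : Test → Prop
  | .lt a b => a < numVars ∧ b < numVars
  | .le a b => a < numVars ∧ b < numVars
  | .eq a b => a < numVars ∧ b < numVars
  | .ne a b => a < numVars ∧ b < numVars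

theorem holds_iff {b : Test} {s : State} (hb : TestVars b) (hs : Rep s σ) :
    b.Holds s.reg ↔ TestOn b σ.env := by
  cases b <;> simp only [TestOn, Test.Holds, hs.reg _ hb.1, hs.reg _ hb.2]

theorem ite {b : Test} (hb : TestVars b)
    (h1 : TestOn b σ.env → WP w P ⟨σ.env, σ.mem, σ.out, σ.time + 1⟩ Q)
    (h2 : ¬ TestOn b σ.env → WP w P' ⟨σ.env, σ.mem, σ.out, σ.time + 1⟩ Q) :
    WP w (.ite b P P') σ Q := by
  intro s hs
  by_cases h : TestOn b σ.env
  · obtain ⟨t, s', σ', g1, g2, g3, g4⟩ := h1 h s ⟨hs.reg, hs.mem, hs.out⟩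
    exact ⟨_, s', σ', .ite_true ((holds_iff hb hs).2 h) g1, g2, by simp at g3; omega, g4⟩
  · obtain ⟨t, s', σ', g1, g2, g3, g4⟩ := h2 h s ⟨hs.reg, hs.mem, hs.out⟩
    exact ⟨_, s', σ', .ite_false (fun h' => h ((holds_iff hb hs).1 h')) g1, g2,
      by simp at g3; omega, g4⟩

/-- A loop with a decreasing measure. -/
theorem loop_measure {b : Test} (hb : TestVars b) (I : Cfg → Prop) (μ : Cfg → ℕ)
    (step : ∀ σ, I σ → TestOn b σ.env →
      WP w P ⟨σ.env, σ.mem, σ.out, σ.time + 1⟩ (fun σ' => I σ' ∧ μ σ' < μ σ))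
    (exit : ∀ σ, I σ → ¬ TestOn b σ.env → Q ⟨σ.env, σ.mem, σ.out, σ.time + 1⟩) :
    ∀ σ, I σ → WP w (.loop b P) σ Q := by
  suffices H : ∀ k σ, μ σ ≤ k → I σ → WP w (.loop b P) σ Q from fun σ => H _ σ le_rfl
  intro k
  induction k with
  | zero =>
    intro σ hμ hI s hs
    by_cases h : TestOn b σ.env
    · obtain ⟨t, s', σ', g1, g2, g3, g4, g5⟩ := step σ hI h s ⟨hs.reg, hs.mem, hs.out⟩
      omega
    · exact ⟨1, s, ⟨σ.env, σ.mem, σ.out, σ.time + 1⟩, .loop_false (fun h' => h ((holds_iff hb hs).1 h')),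
        ⟨hs.reg, hs.mem, hs.out⟩, le_rfl, exit σ hI h⟩
  | succ k ih =>
    intro σ hμ hI s hs
    by_cases h : TestOn b σ.env
    · obtain ⟨t, s', σ', g1, g2, g3, g4, g5⟩ := step σ hI h s ⟨hs.reg, hs.mem, hs.out⟩
      obtain ⟨t', s'', σ'', f1, f2, f3, f4⟩ := ih σ' (by omega) g4 s' g2
      refine ⟨_, s'', σ'', .loop_true ((holds_iff hb hs).2 h) g1 f1, f2, ?_, f4⟩
      simp at g3; omega
    · exact ⟨1, s, ⟨σ.env, σ.mem, σ.out, σ.time + 1⟩, .loop_false (fun h' => h ((holds_iff hb hs).1 h')),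
        ⟨hs.reg, hs.mem, hs.out⟩, le_rfl, exit σ hI h⟩

/-- A loop with a known number of iterations. -/
theorem loop_count {b : Test} (hb : TestVars b) (N : ℕ) (I : ℕ → Cfg → Prop)
    (step : ∀ k < N, ∀ σ, I k σ → TestOn b σ.env ∧
      WP w P ⟨σ.env, σ.mem, σ.out, σ.time + 1⟩ (I (k + 1)))
    (exit : ∀ σ, I N σ → ¬ TestOn b σ.env ∧ Q ⟨σ.env, σ.mem, σ.out, σ.time + 1⟩)
    (h0 : I 0 σ) : WP w (.loop b P) σ Q := by
  suffices H : ∀ j k σ, k + j = N → I k σ → WP w (.loop b P) σ Q from H N 0 σ (by omega) h0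
  intro j
  induction j with
  | zero =>
    intro k σ hk hI s hs
    obtain rfl : k = N := by omega
    exact ⟨1, s, ⟨σ.env, σ.mem, σ.out, σ.time + 1⟩, .loop_false (fun h' => (exit σ hI).1 ((holds_iff hb hs).1 h')),
      ⟨hs.reg, hs.mem, hs.out⟩, le_rfl, (exit σ hI).2⟩
  | succ j ih =>
    intro k σ hk hI s hs
    obtain ⟨h, hw⟩ := step k (by omega) σ hI
    obtain ⟨t, s', σ', g1, g2, g3, g4⟩ := hw s ⟨hs.reg, hs.mem, hs.out⟩
    obtain ⟨t', s'', σ'', f1, f2, f3, f4⟩ := ih (k + 1) σ' (by omega) g4 s' g2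
    refine ⟨_, s'', σ'', .loop_true ((holds_iff hb hs).2 h) g1 f1, f2, ?_, f4⟩
    simp at g3; omega

end WP

/-- In an execution started with words in the registers, all the output consists of words. -/
theorem Exec.out_lt {w : ℕ} {P : Prog} {s s' : State} {t : ℕ} (h : Exec w P s t s')
    (hr : ∀ i, s.reg i < 2 ^ w) (ho : ∀ x ∈ s.out, x < 2 ^ w) :
    (∀ i, s'.reg i < 2 ^ w) ∧ ∀ x ∈ s'.out, x < 2 ^ w := by
  have key : ∀ (s : State) (d v : ℕ), (∀ i, s.reg i < 2 ^ w) → v < 2 ^ w →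
      ∀ i, (s.setReg d v).reg i < 2 ^ w := by
    intro s d v hr hv i
    by_cases hi : i = d
    · subst hi; simpa [State.setReg] using hv
    · simpa [State.setReg, Function.update_of_ne hi] using hr i
  induction h with
  | skip s => exact ⟨hr, ho⟩
  | const s d v h => exact ⟨key _ _ _ hr h, ho⟩
  | op s o d a b h => exact ⟨key _ _ _ hr h, ho⟩
  | load s d a h => exact ⟨key _ _ _ hr h, ho⟩
  | store s a b => exact ⟨hr, ho⟩
  | emit s a =>
    refine ⟨hr, fun x hx => ?_⟩
    rcases List.mem_append.1 hx with hx | hx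
    · exact ho x hx
    · rw [List.mem_singleton.1 hx]; exact hr a
  | seq _ _ ih1 ih2 => exact ih2 (ih1 hr ho).1 (ih1 hr ho).2
  | ite_true _ _ ih => exact ih hr ho
  | ite_false _ _ ih => exact ih hr ho
  | loop_true _ _ _ ih1 ih2 => exact ih2 (ih1 hr ho).1 (ih1 hr ho).2
  | loop_false => exact ⟨hr, ho⟩

/-- From total correctness to `Outputs`. -/
theorem WP.outputs {w : ℕ} {P : Prog} {M args e : List ℕ} {Q : Cfg → Prop}
    (hM : ∀ x ∈ M, x < 2 ^ w) (ha : ∀ x ∈ args, x < 2 ^ w)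
    (he : ∀ i < numVars, args.getD i 0 = e.getD i 0)
    (h : WP w P ⟨e, fun a => M.getD a 0, [], 0⟩ Q) :
    ∃ t σ, Outputs w P M args t σ.out ∧ t ≤ σ.time ∧ Q σ ∧ ∀ x ∈ σ.out, x < 2 ^ w := by
  obtain ⟨t, s', σ', h1, h2, h3, h4⟩ := h (initState M args) ⟨he, rfl, rfl⟩
  refine ⟨t, σ', ⟨hM, ha, s', h1, h2.out⟩, by simpa using h3, h4, ?_⟩
  rw [← h2.out]
  refine (h1.out_lt (fun i => ?_) (by simp [initState])).2
  rcases lt_or_ge i args.length with hi | hi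
  · simpa [initState, hi] using ha _ (List.getElem_mem hi)
  · simp [initState, hi]

end RAM

/-! ### In-place shortening of copy chains -/

/-- One update of the chain pointers `g`: if the position `g x` is at distance at least `b` from
the next phrase border, the pointer of `x` skips it. -/
def sweepStep (dist : ℕ → ℕ) (b : ℕ) (g : ℕ → ℕ) (x : ℕ) : ℕ → ℕ :=
  Function.update g x (if b ≤ dist (g x) then g (g x) else g x)

/-- Updates of `k` consecutive positions from `lo` on. -/
def sweep (dist : ℕ → ℕ) (b lo : ℕ) : ℕ → (ℕ → ℕ) → ℕ → ℕ
  | 0, g => g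
  | k + 1, g => sweepStep dist b (sweep dist b lo k g) (lo + k)

/-- Updates of the first `q` windows `[W i, W i + len)`. -/
def sweeps (dist : ℕ → ℕ) (W : ℕ → ℕ) (b len : ℕ) : ℕ → (ℕ → ℕ) → ℕ → ℕ
  | 0, g => g
  | q + 1, g => sweep dist b (W q) len (sweeps dist W b len q g)

/-- The parameters of the data structure together with the decoded parse: the text `T` occupies
the positions from `M` on, `E q` is the position of the border of phrase `q`, `dist x` the distance
from `x` to the next border, `idx x` the number of the phrase of `x` and `src x` the position that
`x` is copied from. -/
structure Layout where
  n : ℕ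
  z : ℕ
  cl : ℕ
  m : ℕ
  p : ℕ
  r : ℕ
  ri : ℕ
  T : ℕ → ℕ
  dist : ℕ → ℕ
  idx : ℕ → ℕ
  src : ℕ → ℕ
  E : ℕ → ℕ

/-! ### Windows, copy pointers and the stored words -/

namespace Layout

variable (L : Layout)

/-- The distance between windows at level `l`. -/
def s (l : ℕ) : ℕ := L.cl * 2 ^ (L.m - l)

/-- Padding to the left of the text. It keeps the subtraction in `E q - 2 * s l` from truncating and
makes 0 a position outside the text. -/
def M : ℕ := 4 * L.s 0

/-- The starting positions of the neighbourhoods at level `l`. -/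
def W : ℕ → ℕ → ℕ
  | 0, q => L.M + 8 * q * L.s 0
  | l + 1, q => L.E q - 2 * L.s l

/-- The chain pointers at level `l`. -/
def G : ℕ → ℕ → ℕ
  | 0 => sweeps L.dist (L.W 0) (2 * L.s 0) (8 * L.s 0) L.z L.src
  | l + 1 => sweeps L.dist (L.W (l + 1)) (2 * L.s (l + 1)) (8 * L.s (l + 1)) L.z (G l)

/-- The start of a copy of the window of level `l` at `a` that contains a border. -/
def Y (l a : ℕ) : ℕ := if 2 * L.s l ≤ L.dist a then L.G l a else a

def pw (x : ℕ) : ℕ := L.r ^ x % L.p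

def ip (x : ℕ) : ℕ := L.ri ^ x % L.p

/-- Fingerprints of prefixes. -/
def pf (x : ℕ) : ℕ := (∑ t ∈ Finset.range x, L.T t * L.r ^ t) % L.p

/-- The start of the `j`-th window of level `l`. -/
def A (l j : ℕ) : ℕ := L.W l (j / 8) + j % 8 * L.s l

/-- The words describing the window of level `l` at `a`. -/
def node (l a : ℕ) : List ℕ :=
  [L.Y l a + 2 * L.s l - L.E (L.idx (L.Y l a)), L.idx (L.Y l a),
    (L.pf a + L.p - L.pw (a - L.Y l a) * L.pf (L.Y l a) % L.p) % L.p,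
    L.pw (a - L.Y l a), L.ip (a - L.Y l a)]

/-- The words describing a position near a border. -/
def leaf (x : ℕ) : List ℕ :=
  [L.T x, L.pf x, (L.pf x + L.T x * L.pw x) % L.p, L.ip x]

def header : List ℕ := [L.z, L.p, L.r, L.cl, L.s 0]

def level (l : ℕ) : List ℕ := (List.range (8 * L.z)).flatMap (fun j => L.node l (L.A l j))

def leaves : List ℕ := (List.range (L.z * (4 * L.cl))).flatMap
  (fun k => L.leaf (L.W (L.m + 1) (k / (4 * L.cl)) + k % (4 * L.cl)))

/-- The data structure. -/
def D : List ℕ := L.header ++ (List.range (L.m + 1)).flatMap L.level ++ L.leaves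

/-- The positions of the text. -/
def Real (x : ℕ) : Prop := L.M ≤ x ∧ x < L.M + L.n

/-- What correctness uses of the decoded parse. Since `dist`, `idx` and `src` vanish outside the
text, windows may reach into the padding without being clipped. `E_zero` says that the first
character is itself a border, so a window that enters the text from the left padding is close to
border 0. -/
structure Good : Prop where
  z_pos : 0 < L.z
  z_le : L.z ≤ L.n
  cl_pos : 0 < L.cl
  n_le : L.n ≤ L.z * L.s 0
  E_zero : L.E 0 = L.M
  E_mono : ∀ q₁ q₂, q₁ ≤ q₂ → q₂ < L.z → L.E q₁ ≤ L.E q₂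
  E_real : ∀ q < L.z, L.Real (L.E q)
  idx_lt : ∀ x, L.idx x < L.z
  E_idx : ∀ x, L.Real x → L.E (L.idx x) = x + L.dist x
  dist_out : ∀ x, ¬ L.Real x → L.dist x = 0
  idx_out : ∀ x, ¬ L.Real x → L.idx x = 0
  src_out : ∀ x, ¬ L.Real x → L.src x = 0
  src_self : ∀ x, L.Real x → L.dist x = 0 → L.src x = x
  src_lt : ∀ x, L.Real x → 0 < L.dist x → L.M ≤ L.src x ∧ L.src x < x
  src_eq : ∀ x, L.Real x → ∀ t < L.dist x, L.T (x + t) = L.T (L.src x + t)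

/-- `y` is an earlier position, at distance less than `b` from a border, at which the text agrees
with the text at `x` for `b` positions or up to the border following `x`. -/
structure Link (b x y : ℕ) : Prop where
  ge : L.M ≤ y
  le : y ≤ x
  lt : 0 < L.dist x → y < x
  self : L.dist x = 0 → y = x
  dist : L.dist y < b
  eq : ∀ t < b, t < L.dist x → L.T (x + t) = L.T (y + t)

variable {L}

theorem Good.s_pos (h : L.Good) (l : ℕ) : 0 < L.s l := Nat.mul_pos h.cl_pos (by positivity)

theorem s_succ {l : ℕ} (hl : l < L.m) : L.s l = 2 * L.s (l + 1) := by
  have : L.m - l = (L.m - (l + 1)) + 1 := by omega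
  rw [s, s, this, pow_succ]; ring

theorem cl_le (l : ℕ) : L.cl ≤ L.s l :=
  Nat.le_mul_of_pos_right _ (by positivity)

theorem s_last : L.s L.m = L.cl := by simp [s]

theorem Good.M_pos (h : L.Good) : 0 < L.M := by
  have := h.s_pos 0
  unfold M; omega

theorem s_le_zero (l : ℕ) : L.s l ≤ L.s 0 :=
  Nat.mul_le_mul_left _ (Nat.pow_le_pow_right (by norm_num) (by omega))

/-- Agreement passes from `y` to `y'`: the jump is made only if `b ≤ dist y`, so all the offsets
below `b` that matter for `x` are also covered by the link from `y`. -/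
theorem Link.step {b b' x y y' : ℕ} (h : L.Link b' x y) (hb0 : 0 < b) (hb : b ≤ b')
    (h' : b ≤ L.dist y → L.Link b y y') :
    L.Link b x (if b ≤ L.dist y then y' else y) := by
  split_ifs with hd
  · have g := h' hd
    refine ⟨g.ge, g.le.trans h.le, fun hx => g.le.trans_lt (h.lt hx),
      fun hx => by rw [h.self hx, hx] at hd; omega, g.dist, fun t ht htx => ?_⟩
    rw [h.eq t (by omega) htx, g.eq t ht (by omega)]
  · exact ⟨h.ge, h.le, h.lt, h.self, by omega, fun t ht htx => h.eq t (by omega) htx⟩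

/-- `x` is in one of the first `q` windows. -/
def Covered (W : ℕ → ℕ) (len q x : ℕ) : Prop := ∃ i < q, W i ≤ x ∧ x < W i + len

/-- State after the first `q` windows and `k` positions of the next one. Windows may overlap, so a
pointer still to be visited may be final already; hence the disjunction in `all`. -/
structure SweepInv (L : Layout) (W : ℕ → ℕ) (len b b' q k : ℕ) (g : ℕ → ℕ) : Prop where
  out : ∀ x, ¬ L.Real x → g x = 0
  all : ∀ x, L.Real x → Covered W len L.z x → L.Link b x (g x) ∨ L.Link b' x (g x)
  done : ∀ x, L.Real x → Covered W len q x ∨ (W q ≤ x ∧ x < W q + k) → L.Link b x (g x)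

/-- If the pointer of `x` is too far from a border, its target `g x < x` has been treated already,
by `hc`. The pointer of the target is thus final, and one jump makes that of `x` final. -/
theorem SweepInv.step (hL : L.Good) {W : ℕ → ℕ} {len b b' q k : ℕ} {g : ℕ → ℕ}
    (hb0 : 0 < b) (hb : b ≤ b') (hq : q < L.z) (hk : k < len)
    (hc : ∀ q < L.z, ∀ x y, L.Real x → L.Real y → W q ≤ x → x < W q + len → y < x →
      L.dist y < b' → Covered W len q y ∨ W q ≤ y)
    (h : SweepInv L W len b b' q k g) :
    SweepInv L W len b b' q (k + 1) (sweepStep L.dist b g (W q + k)) := by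
  set x := W q + k with hx
  by_cases hR : L.Real x
  · have key : L.Link b x (sweepStep L.dist b g x x) := by
      rw [sweepStep, Function.update_self]
      rcases h.all x hR ⟨q, hq, by omega, by omega⟩ with h1 | h1
      · rw [if_neg (by have := h1.dist; omega)]; exact h1
      · refine h1.step hb0 hb fun hd => ?_
        have hne : g x < x := h1.lt (Nat.pos_of_ne_zero fun h0 => by
          rw [h1.self h0, h0] at hd; omega)
        have hyR : L.Real (g x) := ⟨h1.ge, hne.trans hR.2⟩
        refine h.done _ hyR ?_
        rcases hc q hq x (g x) hR hyR (by omega) (by omega) hne h1.dist with h2 | h2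
        · exact Or.inl h2
        · exact Or.inr ⟨h2, by omega⟩
    have hne : ∀ y, y ≠ x → sweepStep L.dist b g x y = g y := fun y hy => by
      rw [sweepStep, Function.update_of_ne hy]
    refine ⟨fun y hy => ?_, fun y hy hyc => ?_, fun y hy hyc => ?_⟩
    · rw [hne y (by rintro rfl; exact hy hR)]; exact h.out y hy
    · by_cases hyx : y = x
      · rw [hyx]; exact Or.inl key
      · rw [hne y hyx]; exact h.all y hy hyc
    · by_cases hyx : y = x
      · rw [hyx]; exact key
      · rw [hne y hyx]
        refine h.done y hy (hyc.imp_right fun h2 => ⟨h2.1, by omega⟩)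
  -- Outside the text the pointer is 0, which is a padding position with distance 0, so the update
  -- changes nothing.
  · have hg : sweepStep L.dist b g x = g := by
      have h0 : L.dist 0 = 0 := hL.dist_out 0 (fun h => by have := hL.M_pos; have := h.1; omega)
      rw [sweepStep, h.out x hR, h0, if_neg (by omega)]
      conv_rhs => rw [← Function.update_eq_self x g, h.out x hR]
    rw [hg]
    refine ⟨h.out, h.all, fun y hy hyc => h.done y hy (hyc.imp_right fun h2 => ⟨h2.1, ?_⟩)⟩
    have : y ≠ x := by rintro rfl; exact hR hy
    omega

theorem SweepInv.sweeps (hL : L.Good) {W : ℕ → ℕ} {len b b' : ℕ} {g : ℕ → ℕ}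
    (hb0 : 0 < b) (hb : b ≤ b')
    (hc : ∀ q < L.z, ∀ x y, L.Real x → L.Real y → W q ≤ x → x < W q + len → y < x →
      L.dist y < b' → Covered W len q y ∨ W q ≤ y)
    (hout : ∀ x, ¬ L.Real x → g x = 0)
    (hall : ∀ x, L.Real x → Covered W len L.z x → L.Link b' x (g x)) :
    ∀ q ≤ L.z, SweepInv L W len b b' q 0 (sweeps L.dist W b len q g) := by
  intro q
  induction q with
  | zero =>
    intro _
    refine ⟨hout, fun x h1 h2 => Or.inr (hall x h1 h2), fun x _ h2 => ?_⟩
    rcases h2 with ⟨i, hi, -⟩ | h2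
    · omega
    · omega
  | succ q ih =>
    intro hq
    have H : ∀ k ≤ len, SweepInv L W len b b' q k
        (sweep L.dist b (W q) k (_root_.sweeps L.dist W b len q g)) := by
      intro k
      induction k with
      | zero => exact fun _ => ih (by omega)
      | succ k ihk => exact fun hk => (ihk (by omega)).step hL hb0 hb (by omega) (by omega) hc
    have H' := H len le_rfl
    refine ⟨H'.out, H'.all, fun x hx h2 => H'.done x hx ?_⟩
    rcases h2 with ⟨i, hi, h3⟩ | h2
    · rcases Nat.lt_succ_iff_lt_or_eq.1 hi with h4 | rfl
      · exact Or.inl ⟨i, h4, h3⟩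
      · exact Or.inr h3
    · omega

theorem Good.dist_lt (h : L.Good) (x : ℕ) : L.dist x < L.n + 1 := by
  by_cases hx : L.Real x
  · have h1 := h.E_idx x hx
    have h2 := (h.E_real _ (h.idx_lt x)).2
    have := hx.1
    omega
  · rw [h.dist_out x hx]; omega

theorem Good.covered_zero (h : L.Good) {x : ℕ} (hx : L.Real x) :
    Covered (L.W 0) (8 * L.s 0) L.z x := by
  have hs := h.s_pos 0
  have h1 := hx.1
  have h2 := hx.2
  have h3 := h.n_le
  have e := Nat.div_add_mod (x - L.M) (8 * L.s 0)
  have e' := Nat.mod_lt (x - L.M) (show 0 < 8 * L.s 0 by omega)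
  refine ⟨(x - L.M) / (8 * L.s 0), ?_, ?_, ?_⟩
  · rw [Nat.div_lt_iff_lt_mul (by omega)]
    have : L.z * (8 * L.s 0) = 8 * (L.z * L.s 0) := by ring
    omega
  · have : L.W 0 ((x - L.M) / (8 * L.s 0)) = L.M + 8 * L.s 0 * ((x - L.M) / (8 * L.s 0)) := by
      simp only [W]; ring
    omega
  · have : L.W 0 ((x - L.M) / (8 * L.s 0)) = L.M + 8 * L.s 0 * ((x - L.M) / (8 * L.s 0)) := by
      simp only [W]; ring
    omega

/-- Induction on levels: the pointers of level `l`, which land within `2 * s l` of a border, are the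
input of level `l + 1`. Their targets therefore lie in neighbourhoods of level `l + 1`, which is why
sweeping only those suffices. -/
theorem Good.G_inv (h : L.Good) : ∀ l ≤ L.m, (∀ x, ¬ L.Real x → L.G l x = 0) ∧
    ∀ x, L.Real x → Covered (L.W l) (8 * L.s l) L.z x → L.Link (2 * L.s l) x (L.G l x) := by
  intro l
  induction l with
  | zero =>
    intro _
    have hs := h.s_pos 0
    -- The second entry of the maximum exceeds every distance, so the original sources qualify as
    -- links; the first gives `b ≤ b'`.
    have hlink : ∀ x, L.Real x → L.Link (max (2 * L.s 0) (L.n + 1)) x (L.src x) := by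
      intro x hx
      have hd := lt_max_of_lt_right (b := 2 * L.s 0) (h.dist_lt (L.src x))
      by_cases h0 : L.dist x = 0
      · have := h.src_self x hx h0
        exact ⟨by rw [this]; exact hx.1, by rw [this], by omega, fun _ => this, hd,
          by omega⟩
      · have h1 := h.src_lt x hx (by omega)
        exact ⟨h1.1, h1.2.le, fun _ => h1.2, by omega, hd, fun t _ ht => h.src_eq x hx t ht⟩
    have I := SweepInv.sweeps h (W := L.W 0) (len := 8 * L.s 0) (b := 2 * L.s 0)
      (b' := max (2 * L.s 0) (L.n + 1)) (g := L.src) (by omega) (le_max_left _ _)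
      (fun q hq x y hx hy h1 h2 h3 _ => by
        rcases lt_or_ge y (L.W 0 q) with h4 | h4
        · obtain ⟨i, hi, h5, h6⟩ := h.covered_zero hy
          refine Or.inl ⟨i, ?_, h5, h6⟩
          by_contra hc
          have : L.W 0 q ≤ L.W 0 i := by
            simp only [W]; gcongr; omega
          omega
        · exact Or.inr h4) h.src_out (fun x hx _ => hlink x hx) L.z le_rfl
    exact ⟨I.out, fun x hx hc => I.done x hx (Or.inl hc)⟩
  | succ l ih =>
    intro hl
    have hs := h.s_pos (l + 1)
    have e := s_succ (L := L) (l := l) (by omega)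
    have hM : 4 * L.s l ≤ L.M := Nat.mul_le_mul_left _ (s_le_zero l)
    obtain ⟨ho, hi⟩ := ih (by omega)
    -- Neighbourhoods are nested: the radius around a border halves from one level to the next, and
    -- level 0 covers the whole text.
    have hcov : ∀ x, L.Real x → Covered (L.W (l + 1)) (8 * L.s (l + 1)) L.z x →
        Covered (L.W l) (8 * L.s l) L.z x := by
      rintro x hx ⟨q, hq, h1, h2⟩
      cases l with
      | zero => exact h.covered_zero hx
      | succ l =>
        have e' := s_succ (L := L) (l := l) (by omega)
        have := (h.E_real q hq).1
        have hM : 4 * L.s l ≤ L.M := Nat.mul_le_mul_left _ (s_le_zero l)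
        refine ⟨q, hq, ?_, ?_⟩
        · simp only [W] at *; omega
        · simp only [W] at *; omega
    have I := SweepInv.sweeps h (W := L.W (l + 1)) (len := 8 * L.s (l + 1))
      (b := 2 * L.s (l + 1)) (b' := 2 * L.s l) (g := L.G l) (by omega) (by omega)
      (fun q hq x y hx hy h1 h2 h3 h4 => by
        rcases lt_or_ge y (L.W (l + 1) q) with h5 | h5
        · have e1 := h.E_idx y hy
          have e2 := (h.E_real q hq).1
          have e3 := (h.E_real _ (h.idx_lt y)).1
          -- Being within `2 * s l` of its own border, `y` is in the window of its own phrase. That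
          -- phrase precedes `q`, as otherwise `y` could not lie before the start of window `q`.
          refine Or.inl ⟨L.idx y, ?_, ?_, ?_⟩
          · by_contra hc
            have := h.E_mono q (L.idx y) (by omega) (h.idx_lt y)
            simp only [W] at *; omega
          · simp only [W] at *; omega
          · simp only [W] at *; omega
        · exact Or.inr h5) ho (fun x hx hc => hi x hx (hcov x hx hc)) L.z le_rfl
    exact ⟨I.out, fun x hx hc => I.done x hx (Or.inl hc)⟩

/-- Correctness of the pointer of the window of level `l` at `a`. -/
theorem Good.Y_spec (h : L.Good) {l q a : ℕ} (hl : l ≤ L.m) (hq : q < L.z)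
    (h1 : L.W l q ≤ a) (h2 : a < L.W l q + 8 * L.s l) :
    L.Y l a ≤ a ∧ (∀ t < 2 * L.s l, L.T (a + t) = L.T (L.Y l a + t)) ∧
    (L.Real a → L.M ≤ L.Y l a ∧ L.dist (L.Y l a) < 2 * L.s l) ∧
    (¬ L.Real a → L.Y l a = a) := by
  by_cases ha : L.Real a
  · unfold Y
    split_ifs with hd
    · have := (h.G_inv l hl).2 a ha ⟨q, hq, h1, h2⟩
      exact ⟨this.le, fun t ht => this.eq t ht (by omega), fun _ => ⟨this.ge, this.dist⟩,
        fun hc => absurd ha hc⟩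
    · exact ⟨le_rfl, fun _ _ => rfl, fun _ => ⟨ha.1, by omega⟩, fun _ => rfl⟩
  · have : L.Y l a = a := by
      unfold Y
      rw [h.dist_out a ha, if_neg]
      have := h.s_pos l
      omega
    exact ⟨this.le, fun t _ => by rw [this], fun hc => absurd hc ha, fun _ => this⟩

/-! ### Coordinates of a position and one step of the descent -/

/-- The position with coordinates `(q, u)` at level `l` is `x`. -/
structure Pos (L : Layout) (l x q u : ℕ) : Prop where
  q_lt : q < L.z
  eq : x = L.W l q + u
  real : L.Real x
  zero : l = 0 → q = 0
  pos : ∀ k, l = k + 1 → u + L.cl ≤ 4 * L.s k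

/-- At level 0 the blocks of eight windows are contiguous, so window `j` starts at `M + j * s 0` and
`q = 0` loses nothing. At later levels `u < 4 * s k = 8 * s (k + 1)` keeps the quotient below eight.
-/
theorem Pos.window (h : L.Good) {l x q u : ℕ} (hx : Pos L l x q u) (hl : l ≤ L.m) :
    8 * q + u / L.s l < 8 * L.z ∧
    L.A l (8 * q + u / L.s l) + u % L.s l = x ∧
    ∃ q' < L.z, L.W l q' ≤ L.A l (8 * q + u / L.s l) ∧
      L.A l (8 * q + u / L.s l) < L.W l q' + 8 * L.s l := by
  have hs := h.s_pos l
  have e := Nat.div_add_mod u (L.s l)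
  have hcl := h.cl_pos
  have hq := hx.q_lt
  cases l with
  | zero =>
    obtain rfl := hx.zero rfl
    have hx1 := hx.eq
    have hx2 := hx.real.2
    have hn := h.n_le
    have hW : L.W 0 0 = L.M := by simp [W]
    have hu : u / L.s 0 < L.z := by
      rw [Nat.div_lt_iff_lt_mul hs]; omega
    have hA : L.A 0 (8 * 0 + u / L.s 0) = L.M + L.s 0 * (u / L.s 0) := by
      have e2 := Nat.div_add_mod (u / L.s 0) 8
      simp only [A, W, mul_zero, zero_add]
      conv_rhs => rw [← e2]
      ring
    refine ⟨by omega, by omega, u / L.s 0 / 8, by omega, ?_, ?_⟩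
    · simp only [A, mul_zero, zero_add]; omega
    · simp only [A, mul_zero, zero_add]
      have : u / L.s 0 % 8 * L.s 0 < 8 * L.s 0 :=
        Nat.mul_lt_mul_of_pos_right (Nat.mod_lt _ (by norm_num)) hs
      omega
  | succ l =>
    have hp := hx.pos l rfl
    rw [s_succ (by omega)] at hp
    have hu : u / L.s (l + 1) < 8 := by
      rw [Nat.div_lt_iff_lt_mul hs]; omega
    have e1 : (8 * q + u / L.s (l + 1)) / 8 = q := by
      generalize u / L.s (l + 1) = k at hu; omega
    have e2 : (8 * q + u / L.s (l + 1)) % 8 = u / L.s (l + 1) := by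
      generalize u / L.s (l + 1) = k at hu; omega
    have hA : L.A (l + 1) (8 * q + u / L.s (l + 1))
        = L.W (l + 1) q + L.s (l + 1) * (u / L.s (l + 1)) := by
      simp only [A, e1, e2]; ring
    have : L.s (l + 1) * (u / L.s (l + 1)) < 8 * L.s (l + 1) := by
      rw [mul_comm]; exact Nat.mul_lt_mul_of_pos_right hu hs
    refine ⟨by omega, ?_, q, hq, by omega, by omega⟩
    rw [hA, hx.eq]; omega

/-- Following the pointer of a window. -/
theorem Pos.step (h : L.Good) {l x q u : ℕ} (hx : Pos L l x q u) (hl : l ≤ L.m) {a y : ℕ}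
    (ha : a = L.A l (8 * q + u / L.s l)) (hy : y = L.Y l a) :
    Pos L (l + 1) (y + u % L.s l) (L.idx y) (u % L.s l + (y + 2 * L.s l - L.E (L.idx y))) ∧
    a + u % L.s l = x ∧ y ≤ a ∧ ∀ t < 2 * L.s l, L.T (a + t) = L.T (y + t) := by
  obtain ⟨-, h2, q', hq', h3, h4⟩ := hx.window h hl
  obtain ⟨g1, g2, g3, g4⟩ := h.Y_spec hl hq' h3 h4
  rw [← ha] at h2 h3 h4 g1 g2 g3 g4
  rw [← hy] at g1 g2 g3 g4
  have hs := h.s_pos l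
  have ho := Nat.mod_lt u hs
  have hcl := cl_le (L := L) l
  have hr1 := hx.real.1
  have hr2 := hx.real.2
  have hM : 4 * L.s l ≤ L.M := Nat.mul_le_mul_left _ (s_le_zero l)
  refine ⟨?_, h2, g1, g2⟩
  by_cases hR : L.Real a
  · obtain ⟨f1, f2⟩ := g3 hR
    have hyR : L.Real y := ⟨f1, g1.trans_lt hR.2⟩
    have e := h.E_idx y hyR
    refine ⟨h.idx_lt y, ?_, ⟨by omega, by omega⟩, by omega, ?_⟩
    · simp only [W]; omega
    · rintro k hk
      obtain rfl : l = k := by omega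
      omega
  -- The window starts in the left padding but reaches `x`, so it starts less than `s l` before `M`,
  -- the border of phrase 0. This is the phrase that `idx` names outside the text.
  · have hya := g4 hR
    have hlt : a < L.M := by
      by_contra hc
      exact hR ⟨by omega, by omega⟩
    have e : L.idx y = 0 := h.idx_out y (by rw [hya]; exact hR)
    rw [e, h.E_zero]
    refine ⟨h.z_pos, ?_, ⟨by omega, by omega⟩, by omega, ?_⟩
    · simp only [W, h.E_zero]; omega
    · rintro k hk
      obtain rfl : l = k := by omega
      omega

end Layout

/-! ### Reading the data structure -/

theorem List.length_flatMap_range {α : Type*} (f : ℕ → List α) (c : ℕ) (hf : ∀ j, (f j).length = c)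
    (N : ℕ) : ((List.range N).flatMap f).length = N * c := by
  induction N with
  | zero => simp
  | succ N ih => rw [List.range_succ, List.flatMap_append, List.length_append, ih]; simp [hf]; ring

theorem List.getD_flatMap_range {α : Type*} (f : ℕ → List α) (c : ℕ) (hf : ∀ j, (f j).length = c)
    (d : α) {N j o : ℕ} (hj : j < N) (ho : o < c) :
    ((List.range N).flatMap f).getD (j * c + o) d = (f j).getD o d := by
  induction N with
  | zero => omega
  | succ N ih =>
    have hl := List.length_flatMap_range f c hf N
    rw [List.range_succ, List.flatMap_append]
    rcases Nat.lt_succ_iff_lt_or_eq.1 hj with h | rfl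
    · have : j * c + o < N * c := by
        calc j * c + o < (j + 1) * c := by rw [Nat.add_mul]; omega
          _ ≤ N * c := Nat.mul_le_mul_right _ h
      rw [List.getD_append _ _ _ _ (by omega), ih h]
    · rw [List.getD_append_right _ _ _ _ (by omega), hl]
      simp

/-! ### Addresses of the stored words -/

namespace Layout

variable {L : Layout}

theorem length_level (l : ℕ) : (L.level l).length = 40 * L.z := by
  rw [level, List.length_flatMap_range _ 5 (fun _ => rfl)]; ring

theorem length_leaves : L.leaves.length = L.z * (4 * L.cl) * 4 :=
  List.length_flatMap_range _ 4 (fun _ => rfl) _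

theorem length_levels (k : ℕ) :
    ((List.range k).flatMap L.level).length = k * (40 * L.z) :=
  List.length_flatMap_range _ _ length_level _

theorem length_D : L.D.length = 5 + (L.m + 1) * (40 * L.z) + L.z * (4 * L.cl) * 4 := by
  simp only [D, List.length_append, length_levels, length_leaves, header, List.length_cons,
    List.length_nil]

theorem D_header {f : ℕ} (hf : f < 5) : L.D.getD f 0 = L.header.getD f 0 := by
  rw [D, List.append_assoc, List.getD_append _ _ _ _ hf]

theorem D_node {l j f : ℕ} (hl : l ≤ L.m) (hj : j < 8 * L.z) (hf : f < 5) :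
    L.D.getD (5 + l * (40 * L.z) + 5 * j + f) 0 = (L.node l (L.A l j)).getD f 0 := by
  have h1 : l * (40 * L.z) + (5 * j + f) < (L.m + 1) * (40 * L.z) := by
    calc _ < (l + 1) * (40 * L.z) := by rw [Nat.add_mul l]; omega
      _ ≤ _ := Nat.mul_le_mul_right _ (by omega)
  have hh : L.header.length = 5 := rfl
  rw [D, List.append_assoc, List.getD_append_right _ _ _ _ (by omega),
    List.getD_append _ _ _ _ (by rw [length_levels]; omega),
    show 5 + l * (40 * L.z) + 5 * j + f - L.header.length = l * (40 * L.z) + (5 * j + f) by omega,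
    List.getD_flatMap_range _ _ length_level 0 (by omega) (by omega), level, mul_comm 5 j,
    List.getD_flatMap_range _ 5 (fun _ => rfl) 0 hj hf]

theorem D_leaf {q u f : ℕ} (hq : q < L.z) (hu : u < 4 * L.cl) (hf : f < 4) :
    L.D.getD (5 + (L.m + 1) * (40 * L.z) + 4 * (q * (4 * L.cl) + u) + f) 0 =
      (L.leaf (L.W (L.m + 1) q + u)).getD f 0 := by
  have hh : L.header.length = 5 := rfl
  have hk : q * (4 * L.cl) + u < L.z * (4 * L.cl) := by
    calc _ < (q + 1) * (4 * L.cl) := by rw [Nat.add_mul q]; omega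
      _ ≤ _ := Nat.mul_le_mul_right _ hq
  have e1 : (q * (4 * L.cl) + u) / (4 * L.cl) = q := by
    rw [mul_comm q, Nat.mul_add_div (by omega), Nat.div_eq_of_lt hu, add_zero]
  have e2 : (q * (4 * L.cl) + u) % (4 * L.cl) = u := by
    rw [mul_comm q, Nat.mul_add_mod, Nat.mod_eq_of_lt hu]
  rw [D, List.getD_append_right _ _ _ _ (by
      rw [List.length_append, length_levels]; omega), List.length_append, length_levels, hh,
    show 5 + (L.m + 1) * (40 * L.z) + 4 * (q * (4 * L.cl) + u) + f - (5 + (L.m + 1) * (40 * L.z))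
      = (q * (4 * L.cl) + u) * 4 + f by omega, leaves,
    List.getD_flatMap_range _ 4 (fun _ => rfl) 0 hk hf, e1, e2]

/-! ### Prefix fingerprints and their change along the descent -/

/-- Fingerprints of prefixes, as residues. -/
noncomputable def PF (L : Layout) (x : ℕ) : ZMod L.p :=
  ∑ t ∈ Finset.range x, (L.T t : ZMod L.p) * (L.r : ZMod L.p) ^ t

theorem cast_pf (x : ℕ) : ((L.pf x : ℕ) : ZMod L.p) = L.PF x := by
  simp [pf, PF]

theorem cast_pw (x : ℕ) : ((L.pw x : ℕ) : ZMod L.p) = (L.r : ZMod L.p) ^ x := by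
  simp [pw]

theorem cast_ip (x : ℕ) : ((L.ip x : ℕ) : ZMod L.p) = (L.ri : ZMod L.p) ^ x := by
  simp [ip]

theorem PF_succ (x : ℕ) : L.PF (x + 1) = L.PF x + L.T x * (L.r : ZMod L.p) ^ x :=
  Finset.sum_range_succ _ _

/-- Equal characters contribute with weights that differ by the constant factor `r ^ (a - y)`. -/
theorem PF_shift {a y : ℕ} (hy : y ≤ a) (k : ℕ) (h : ∀ t < k, L.T (a + t) = L.T (y + t)) :
    L.PF (a + k) = L.PF a + (L.r : ZMod L.p) ^ (a - y) * (L.PF (y + k) - L.PF y) := by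
  induction k with
  | zero => simp
  | succ k ih =>
    rw [← Nat.add_assoc, ← Nat.add_assoc, PF_succ, PF_succ, ih (fun t ht => h t (by omega)),
      h k (by omega)]
    obtain ⟨d, rfl⟩ := Nat.exists_eq_add_of_le hy
    rw [Nat.add_sub_cancel_left, pow_add, pow_add, pow_add]
    ring

/-- Adding `p` before the subtraction prevents truncation; stored and returned differences have this
form. -/
theorem cast_sub_mod {p a b : ℕ} (hp : 0 < p) :
    (((a + p - b % p) % p : ℕ) : ZMod p) = (a : ZMod p) - b := by
  have : b % p ≤ a + p := (Nat.mod_lt b hp).le.trans (Nat.le_add_left _ _)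
  rw [ZMod.natCast_mod, Nat.cast_sub this]
  simp

/-- The relation between a position `x₀` of the text and the variables of the query programs
at level `l`. -/
structure Descent (L : Layout) (l x₀ x q u α β γ : ℕ) : Prop where
  pos : Pos L l x q u
  eq : ∀ t < L.cl, L.T (x₀ + t) = L.T (x + t)
  pre : (α : ZMod L.p) + β * L.PF x = L.PF x₀
  pre_succ : (α : ZMod L.p) + β * L.PF (x + 1) = L.PF (x₀ + 1)
  inv : (γ : ZMod L.p) * (L.ri : ZMod L.p) ^ x = (L.ri : ZMod L.p) ^ x₀

theorem Descent.init (h : L.Good) {x : ℕ} (hx : L.Real x) :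
    Descent L 0 x x 0 (x - L.M) 0 1 1 := by
  refine ⟨⟨h.z_pos, ?_, hx, fun _ => rfl, fun k hk => by omega⟩, fun _ _ => rfl, by simp, by simp,
    by simp⟩
  have := hx.1
  simp only [W]; omega

/-- A node stores the affine map `PF (y + o) ↦ PF (a + o)`, with slope `r ^ (a - y)` and intercept
`PF a - r ^ (a - y) * PF y`, which do not depend on `o`. Composing it with the current map gives the
new `α` and `β`. -/
theorem Descent.step (h : L.Good) (hp : 0 < L.p) {l x₀ x q u α β γ : ℕ}
    (hd : Descent L l x₀ x q u α β γ) (hl : l ≤ L.m) {e : List ℕ}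
    (he : e = L.node l (L.A l (8 * q + u / L.s l))) :
    ∃ x', Descent L (l + 1) x₀ x' (e.getD 1 0) (u % L.s l + e.getD 0 0)
      ((α + β * e.getD 2 0) % L.p) (β * e.getD 3 0 % L.p) (γ * e.getD 4 0 % L.p) := by
  set a := L.A l (8 * q + u / L.s l) with ha
  set y := L.Y l a with hy
  obtain ⟨h1, h2, h3, h4⟩ := hd.pos.step h hl ha hy
  have hs := h.s_pos l
  have ho := Nat.mod_lt u hs
  have hcl := cl_le (L := L) l
  set o := u % L.s l
  have e0 : e.getD 0 0 = y + 2 * L.s l - L.E (L.idx y) := by rw [he]; rfl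
  have e1 : e.getD 1 0 = L.idx y := by rw [he]; rfl
  have e2 : e.getD 2 0 = (L.pf a + L.p - L.pw (a - y) * L.pf y % L.p) % L.p := by rw [he]; rfl
  have e3 : e.getD 3 0 = L.pw (a - y) := by rw [he]; rfl
  have e4 : e.getD 4 0 = L.ip (a - y) := by rw [he]; rfl
  refine ⟨y + o, ?_⟩
  rw [e0, e1, e2, e3, e4]
  -- Since `o < s l` and `cl ≤ s l`, the offset itself, its successor and the `cl` characters read
  -- ahead all stay within the `2 * s l` characters on which the copy agrees.
  have k1 : L.PF x = _ := h2 ▸ PF_shift h3 o (fun t ht => h4 t (by omega))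
  have k2 := PF_shift h3 (o + 1) (fun t ht => h4 t (by omega))
  rw [← Nat.add_assoc, h2, ← Nat.add_assoc] at k2
  refine ⟨h1, fun t ht => ?_, ?_, ?_, ?_⟩
  · rw [hd.eq t ht, ← h2, Nat.add_assoc, h4 _ (by omega), Nat.add_assoc]
  · rw [← hd.pre, k1, ZMod.natCast_mod, ZMod.natCast_mod, Nat.cast_add, Nat.cast_mul, Nat.cast_mul,
      cast_sub_mod hp, cast_pf, Nat.cast_mul, cast_pw, cast_pf]
    ring
  · rw [← hd.pre_succ, k2, ZMod.natCast_mod, ZMod.natCast_mod, Nat.cast_add, Nat.cast_mul,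
      Nat.cast_mul, cast_sub_mod hp, cast_pf, Nat.cast_mul, cast_pw, cast_pf]
    ring_nf
  · rw [← hd.inv, ZMod.natCast_mod, Nat.cast_mul, cast_ip, ← h2, mul_assoc, ← pow_add]
    congr 2
    omega

theorem getD_substr (S : List ℕ) (i j t : ℕ) (ht : t < j - i) :
    (LZ.substr S (i + 1) j).getD t 0 = S.getD (i + t) 0 := by
  simp only [LZ.substr, List.getD_eq_getElem?_getD, List.getElem?_drop, List.getElem?_take,
    Nat.add_sub_cancel]
  rw [if_pos (by omega)]

theorem length_substr (S : List ℕ) (i j : ℕ) (hj : j ≤ S.length) :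
    (LZ.substr S (i + 1) j).length = j - i := by
  simp [LZ.substr, hj]

/-- The fingerprint of a substring from fingerprints of prefixes. -/
theorem fingerprint_substr {S : List ℕ} (hS : ∀ x, x < S.length → L.T (L.M + x) = S.getD x 0)
    (hr : (L.r : ZMod L.p) * L.ri = 1) {i j : ℕ} (hij : i ≤ j) (hj : j ≤ S.length) :
    ((LZ.fingerprint L.p L.r (LZ.substr S (i + 1) j) : ℕ) : ZMod L.p) =
      (L.PF (L.M + j) - L.PF (L.M + i)) * (L.ri : ZMod L.p) ^ (L.M + i) := by
  have key : ∀ k, i + k ≤ S.length → (L.PF (L.M + (i + k)) - L.PF (L.M + i)) *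
      (L.ri : ZMod L.p) ^ (L.M + i) =
      ∑ t ∈ Finset.range k, (S.getD (i + t) 0 : ZMod L.p) * (L.r : ZMod L.p) ^ t := by
    intro k
    induction k with
    | zero => simp
    | succ k ih =>
      intro hk
      rw [Finset.sum_range_succ, ← ih (by omega), ← Nat.add_assoc i, ← Nat.add_assoc L.M, PF_succ,
        hS (i + k) (by omega), show L.M + (i + k) = k + (L.M + i) by omega, pow_add]
      have : (L.r : ZMod L.p) ^ (L.M + i) * (L.ri : ZMod L.p) ^ (L.M + i) = 1 := by
        rw [← mul_pow, hr, one_pow]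
      linear_combination (S.getD (i + k) 0 : ZMod L.p) * (L.r : ZMod L.p) ^ k * this
  have hk := key (j - i) (by omega)
  rw [show i + (j - i) = j by omega] at hk
  rw [hk, LZ.fingerprint, ZMod.natCast_mod, length_substr S i j hj, Nat.cast_sum]
  refine Finset.sum_congr rfl fun t ht => ?_
  rw [getD_substr S i j t (Finset.mem_range.1 ht), Nat.cast_mul, Nat.cast_pow]

end Layout

/-! ### The query programs -/

namespace RAM

open Ex Instr

/-- Loads the header of the data structure. -/
def loadHeader : List Instr :=
  [asg 2 (ld (lit 0)), asg 3 (ld (lit 1)), asg 4 (ld (lit 2)), asg 5 (ld (lit 3)),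
    asg 6 (ld (lit 4)), asg 17 (lit 40 * var 2), asg 15 (var 0 - lit 1)]

/-- One level of the descent. -/
def descendStep : List Instr :=
  [asg 11 (var 7 + lit 5 * (lit 8 * var 8 + var 9 / var 10)),
    asg 9 (var 9 % var 10 + ld (var 11)),
    asg 8 (ld (var 11 + lit 1)),
    asg 12 ((var 12 + var 13 * ld (var 11 + lit 2)) % var 3),
    asg 13 (var 13 * ld (var 11 + lit 3) % var 3),
    asg 14 (var 14 * ld (var 11 + lit 4) % var 3),
    asg 7 (var 7 + var 17),
    asg 10 (var 10 / lit 2)]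

/-- From the position in register `9` to the address of a leaf in register `11`. -/
def descend : Prog :=
  .seq (block [asg 8 (lit 0), asg 10 (var 6), asg 7 (lit 5), asg 12 (lit 0), asg 13 (lit 1),
      asg 14 (lit 1)])
    (.seq (.loop (.le 5 10) (block descendStep))
      (block [asg 11 (var 7 + lit 4 * (var 8 * (lit 4 * var 5) + var 9))]))

/-- The words are long enough for the queries. -/
structure QueryFits (L : Layout) (w : ℕ) : Prop where
  word : ∀ a, L.D.getD a 0 < 2 ^ w
  len : L.D.length + 100 < 2 ^ w
  prime : 2 * (L.p * L.p) < 2 ^ w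
  pos : 4 * L.s 0 + L.n + L.cl < 2 ^ w
  two : 2 ≤ L.p

theorem _root_.Layout.Pos.u_lt {L : Layout} {l x q u : ℕ} (h : L.Good) (hx : L.Pos l x q u) :
    u < 4 * L.s 0 + L.n := by
  have hcl := h.cl_pos
  cases l with
  | zero =>
    have h0 := hx.zero rfl
    have := hx.eq
    have := hx.real.2
    subst h0
    simp only [Layout.W] at *
    omega
  | succ l =>
    have := hx.pos l rfl
    have := Layout.s_le_zero (L := L) l
    omega

/-- The loop counts levels by halving `s l`: it is at least `cl` up to level `m`, where it equals
`cl`, so the test fails after exactly `m + 1` rounds. -/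
theorem wp_descend {L : Layout} {w : ℕ} (h : L.Good) (hf : QueryFits L w) {x : ℕ}
    (hx : L.Real x) {σ : Cfg} {a0 a1 a7 a8 a10 a11 a12 a13 a14 a15 a16 a18 a19 : ℕ}
    (he : σ.env = [a0, a1, L.z, L.p, L.r, L.cl, L.s 0, a7, a8, x - L.M, a10, a11, a12, a13, a14,
      a15, a16, 40 * L.z, a18, a19]) (hm : ∀ a, σ.mem a = L.D.getD a 0) :
    WP w descend σ (fun σ' => ∃ b7 q u b10 α β γ x', L.Descent (L.m + 1) x x' q u α β γ ∧
      (α < L.p ∧ β < L.p ∧ γ < L.p) ∧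
      σ'.env = [a0, a1, L.z, L.p, L.r, L.cl, L.s 0, b7, q, u, b10,
        5 + (L.m + 1) * (40 * L.z) + 4 * (q * (4 * L.cl) + u), α, β, γ,
        a15, a16, 40 * L.z, a18, a19] ∧ σ'.mem = σ.mem ∧ σ'.out = σ.out ∧
      σ'.time ≤ σ.time + 100 * (L.m + 2)) := by
  obtain ⟨e, m, o, t⟩ := σ
  replace hm : ∀ a, m a = L.D.getD a 0 := hm
  subst he
  have hlen := hf.len
  have hword : ∀ a, m a < 2 ^ w := fun a => by rw [hm]; exact hf.word a
  rw [Layout.length_D] at hlen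
  have hpos := hf.pos
  have htwo := hf.two
  have hprime := hf.prime
  have hp2 : L.p ≤ L.p * L.p := Nat.le_mul_self _
  have hz : 40 * L.z ≤ (L.m + 1) * (40 * L.z) := Nat.le_mul_of_pos_left _ (by omega)
  have hcl := h.cl_pos
  generalize hB : 2 ^ w = B at *
  have h1 := hx.1
  have h2 := hx.2
  refine WP.seq (WP.block ?_ ?_)
  · rw [hB]
    simp [Oks, Instr.run, Instr.Ok, numVars]
    omega
  simp only [runs, Instr.run]
  simp only [val_lit, val_var, List.set_cons_zero, List.set_cons_succ, cost_lit, cost_var]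
  refine WP.seq (WP.loop_count (b := .le 5 10) ⟨by decide, by decide⟩ (L.m + 1)
    (fun l σ => ∃ q u b10 b11 α β γ x', L.Descent l x x' q u α β γ ∧
      (α < L.p ∧ β < L.p ∧ γ < L.p) ∧ (l ≤ L.m → b10 = L.s l) ∧ (L.m < l → b10 < L.cl) ∧
      σ.env = [a0, a1, L.z, L.p, L.r, L.cl, L.s 0, 5 + l * (40 * L.z), q, u, b10, b11, α, β, γ,
        a15, a16, 40 * L.z, a18, a19] ∧ σ.mem = m ∧ σ.out = o ∧ σ.time ≤ t + 100 * l + 20)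
    ?_ ?_ ?_)
  · rintro l hl ⟨e, m', o', t'⟩ ⟨q, u, b10, b11, α, β, γ, x', hd, ⟨hα, hβ, hγ⟩, hb, -, he, hm', ho,
      ht⟩
    simp only at he hm' ho ht
    subst he hm' ho
    obtain rfl := hb (by omega)
    obtain ⟨hj, -⟩ := hd.pos.window h (by omega)
    have hu := hd.pos.u_lt h
    have hql := hd.pos.q_lt
    have hsl := Layout.s_le_zero (L := L) l
    have hlz : l * (40 * L.z) + 40 * L.z ≤ (L.m + 1) * (40 * L.z) := by
      rw [← Nat.succ_mul]; exact Nat.mul_le_mul_right _ hl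
    have nd : ∀ f < 5, m' (5 + l * (40 * L.z) + 5 * (8 * q + u / L.s l) + f) =
        (L.node l (L.A l (8 * q + u / L.s l))).getD f 0 := fun f hf' => by
      rw [hm, Layout.D_node (by omega) hj hf']
    obtain ⟨x'', hd'⟩ := hd.step h (by omega) (by omega) rfl
    have n0 : m' (5 + l * (40 * L.z) + 5 * (8 * q + u / L.s l)) = _ := nd 0 (by norm_num)
    have n1 := nd 1 (by norm_num)
    have n2 := nd 2 (by norm_num)
    have n3 := nd 3 (by norm_num)
    have n4 := nd 4 (by norm_num)
    refine ⟨by simpa [WP.TestOn, Test.Holds] using Layout.cl_le l, WP.block ?_ ?_⟩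
    · have := hd'.pos.pos l rfl
      have c2 : (L.node l (L.A l (8 * q + u / L.s l))).getD 2 0 ≤ L.p :=
        (Nat.mod_lt _ (by omega)).le
      have c3 : (L.node l (L.A l (8 * q + u / L.s l))).getD 3 0 ≤ L.p :=
        (Nat.mod_lt _ (by omega)).le
      have c4 : (L.node l (L.A l (8 * q + u / L.s l))).getD 4 0 ≤ L.p :=
        (Nat.mod_lt _ (by omega)).le
      have b2 := Nat.mul_le_mul hβ.le c2
      have b3 := Nat.mul_le_mul hβ.le c3
      have b4 := Nat.mul_le_mul hγ.le c4
      rw [← n0] at this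
      rw [← n2] at b2
      rw [← n3] at b3
      rw [← n4] at b4
      have hs2 : u % L.s l < B := (Nat.mod_le _ _).trans_lt (by omega)
      generalize hk : u / L.s l = k at *
      rw [hB]
      simp [Oks, Instr.run, Instr.Ok, numVars, descendStep, hword, hk]
      omega
    · simp only [runs, Instr.run, descendStep, List.set_cons_zero, List.set_cons_succ]
      simp only [val_add, val_mul, val_div, val_mod, val_ld, val_lit, val_var, List.getD_cons_zero,
        List.getD_cons_succ, cost_add, cost_mul, cost_div, cost_mod, cost_ld, cost_lit, cost_var]
      rw [n0, n1, n2, n3, n4]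
      refine ⟨_, _, L.s l / 2, 5 + l * (40 * L.z) + 5 * (8 * q + u / L.s l), _, _, _, x'', hd', ⟨Nat.mod_lt _ (by omega), Nat.mod_lt _ (by omega),
        Nat.mod_lt _ (by omega)⟩, fun hl' => ?_, fun hl' => ?_, ?_, by trivial, by trivial, ?_⟩
      · rw [Layout.s_succ (by omega)]; omega
      · obtain rfl : l = L.m := by omega
        rw [Layout.s_last]; omega
      · rw [show 5 + l * (40 * L.z) + 40 * L.z = 5 + (l + 1) * (40 * L.z) by ring]
      · omega
  · rintro ⟨e, m', o', t'⟩ ⟨q, u, b10, b11, α, β, γ, x', hd, hp, -, hb, he, hm', ho, ht⟩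
    simp only at he hm' ho ht
    subst he hm' ho
    have hb := hb (by omega)
    have hu := hd.pos.pos L.m rfl
    rw [Layout.s_last] at hu
    have hq : q * (4 * L.cl) + 4 * L.cl ≤ L.z * (4 * L.cl) := by
      rw [← Nat.succ_mul]; exact Nat.mul_le_mul_right _ hd.pos.q_lt
    have hql := hd.pos.q_lt
    have hqz : L.z ≤ L.z * (4 * L.cl) := Nat.le_mul_of_pos_right _ (by omega)
    refine ⟨by simpa [WP.TestOn, Test.Holds] using hb, WP.block ?_ ?_⟩
    · rw [hB]
      simp [Oks, Instr.Ok, numVars]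
      omega
    · simp only [runs, Instr.run, List.set_cons_zero, List.set_cons_succ]
      simp only [val_add, val_mul, val_lit, val_var, List.getD_cons_zero,
        List.getD_cons_succ, cost_add, cost_mul, cost_lit, cost_var]
      refine ⟨_, _, _, _, _, _, _, x', hd, hp, rfl, by trivial, by trivial, ?_⟩
      omega
  · refine ⟨0, x - L.M, L.s 0, a11, 0, 1, 1, x, Layout.Descent.init h hx, ⟨by omega, by omega, by omega⟩,
      fun _ => rfl, by omega, ?_, by trivial, by trivial, ?_⟩
    · simp
    · simp only; omega

end RAM

/-! ### Extraction and fingerprinting -/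

namespace RAM

open Ex Instr

/-- The extraction program. -/
def extract : Prog :=
  .seq (block loadHeader) (.loop (.lt 15 1)
    (.seq (block [asg 9 (var 15)]) (.seq descend
      (.seq (block [asg 16 (var 1 - (var 1 - (var 15 + var 5)))])
        (.loop (.lt 15 16)
          (block [emi (ld (var 11)), asg 11 (var 11 + lit 4), asg 15 (var 15 + lit 1)]))))))

/-- The fingerprinting program. -/
def fprint : Prog :=
  .seq (block loadHeader) (.ite (.lt 1 0) (block [emi (lit 0)])
    (.seq (block [asg 9 (var 15)]) (.seq descend
      (.ite (.eq 4 18) (block [emi (ld (var 11) % var 3)])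
        (.seq (block [asg 18 ((var 12 + var 13 * ld (var 11 + lit 1)) % var 3),
            asg 19 (var 14 * ld (var 11 + lit 3) % var 3), asg 9 (var 1 - lit 1)])
          (.seq descend
            (block [asg 12 ((var 12 + var 13 * ld (var 11 + lit 2)) % var 3),
              emi ((var 12 + var 3 - var 18) % var 3 * var 19 % var 3)])))))))

variable {L : Layout} {w : ℕ}

theorem wp_loadHeader (h : L.Good) (hf : QueryFits L w) {m : ℕ → ℕ} (hm : ∀ a, m a = L.D.getD a 0) {i j : ℕ}
    (hi : i ≤ L.n + 1) : WP w (block loadHeader)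
      ⟨[i, j, 0, 0, 0, 0, 0, 0, 0, 0, 0, 0, 0, 0, 0, 0, 0, 0, 0, 0], m, [], 0⟩
      (fun σ => σ = ⟨[i, j, L.z, L.p, L.r, L.cl, L.s 0, 0, 0, 0, 0, 0, 0, 0, 0, i - 1, 0, 40 * L.z,
        0, 0], m, [], 24⟩) := by
  have hword : ∀ a, m a < 2 ^ w := fun a => by rw [hm]; exact hf.word a
  have h0 : m 0 = L.z := (hm 0).trans (Layout.D_header (by norm_num))
  have h1 : m 1 = L.p := (hm 1).trans (Layout.D_header (by norm_num))
  have h2 : m 2 = L.r := (hm 2).trans (Layout.D_header (by norm_num))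
  have h3 : m 3 = L.cl := (hm 3).trans (Layout.D_header (by norm_num))
  have h4 : m 4 = L.s 0 := (hm 4).trans (Layout.D_header (by norm_num))
  have hlen := hf.len
  rw [Layout.length_D] at hlen
  have hpos := hf.pos
  have hcl := h.cl_pos
  have hz : 40 * L.z ≤ (L.m + 1) * (40 * L.z) := Nat.le_mul_of_pos_left _ (by omega)
  generalize hB : 2 ^ w = B at *
  refine WP.block ?_ ?_
  · rw [hB]
    simp [loadHeader, Oks, Instr.run, Instr.Ok, numVars, hword, h0]
    omega
  · simp [loadHeader, runs, Instr.run, h0, h1, h2, h3, h4]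

/-- Reading the leaf reached by a descent. -/
theorem leaf_read {m : ℕ → ℕ} (hm : ∀ a, m a = L.D.getD a 0) {x x' q u α β γ k f : ℕ}
    (hd : L.Descent (L.m + 1) x x' q u α β γ) (hk : k < L.cl) (hf : f < 4) :
    m (5 + (L.m + 1) * (40 * L.z) + 4 * (q * (4 * L.cl) + (u + k)) + f) =
      (L.leaf (x' + k)).getD f 0 := by
  have hu := hd.pos.pos L.m rfl
  rw [Layout.s_last] at hu
  rw [hm, Layout.D_leaf hd.pos.q_lt (by omega) hf, ← Nat.add_assoc (L.W (L.m + 1) q),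
    ← hd.pos.eq]

/-- The slack `4 * cl` pays for reading `cl` consecutive leaves of four words. -/
theorem leaf_lt (hf : QueryFits L w) {x x' q u α β γ : ℕ}
    (hd : L.Descent (L.m + 1) x x' q u α β γ) :
    5 + (L.m + 1) * (40 * L.z) + 4 * (q * (4 * L.cl) + u) + 4 * L.cl + 100 < 2 ^ w := by
  have hlen := hf.len
  rw [Layout.length_D] at hlen
  have hu := hd.pos.pos L.m rfl
  rw [Layout.s_last] at hu
  have hq : q * (4 * L.cl) + 4 * L.cl ≤ L.z * (4 * L.cl) := by
    rw [← Nat.succ_mul]; exact Nat.mul_le_mul_right _ hd.pos.q_lt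
  omega

theorem wp_extract (h : L.Good) (hf : QueryFits L w) (hmcl : L.m + 1 ≤ L.cl) {m : ℕ → ℕ}
    (hm : ∀ a, m a = L.D.getD a 0) {i j : ℕ} (hi : i ≤ L.n + 1) (hj : j ≤ L.n) :
    WP w extract ⟨[i, j, 0, 0, 0, 0, 0, 0, 0, 0, 0, 0, 0, 0, 0, 0, 0, 0, 0, 0], m, [], 0⟩
      (fun σ => σ.out = (List.range (j - (i - 1))).map (fun t => L.T (L.M + (i - 1) + t)) ∧
        σ.time ≤ 100 + 300 * (j - (i - 1)) + 300 * L.cl) := by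
  have hword : ∀ a, m a < 2 ^ w := fun a => by rw [hm]; exact hf.word a
  have hpos := hf.pos
  have hcl := h.cl_pos
  refine WP.seq ((wp_loadHeader h hf hm hi).mono ?_)
  rintro _ rfl
  refine WP.loop_measure (b := .lt 15 1) ⟨by decide, by decide⟩
    (fun σ => ∃ pos a7 a8 a9 a10 a11 a12 a13 a14 a16, i - 1 ≤ pos ∧ (pos ≤ j ∨ pos = i - 1) ∧
      σ.env = [i, j, L.z, L.p, L.r, L.cl, L.s 0, a7, a8, a9, a10, a11, a12, a13, a14, pos, a16,
        40 * L.z, 0, 0] ∧ σ.mem = m ∧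
      σ.out = (List.range (pos - (i - 1))).map (fun t => L.T (L.M + (i - 1) + t)) ∧
      -- A round that emits `cl` characters pays for its own descent, because `m + 1 ≤ cl`. Only the
      -- last round may emit fewer; the term `300 * cl` in the other bound pays for it.
      (pos < j → σ.time ≤ 50 + 300 * (pos - (i - 1))) ∧
      σ.time ≤ 50 + 300 * (pos - (i - 1)) + 300 * L.cl)
    (fun σ => j - σ.env.getD 15 0) ?_ ?_ _ ?_
  · rintro ⟨e, m', o', t'⟩ ⟨pos, a7, a8, a9, a10, a11, a12, a13, a14, a16, hp1, hp2, he, hm', ho,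
      ht1, ht2⟩ htest
    simp only at he hm' ho ht1 ht2
    subst he hm'
    replace htest : pos < j := htest
    have ht1 := ht1 htest
    refine WP.seq (WP.block ?_ ?_)
    · generalize hB : 2 ^ w = B at *
      simp [Oks, Instr.Ok, numVars]
      omega
    simp only [runs, Instr.run, List.set_cons_zero, List.set_cons_succ]
    simp only [val_var, List.getD_cons_zero, List.getD_cons_succ, cost_var]
    refine WP.seq ((wp_descend h hf (x := L.M + pos) ⟨by omega, by omega⟩ (σ := ⟨_, m', o', _⟩)
      (by rw [Nat.add_sub_cancel_left]) hm).mono ?_)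
    rintro ⟨e, m'', o'', t''⟩ ⟨b7, q, u, b10, α, β, γ, x', hd, -, he, hm'', ho', ht⟩
    simp only at he hm'' ho' ht
    subst he hm'' ho'
    have hl := leaf_lt hf hd
    refine WP.seq (WP.block ?_ ?_)
    · generalize hB : 2 ^ w = B at *
      simp [Oks, Instr.Ok, numVars]
      omega
    simp only [runs, Instr.run, List.set_cons_zero, List.set_cons_succ]
    simp only [val_var, val_sub, val_add, List.getD_cons_zero, List.getD_cons_succ, cost_var,
      cost_sub, cost_add]
    -- By truncation `j - (j - (pos + cl))` is the minimum of `j` and `pos + cl`.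
    refine WP.loop_count (b := .lt 15 16) ⟨by decide, by decide⟩ (min L.cl (j - pos))
      (fun k σ => σ.env = [i, j, L.z, L.p, L.r, L.cl, L.s 0, b7, q, u, b10,
        5 + (L.m + 1) * (40 * L.z) + 4 * (q * (4 * L.cl) + (u + k)), α, β, γ, pos + k,
        j - (j - (pos + L.cl)), 40 * L.z, 0, 0] ∧ σ.mem = m'' ∧
      σ.out = (List.range (pos + k - (i - 1))).map (fun t => L.T (L.M + (i - 1) + t)) ∧
      σ.time ≤ 70 + 300 * (pos - (i - 1)) + 100 * (L.m + 2) + 15 * k) ?_ ?_ ?_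
    · rintro k hk ⟨e, m', o', t'⟩ ⟨he, hm', ho, ht⟩
      simp only at he hm' ho ht
      subst he hm' ho
      have hr : m' (5 + (L.m + 1) * (40 * L.z) + 4 * (q * (4 * L.cl) + (u + k))) = L.T (x' + k) :=
        leaf_read hm hd (k := k) (f := 0) (by omega) (by norm_num)
      refine ⟨?_, WP.block ?_ ?_⟩
      · simp [WP.TestOn, Test.Holds]; omega
      · generalize hB : 2 ^ w = B at *
        simp [Oks, Instr.run, Instr.Ok, numVars, hword]
        omega
      · simp [runs, Instr.run, hr]
        refine ⟨by omega, ?_, by omega⟩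
        have := hd.eq k (by omega)
        rw [show pos + (k + 1) - (i - 1) = (pos + k - (i - 1)) + 1 by omega, List.range_succ,
          List.map_append, ← this]
        simp
        congr 1
        omega
    · rintro ⟨e, m', o', t'⟩ ⟨he, hm', ho, ht⟩
      simp only at he hm' ho ht
      subst he hm' ho
      refine ⟨?_, ⟨_, _, _, _, _, _, _, _, _, _, ?_, ?_, rfl, rfl, rfl, ?_, ?_⟩, ?_⟩
      · simp [WP.TestOn, Test.Holds]; omega
      · omega
      · omega
      · simp only; intro h1; omega
      · simp only; omega
      · simp; omega
    · refine ⟨rfl, rfl, ?_, ?_⟩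
      · simp [ho]
      · simp only at ht ⊢; omega
  · rintro ⟨e, m', o', t'⟩ ⟨pos, a7, a8, a9, a10, a11, a12, a13, a14, a16, hp1, hp2, he, hm', ho,
      ht1, ht2⟩ htest
    simp only at he hm' ho ht1 ht2
    subst he hm' ho
    replace htest : ¬ pos < j := htest
    refine ⟨?_, ?_⟩
    · simp only
      rw [show pos - (i - 1) = j - (i - 1) by omega]
    · simp only
      have : pos - (i - 1) = j - (i - 1) := by omega
      omega
  · refine ⟨i - 1, _, _, _, _, _, _, _, _, _, le_rfl, Or.inr rfl, rfl, rfl, ?_, ?_, ?_⟩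
    · simp
    · simp
    · simp only; omega

/-- Two descents yield the prefix fingerprints at both ends; the first also yields the power of r⁻¹
that moves the substring to exponent 0. -/
theorem wp_fprint (h : L.Good) (hf : QueryFits L w) {m : ℕ → ℕ}
    (hm : ∀ a, m a = L.D.getD a 0) {i j : ℕ} (hi1 : 1 ≤ i) (hi : i ≤ L.n + 1) (hj : j ≤ L.n)
    {S : List ℕ} (hn : S.length = L.n) (hS : ∀ x < S.length, L.T (L.M + x) = S.getD x 0)
    (hr : L.r ≠ 0 → (L.r : ZMod L.p) * L.ri = 1) :
    WP w fprint ⟨[i, j, 0, 0, 0, 0, 0, 0, 0, 0, 0, 0, 0, 0, 0, 0, 0, 0, 0, 0], m, [], 0⟩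
      (fun σ => σ.out = [LZ.fingerprint L.p L.r (LZ.substr S i j)] ∧
        σ.time ≤ 200 + 200 * (L.m + 2)) := by
  have hword : ∀ a, m a < 2 ^ w := fun a => by rw [hm]; exact hf.word a
  have hpos := hf.pos
  have hcl := h.cl_pos
  have htwo := hf.two
  have hprime := hf.prime
  have hp2 : L.p ≤ L.p * L.p := Nat.le_mul_self _
  obtain ⟨i, rfl⟩ := Nat.exists_eq_add_of_le' hi1
  have hcl := h.cl_pos
  refine WP.seq ((wp_loadHeader h hf hm hi).mono ?_)
  rintro _ rfl
  rw [Nat.add_sub_cancel]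
  refine WP.ite (b := .lt 1 0) ⟨by decide, by decide⟩ (fun htest => ?_) (fun htest => ?_)
  · replace htest : j < i + 1 := htest
    refine WP.block ?_ ?_
    · generalize hB : 2 ^ w = B at *
      simp [Oks, Instr.Ok]
      omega
    · have : LZ.substr S (i + 1) j = [] := List.eq_nil_of_length_eq_zero (by
        rw [Layout.length_substr _ _ _ (by omega)]; omega)
      simp [runs, Instr.run, this, LZ.fingerprint]
      omega
  replace htest : ¬ j < i + 1 := htest
  refine WP.seq (WP.block ?_ ?_)
  · generalize hB : 2 ^ w = B at *
    simp [Oks, Instr.Ok, numVars]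
    omega
  simp only [runs, Instr.run, List.set_cons_zero, List.set_cons_succ]
  simp only [val_var, List.getD_cons_zero, List.getD_cons_succ, cost_var]
  refine WP.seq ((wp_descend h hf (x := L.M + i) ⟨by omega, by omega⟩ (σ := ⟨_, m, [], _⟩)
    (by rw [Nat.add_sub_cancel_left]) hm).mono ?_)
  rintro ⟨e, m', o', t'⟩ ⟨b7, q, u, b10, α, β, γ, x', hd, ⟨hα, hβ, hγ⟩, he, hm', ho, ht⟩
  simp only at he hm' ho ht
  subst he hm' ho
  have hl := leaf_lt hf hd
  have l0 : m' (5 + (L.m + 1) * (40 * L.z) + 4 * (q * (4 * L.cl) + u)) = L.T x' :=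
    leaf_read hm hd (k := 0) (f := 0) hcl (by norm_num)
  have l1 : m' (5 + (L.m + 1) * (40 * L.z) + 4 * (q * (4 * L.cl) + u) + 1) = L.pf x' :=
    leaf_read hm hd (k := 0) (f := 1) hcl (by norm_num)
  have l3 : m' (5 + (L.m + 1) * (40 * L.z) + 4 * (q * (4 * L.cl) + u) + 3) = L.ip x' :=
    leaf_read hm hd (k := 0) (f := 3) hcl (by norm_num)
  have p1 : L.pf x' < L.p := Nat.mod_lt _ (by omega)
  have p3 : L.ip x' < L.p := Nat.mod_lt _ (by omega)
  have hlen := Layout.length_substr S i j (by omega)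
  refine WP.ite (b := .eq 4 18) ⟨by decide, by decide⟩ (fun hr0 => ?_) (fun hr0 => ?_)
  -- Zero has no inverse, but then only the term with exponent 0 survives, and the answer is the
  -- first character modulo `p`.
  · replace hr0 : L.r = 0 := hr0
    refine WP.block ?_ ?_
    · generalize hB : 2 ^ w = B at *
      simp [Oks, Instr.Ok, numVars, hword]
      omega
    · simp [runs, Instr.run, l0]
      refine ⟨?_, by omega⟩
      obtain ⟨k, hk⟩ := Nat.exists_eq_add_of_le' (show 1 ≤ j - i by omega)
      rw [LZ.fingerprint, hlen, hk, Finset.sum_range_succ', hr0]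
      have := hd.eq 0 hcl
      rw [Nat.add_zero, Nat.add_zero, hS i (by omega)] at this
      rw [Layout.getD_substr S i j 0 (by omega), Nat.add_zero i, this]
      simp
  replace hr0 : ¬ L.r = 0 := hr0
  have b1 := Nat.mul_le_mul hβ.le p1.le
  have b3 := Nat.mul_le_mul hγ.le p3.le
  refine WP.seq (WP.block ?_ ?_)
  · generalize hB : 2 ^ w = B at *
    simp [Oks, Instr.run, Instr.Ok, numVars, l1, l3]
    omega
  simp only [runs, Instr.run, List.set_cons_zero, List.set_cons_succ]
  simp only [val_var, val_sub, val_add, val_mul, val_mod, val_ld, val_lit, List.getD_cons_zero,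
    List.getD_cons_succ, cost_var, cost_sub, cost_add, cost_mul, cost_mod, cost_ld, cost_lit,
    l1, l3]
  -- The descent goes to the last character, since the position after it may be outside the text.
  -- The leaf also stores the fingerprint of the prefix including its character, to which `pre_succ`
  -- applies.
  refine WP.seq ((wp_descend h hf (x := L.M + (j - 1)) ⟨by omega, by omega⟩ (σ := ⟨_, m', [], _⟩)
    (by rw [Nat.add_sub_cancel_left]) hm).mono ?_)
  rintro ⟨e, m'', o', t''⟩ ⟨b7', q', u', b10', α', β', γ', x'', hd', ⟨hα', hβ', hγ'⟩, he, hm', ho,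
    ht'⟩
  simp only at he hm' ho ht'
  subst he hm' ho
  have hl' := leaf_lt hf hd'
  have l2 : m'' (5 + (L.m + 1) * (40 * L.z) + 4 * (q' * (4 * L.cl) + u') + 2) =
      (L.pf x'' + L.T x'' * L.pw x'') % L.p :=
    leaf_read hm hd' (k := 0) (f := 2) hcl (by norm_num)
  have p2 : (L.pf x'' + L.T x'' * L.pw x'') % L.p < L.p := Nat.mod_lt _ (by omega)
  have b2 := Nat.mul_le_mul hβ'.le p2.le
  have p4 : (α + β * L.pf x') % L.p < L.p := Nat.mod_lt _ (by omega)
  have p5 : γ * L.ip x' % L.p < L.p := Nat.mod_lt _ (by omega)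
  have p6 : ((α' + β' * ((L.pf x'' + L.T x'' * L.pw x'') % L.p)) % L.p + L.p -
    (α + β * L.pf x') % L.p) % L.p < L.p := Nat.mod_lt _ (by omega)
  have p7 : (α' + β' * ((L.pf x'' + L.T x'' * L.pw x'') % L.p)) % L.p < L.p :=
    Nat.mod_lt _ (by omega)
  have b6 := Nat.mul_le_mul p6.le p5.le
  refine WP.block ?_ ?_
  · generalize hB : 2 ^ w = B at *
    simp [Oks, Instr.run, Instr.Ok, numVars, l2]
    omega
  · simp [runs, Instr.run, l2]
    refine ⟨?_, by omega⟩
    have e1 := Layout.fingerprint_substr hS (hr hr0) (i := i) (j := j) (by omega) (by omega)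
    have e2 : LZ.fingerprint L.p L.r (LZ.substr S (i + 1) j) < L.p := Nat.mod_lt _ (by omega)
    have hc : (((L.pf x'' + L.T x'' * L.pw x'') % L.p : ℕ) : ZMod L.p) = L.PF (x'' + 1) := by
      rw [ZMod.natCast_mod, Nat.cast_add, Nat.cast_mul, Layout.cast_pf, Layout.cast_pw,
        Layout.PF_succ]
    have hj1 := hd'.pre_succ
    rw [show L.M + (j - 1) + 1 = L.M + j by omega] at hj1
    rw [← Nat.mod_eq_of_lt e2]
    apply (ZMod.natCast_eq_natCast_iff' _ _ _).1
    have hX := Layout.cast_sub_mod (p := L.p)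
      (a := (α' + β' * ((L.pf x'' + L.T x'' * L.pw x'') % L.p)) % L.p)
      (b := α + β * L.pf x') (by omega)
    rw [ZMod.natCast_mod] at hX
    rw [e1, Nat.cast_mul, hX, ← hj1, ← hd.pre, ← hd.inv,
      ZMod.natCast_mod, Nat.cast_add, Nat.cast_mul, hc, Nat.cast_add,
      Nat.cast_mul, Nat.cast_mul, Layout.cast_pf, Layout.cast_ip]

end RAM

/-! ### The construction program -/

namespace RAM

open Ex Instr

/-- The memory with the cells from `base` on divided into records of eight fields. -/
def memOf (base : ℕ) (inp : ℕ → ℕ) (A : ℕ → ℕ → ℕ) : ℕ → ℕ :=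
  fun a => if a < base then inp a else A ((a - base) % 8) ((a - base) / 8)

/-- Field `f` of record `x` is changed to `v`. -/
def upd (A : ℕ → ℕ → ℕ) (f x v : ℕ) : ℕ → ℕ → ℕ :=
  Function.update A f (Function.update (A f) x v)

section
variable {base : ℕ} {inp : ℕ → ℕ} {A : ℕ → ℕ → ℕ}

theorem memOf_lt {a : ℕ} (ha : a < base) : memOf base inp A a = inp a := if_pos ha

theorem memOf_add (f x : ℕ) (hf : f < 8) : memOf base inp A (base + 8 * x + f) = A f x := by
  rw [memOf, if_neg (by omega)]
  congr 1 <;> omega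

theorem memOf_zero (x : ℕ) : memOf base inp A (base + 8 * x) = A 0 x :=
  memOf_add 0 x (by norm_num)

theorem update_memOf (f x v : ℕ) (hf : f < 8) :
    Function.update (memOf base inp A) (base + 8 * x + f) v = memOf base inp (upd A f x v) := by
  funext a
  by_cases ha : a = base + 8 * x + f
  · subst ha
    rw [Function.update_self, memOf_add f x hf, upd, Function.update_self, Function.update_self]
  · rw [Function.update_of_ne ha]
    unfold memOf
    split_ifs with h
    · rfl
    · unfold upd
      by_cases h1 : (a - base) % 8 = f
      · rw [h1, Function.update_self, Function.update_of_ne (by omega)]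
      · rw [Function.update_of_ne h1]

theorem upd_same (f x v : ℕ) : upd A f x v f = Function.update (A f) x v := by
  rw [upd, Function.update_self]

theorem upd_ne {f f' : ℕ} (x v : ℕ) (h : f' ≠ f) : upd A f x v f' = A f' := by
  rw [upd, Function.update_of_ne h]

end

/-- The address of field `f` of record `x`. -/
def fa (f : ℕ) (x : Ex) : Ex := var 7 + lit 8 * x + lit f

/-- The sum of the phrase lengths. -/
def sumLengths : Prog :=
  .seq (block [asg 0 (ld (lit 0)), asg 1 (ld (lit 1)), asg 2 (ld (lit 2))])
    (.loop (.lt 9 0)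
      (block [asg 3 (var 3 + ld (lit 3 * var 9 + lit 4) + lit 1), asg 9 (var 9 + lit 1)]))

/-- The parameters of the data structure. -/
def parameters : Prog :=
  .seq (block [asg 4 (lit 1), asg 16 (var 0)])
    (.seq (.loop (.lt 16 3) (block [asg 16 (var 16 + var 16), asg 4 (var 4 + lit 1)]))
      (.seq (block [asg 5 (var 4), asg 16 (var 0 * var 4)])
        (.seq (.loop (.lt 16 3) (block [asg 16 (var 16 + var 16), asg 5 (var 5 + var 5)]))
          (block [asg 6 (lit 4 * var 5), asg 7 (lit 3 + lit 3 * var 0), asg 9 (lit 0),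
            asg 10 (var 6)]))))

/-- The position at which phrase `k` starts. -/
def phraseStart (ln : ℕ → ℕ) (k : ℕ) : ℕ := ∑ i ∈ Finset.range k, (ln i + 1)

/-- The input does not contain `n`; it is the sum of source lengths, plus one border per phrase. -/
theorem wp_sumLengths {w z p r n : ℕ} {inp : ℕ → ℕ} {ln : ℕ → ℕ} (h0 : inp 0 = z) (h1 : inp 1 = p)
    (h2 : inp 2 = r) (hl : ∀ k < z, inp (3 * k + 4) = ln k) (hn : phraseStart ln z = n)
    (hz : z ≤ n) (hp : p < 2 ^ w) (hr : r < 2 ^ w) (hw : 4 * n + 10 < 2 ^ w) :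
    WP w sumLengths ⟨[0, 0, 0, 0, 0, 0, 0, 0, 0, 0, 0, 0, 0, 0, 0, 0, 0, 0, 0, 0], inp, [], 0⟩
      (fun σ => σ.env = [z, p, r, n, 0, 0, 0, 0, 0, z, 0, 0, 0, 0, 0, 0, 0, 0, 0, 0] ∧
        σ.mem = inp ∧ σ.out = [] ∧ σ.time ≤ 20 + 20 * z) := by
  have hmono : ∀ k ≤ z, phraseStart ln k ≤ n := fun k hk => by
    rw [← hn]
    exact Finset.sum_le_sum_of_subset (Finset.range_mono hk)
  refine WP.seq (WP.block ?_ ?_)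
  · generalize 2 ^ w = B at *
    simp [Oks, Instr.run, Instr.Ok, numVars, h0, h1, h2]
    omega
  simp only [runs, Instr.run, List.set_cons_zero, List.set_cons_succ]
  simp only [val_ld, val_lit, cost_ld, cost_lit, h0, h1, h2]
  refine WP.loop_count (b := .lt 9 0) ⟨by decide, by decide⟩ z
    (fun k σ => σ.env = [z, p, r, phraseStart ln k, 0, 0, 0, 0, 0, k, 0, 0, 0, 0, 0, 0, 0, 0, 0, 0]
      ∧ σ.mem = inp ∧ σ.out = [] ∧ σ.time ≤ 15 + 20 * k) ?_ ?_ ?_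
  · rintro k hk ⟨e, m, o, t⟩ ⟨he, hm, ho, ht⟩
    simp only at he hm ho ht
    subst he hm ho
    have hs : phraseStart ln (k + 1) = phraseStart ln k + ln k + 1 := by
      rw [phraseStart, Finset.sum_range_succ, ← Nat.add_assoc]; rfl
    have := hmono (k + 1) hk
    refine ⟨by simpa [WP.TestOn, Test.Holds] using hk, WP.block ?_ ?_⟩
    · generalize 2 ^ w = B at *
      simp [Oks, Instr.run, Instr.Ok, numVars, hl k hk]
      omega
    · simp [runs, Instr.run, hl k hk, hs]
      omega
  · rintro ⟨e, m, o, t⟩ ⟨he, hm, ho, ht⟩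
    simp only at he hm ho ht
    subst he hm ho
    refine ⟨by simp [WP.TestOn, Test.Holds], by simp [hn], rfl, rfl, ?_⟩
    simp only
    omega
  · exact ⟨rfl, rfl, rfl, by simp⟩

/-- The hypotheses state that `cl` and `m` are least; each loop doubles until its inequality first
holds, which fixes the number of rounds. -/
theorem wp_parameters {w z p r n cl m t : ℕ} {inp : ℕ → ℕ} (hz0 : 0 < z) (hz : z ≤ n)
    (hcl0 : 0 < cl) (hcl : n ≤ z * 2 ^ (cl - 1)) (hcl' : ∀ k < cl - 1, z * 2 ^ k < n)
    (hm : n ≤ z * cl * 2 ^ m) (hm' : ∀ k < m, z * cl * 2 ^ k < n) (hmcl : m + 1 ≤ cl)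
    (hclz : cl * z ≤ 2 * n)
    (hw : 20 * n + 10 < 2 ^ w) :
    WP w parameters ⟨[z, p, r, n, 0, 0, 0, 0, 0, z, 0, 0, 0, 0, 0, 0, 0, 0, 0, 0], inp, [], t⟩
      (fun σ => (∃ a, σ.env = [z, p, r, n, cl, cl * 2 ^ m, 4 * (cl * 2 ^ m), 3 + 3 * z, 0, 0,
        4 * (cl * 2 ^ m), 0, 0, 0, 0, 0, a, 0, 0, 0]) ∧
        σ.mem = inp ∧ σ.out = [] ∧ σ.time ≤ t + 50 + 30 * cl) := by
  have hcln : cl ≤ 2 * n := (Nat.le_mul_of_pos_right _ hz0).trans hclz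
  refine WP.seq (WP.block ?_ ?_)
  · generalize 2 ^ w = B at *
    simp [Oks, Instr.run, Instr.Ok, numVars]
    omega
  simp only [runs, Instr.run, List.set_cons_zero, List.set_cons_succ]
  simp only [val_var, val_lit, cost_var, cost_lit, List.getD_cons_zero]
  refine WP.seq (WP.loop_count (b := .lt 16 3) ⟨by decide, by decide⟩ (cl - 1)
    (fun k σ => σ.env = [z, p, r, n, 1 + k, 0, 0, 0, 0, z, 0, 0, 0, 0, 0, 0, z * 2 ^ k, 0, 0, 0]
      ∧ σ.mem = inp ∧ σ.out = [] ∧ σ.time ≤ t + 10 + 10 * k) ?_ ?_ ?_)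
  · rintro k hk ⟨e, m, o, t⟩ ⟨he, hm, ho, ht⟩
    simp only at he hm ho ht
    subst he hm ho
    have := hcl' k hk
    refine ⟨by simpa [WP.TestOn, Test.Holds] using this, WP.block ?_ ?_⟩
    · generalize 2 ^ w = B at *
      simp [Oks, Instr.run, Instr.Ok, numVars]
      omega
    · simp [runs, Instr.run, pow_succ]
      refine ⟨⟨by omega, by ring⟩, by omega⟩
  · rintro ⟨e, m', o, t'⟩ ⟨he, hm', ho, ht⟩
    simp only at he hm' ho ht
    subst he hm' ho
    rw [show 1 + (cl - 1) = cl by omega]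
    refine ⟨by simpa [WP.TestOn, Test.Holds] using hcl, WP.seq (WP.block ?_ ?_)⟩
    · rw [mul_comm] at hclz
      generalize 2 ^ w = B at *
      simp [Oks, Instr.run, Instr.Ok, numVars]
      omega
    simp only [runs, Instr.run, List.set_cons_zero, List.set_cons_succ]
    simp only [val_var, val_mul, cost_var, cost_mul, List.getD_cons_zero, List.getD_cons_succ]
    refine WP.seq (WP.loop_count (b := .lt 16 3) ⟨by decide, by decide⟩ m
      (fun k σ => σ.env = [z, p, r, n, cl, cl * 2 ^ k, 0, 0, 0, z, 0, 0, 0, 0, 0, 0,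
        z * cl * 2 ^ k, 0, 0, 0] ∧ σ.mem = m' ∧ σ.out = [] ∧
        σ.time ≤ t + 20 + 10 * cl + 10 * k) ?_ ?_ ?_)
    · rintro k hk ⟨e, m, o, t⟩ ⟨he, hm, ho, ht⟩
      simp only at he hm ho ht
      subst he hm ho
      have h1 := hm' k hk
      have h2 : cl * 2 ^ k ≤ z * cl * 2 ^ k := by
        rw [mul_assoc]; exact Nat.le_mul_of_pos_left _ hz0
      refine ⟨by simpa [WP.TestOn, Test.Holds] using h1, WP.block ?_ ?_⟩
      · generalize 2 ^ w = B at *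
        simp [Oks, Instr.run, Instr.Ok, numVars]
        omega
      · simp [runs, Instr.run, pow_succ]
        refine ⟨⟨by ring, by ring⟩, by omega⟩
    · rintro ⟨e, m'', o, t''⟩ ⟨he, hm'', ho, ht⟩
      simp only at he hm'' ho ht
      subst he hm'' ho
      have h2 : cl * 2 ^ m ≤ 2 * n := by
        rcases Nat.eq_zero_or_pos m with rfl | h0
        · simpa using hcln
        · have h1 := hm' (m - 1) (by omega)
          obtain ⟨k, rfl⟩ := Nat.exists_eq_add_of_le' h0
          rw [Nat.add_sub_cancel] at h1
          have : cl * 2 ^ k ≤ z * cl * 2 ^ k := by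
            rw [mul_assoc]; exact Nat.le_mul_of_pos_left _ hz0
          rw [pow_succ, ← mul_assoc]; omega
      refine ⟨by simpa [WP.TestOn, Test.Holds] using hm, WP.block ?_ ?_⟩
      · generalize 2 ^ w = B at *
        simp [Oks, Instr.run, Instr.Ok, numVars]
        omega
      · simp [runs, Instr.run]
        omega
    · refine ⟨by simp, rfl, rfl, ?_⟩
      simp only at ht ⊢
      omega
  · refine ⟨by simp, rfl, rfl, ?_⟩
    simp only
    omega

end RAM

/-! ### Decoding the parse into arrays -/

namespace LZ

/-- The properties of the `k`-th phrase that the construction relies on. -/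
structure PhraseSpec (S : List ℕ) (st ln bd : ℕ → ℕ) (k : ℕ) : Prop where
  lt : RAM.phraseStart ln k + ln k < S.length
  border : S.getD (RAM.phraseStart ln k + ln k) 0 = bd k
  start_le : st k ≤ RAM.phraseStart ln k
  src : 0 < ln k → 1 ≤ st k ∧ ∀ t < ln k, S.getD (RAM.phraseStart ln k + t) 0 = S.getD (st k - 1 + t) 0

end LZ

namespace RAM

open Ex Instr LZ

/-- Decodes the parse. -/
def decode : Prog :=
  .loop (.lt 9 0)
    (.seq (block [asg 11 (var 6 + ld (lit 3 * var 9 + lit 3) - lit 1),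
        asg 12 (ld (lit 3 * var 9 + lit 4)), sto (fa 7 (var 9)) (var 10 + var 12)])
      (.seq (.loop (.lt 18 12)
          (block [sto (fa 0 (var 10)) (ld (fa 0 (var 11))), sto (fa 1 (var 10)) (var 12),
            sto (fa 2 (var 10)) (var 9), sto (fa 3 (var 10)) (var 11), asg 10 (var 10 + lit 1),
            asg 11 (var 11 + lit 1), asg 12 (var 12 - lit 1)]))
        (block [sto (fa 0 (var 10)) (ld (lit 3 * var 9 + lit 5)), sto (fa 2 (var 10)) (var 9),
          sto (fa 3 (var 10)) (var 10), asg 10 (var 10 + lit 1), asg 9 (var 9 + lit 1)])))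

/-- The contents of the arrays after the decoding of a prefix of length `cur` with `q` phrases. -/
structure DecInv (S : List ℕ) (ln : ℕ → ℕ) (M : ℕ) (A : ℕ → ℕ → ℕ) (q cur : ℕ) : Prop where
  text : ∀ x < cur, A 0 (M + x) = S.getD x 0
  out0 : ∀ x, ¬ (M ≤ x ∧ x < M + cur) → A 0 x = 0
  out1 : ∀ x, ¬ (M ≤ x ∧ x < M + cur) → A 1 x = 0
  out2 : ∀ x, ¬ (M ≤ x ∧ x < M + cur) → A 2 x = 0
  out3 : ∀ x, ¬ (M ≤ x ∧ x < M + cur) → A 3 x = 0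
  idx : ∀ x < cur, A 2 (M + x) < q ∧ A 7 (A 2 (M + x)) = M + x + A 1 (M + x)
  self : ∀ x < cur, A 1 (M + x) = 0 → A 3 (M + x) = M + x
  src : ∀ x < cur, 0 < A 1 (M + x) → ∃ y < x, A 3 (M + x) = M + y ∧
    ∀ t < A 1 (M + x), S.getD (x + t) 0 = S.getD (y + t) 0
  E : ∀ i < q, A 7 i = M + phraseStart ln i + ln i
  rest : A 4 = 0 ∧ A 5 = 0 ∧ A 6 = 0

variable {S : List ℕ} {st ln bd : ℕ → ℕ} {M : ℕ} {A : ℕ → ℕ → ℕ} {q cur : ℕ}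

theorem phraseStart_succ (k : ℕ) : phraseStart ln (k + 1) = phraseStart ln k + ln k + 1 := by
  rw [phraseStart, Finset.sum_range_succ, ← Nat.add_assoc]; rfl

theorem phraseStart_mono {i k : ℕ} (h : i ≤ k) : phraseStart ln i ≤ phraseStart ln k :=
  Finset.sum_le_sum_of_subset (Finset.range_mono h)

/-- The border of a phrase is recorded before its characters, so that `DecInv.push` can relate each
new position to it at once. -/
theorem DecInv.border (h : DecInv S ln M A q (phraseStart ln q)) :
    DecInv S ln M (upd A 7 q (M + phraseStart ln q + ln q)) (q + 1) (phraseStart ln q) := by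
  have n0 := upd_ne (A := A) q (M + phraseStart ln q + ln q) (show 0 ≠ 7 by decide)
  have n1 := upd_ne (A := A) q (M + phraseStart ln q + ln q) (show 1 ≠ 7 by decide)
  have n2 := upd_ne (A := A) q (M + phraseStart ln q + ln q) (show 2 ≠ 7 by decide)
  have n3 := upd_ne (A := A) q (M + phraseStart ln q + ln q) (show 3 ≠ 7 by decide)
  have n4 := upd_ne (A := A) q (M + phraseStart ln q + ln q) (show 4 ≠ 7 by decide)
  have n5 := upd_ne (A := A) q (M + phraseStart ln q + ln q) (show 5 ≠ 7 by decide)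
  have n6 := upd_ne (A := A) q (M + phraseStart ln q + ln q) (show 6 ≠ 7 by decide)
  refine ⟨?_, ?_, ?_, ?_, ?_, ?_, ?_, ?_, ?_, ?_⟩
  · rw [n0]; exact h.text
  · rw [n0]; exact h.out0
  · rw [n1]; exact h.out1
  · rw [n2]; exact h.out2
  · rw [n3]; exact h.out3
  · rw [n1, n2, upd_same]
    intro x hx
    have := h.idx x hx
    rw [Function.update_of_ne (by omega)]
    exact ⟨by omega, this.2⟩
  · rw [n1, n3]; exact h.self
  · rw [n1, n3]; exact h.src
  · rw [upd_same]
    intro i hi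
    by_cases hiq : i = q
    · rw [hiq, Function.update_self]
    · rw [Function.update_of_ne hiq]; exact h.E i (by omega)
  · rw [n4, n5, n6]; exact h.rest

/-- One more decoded character. -/
theorem DecInv.push (h : DecInv S ln M A q cur) {c d i s : ℕ} {A' : ℕ → ℕ → ℕ}
    (e0 : A' 0 = Function.update (A 0) (M + cur) c)
    (e1 : A' 1 = Function.update (A 1) (M + cur) d)
    (e2 : A' 2 = Function.update (A 2) (M + cur) i)
    (e3 : A' 3 = Function.update (A 3) (M + cur) s)
    (e4 : A' 4 = A 4) (e5 : A' 5 = A 5) (e6 : A' 6 = A 6) (e7 : A' 7 = A 7)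
    (hc : c = S.getD cur 0) (hi : i < q) (hE : A 7 i = M + cur + d)
    (hs : d = 0 → s = M + cur)
    (hs' : 0 < d → ∃ y < cur, s = M + y ∧ ∀ t < d, S.getD (cur + t) 0 = S.getD (y + t) 0) :
    DecInv S ln M A' q (cur + 1) := by
  refine ⟨?_, ?_, ?_, ?_, ?_, ?_, ?_, ?_, ?_, ?_⟩
  · intro x hx
    rw [e0]
    rcases Nat.lt_succ_iff_lt_or_eq.1 hx with h1 | rfl
    · rw [Function.update_of_ne (by omega)]; exact h.text x h1
    · rw [Function.update_self, hc]
  · intro x hx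
    rw [e0, Function.update_of_ne (by omega)]; exact h.out0 x (by omega)
  · intro x hx
    rw [e1, Function.update_of_ne (by omega)]; exact h.out1 x (by omega)
  · intro x hx
    rw [e2, Function.update_of_ne (by omega)]; exact h.out2 x (by omega)
  · intro x hx
    rw [e3, Function.update_of_ne (by omega)]; exact h.out3 x (by omega)
  · intro x hx
    rw [e1, e2, e7]
    rcases Nat.lt_succ_iff_lt_or_eq.1 hx with h1 | rfl
    · rw [Function.update_of_ne (by omega), Function.update_of_ne (by omega)]; exact h.idx x h1
    · rw [Function.update_self, Function.update_self]; exact ⟨hi, hE⟩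
  · intro x hx
    rw [e1, e3]
    rcases Nat.lt_succ_iff_lt_or_eq.1 hx with h1 | rfl
    · rw [Function.update_of_ne (by omega), Function.update_of_ne (by omega)]; exact h.self x h1
    · rw [Function.update_self, Function.update_self]; exact hs
  · intro x hx
    rw [e1, e3]
    rcases Nat.lt_succ_iff_lt_or_eq.1 hx with h1 | rfl
    · rw [Function.update_of_ne (by omega), Function.update_of_ne (by omega)]; exact h.src x h1
    · rw [Function.update_self, Function.update_self]; exact hs'
  · rw [e7]; exact h.E
  · rw [e4, e5, e6]; exact h.rest

theorem wp_decode {w z p r n cl s M base a16 t : ℕ} {inp : ℕ → ℕ} {A₀ : ℕ → ℕ → ℕ}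
    (h3 : ∀ k < z, inp (3 * k + 3) = st k) (h4 : ∀ k < z, inp (3 * k + 4) = ln k)
    (h5 : ∀ k < z, inp (3 * k + 5) = bd k) (hS : ∀ k < z, PhraseSpec S st ln bd k)
    (hn : S.length = n) (hzn : phraseStart ln z = n) (hz : z ≤ n) (hM : 0 < M)
    (hbase : base = 3 + 3 * z) (hA : DecInv S ln M A₀ 0 0)
    (hw : base + 8 * (M + n) + 100 < 2 ^ w) (hch : ∀ x, S.getD x 0 < 2 ^ w) :
    WP w decode ⟨[z, p, r, n, cl, s, M, base, 0, 0, M, 0, 0, 0, 0, 0, a16, 0, 0, 0],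
        memOf base inp A₀, [], t⟩
      (fun σ => ∃ A a10 a11, DecInv S ln M A z n ∧ σ.env = [z, p, r, n, cl, s, M, base, 0, z, a10,
        a11, 0, 0, 0, 0, a16, 0, 0, 0] ∧ σ.mem = memOf base inp A ∧ σ.out = [] ∧
        σ.time ≤ t + 10 + 150 * n) := by
  refine WP.loop_count (b := .lt 9 0) ⟨by decide, by decide⟩ z
    (fun k σ => ∃ A a11, DecInv S ln M A k (phraseStart ln k) ∧
      σ.env = [z, p, r, n, cl, s, M, base, 0, k, M + phraseStart ln k,
        a11, 0, 0, 0, 0, a16, 0, 0, 0] ∧ σ.mem = memOf base inp A ∧ σ.out = [] ∧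
        σ.time ≤ t + 150 * phraseStart ln k) ?_ ?_ ?_
  · rintro k hk ⟨e, m, o, t'⟩ ⟨A, a11, hI, he, hm, ho, ht⟩
    simp only at he hm ho ht
    subst he hm ho
    have hp := hS k hk
    have hlt := hp.lt
    have hst := hp.start_le
    have hle := phraseStart_mono (ln := ln) hk
    rw [hzn, phraseStart_succ] at hle
    have m3 : memOf base inp A (3 * k + 3) = st k := by rw [memOf_lt (by omega), h3 k hk]
    have m4 : memOf base inp A (3 * k + 4) = ln k := by rw [memOf_lt (by omega), h4 k hk]
    refine ⟨by simpa [WP.TestOn, Test.Holds] using hk, WP.seq (WP.block ?_ ?_)⟩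
    · generalize 2 ^ w = B at *
      simp [Oks, Instr.run, Instr.Ok, numVars, fa, m3, m4]
      omega
    simp only [runs, Instr.run, List.set_cons_zero, List.set_cons_succ]
    simp only [fa, val_var, val_add, val_sub, val_mul, val_ld, val_lit, cost_var, cost_add,
      cost_sub, cost_mul, cost_ld, cost_lit, List.getD_cons_zero, List.getD_cons_succ, m3, m4,
      update_memOf 7 _ _ (show 7 < 8 by decide)]
    refine WP.seq (WP.loop_count (b := .lt 18 12) ⟨by decide, by decide⟩ (ln k)
      (fun j σ => ∃ A, DecInv S ln M A (k + 1) (phraseStart ln k + j) ∧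
        σ.env = [z, p, r, n, cl, s, M, base, 0, k, M + phraseStart ln k + j,
          M + st k - 1 + j, ln k - j, 0, 0, 0, a16, 0, 0, 0] ∧ σ.mem = memOf base inp A ∧
          σ.out = [] ∧ σ.time ≤ t + 150 * phraseStart ln k + 50 + 100 * j) ?_ ?_ ?_)
    · rintro j hj ⟨e, m, o, t'⟩ ⟨A, hI, he, hm, ho, ht⟩
      simp only at he hm ho ht
      subst he hm ho
      obtain ⟨hs1, hs2⟩ := hp.src (by omega)
      -- Copying proceeds one character at a time, so the source position is always decoded already,
      -- even if source and phrase overlap.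
      have hA0 : A 0 (M + st k - 1 + j) = S.getD (phraseStart ln k + j) 0 := by
        rw [hs2 j hj, show M + st k - 1 + j = M + (st k - 1 + j) by omega]
        exact hI.text _ (by omega)
      have hc := hch (phraseStart ln k + j)
      obtain ⟨c, hcd⟩ : ∃ c, c = S.getD (phraseStart ln k + j) 0 := ⟨_, rfl⟩
      rw [← hcd] at hA0 hc
      refine ⟨by simpa [WP.TestOn, Test.Holds] using hj, WP.block ?_ ?_⟩
      · generalize 2 ^ w = B at *
        simp [Oks, Instr.run, Instr.Ok, numVars, memOf_zero, hA0]
        omega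
      simp only [runs, Instr.run, List.set_cons_zero, List.set_cons_succ]
      simp only [val_var, val_add, val_sub, val_mul, val_ld, val_lit, cost_var, cost_add,
        cost_sub, cost_mul, cost_ld, cost_lit, List.getD_cons_zero, List.getD_cons_succ,
        memOf_add 0 _ (show 0 < 8 by decide), hA0,
        update_memOf 0 _ _ (show 0 < 8 by decide), update_memOf 1 _ _ (show 1 < 8 by decide),
        update_memOf 2 _ _ (show 2 < 8 by decide), update_memOf 3 _ _ (show 3 < 8 by decide)]
      refine ⟨_, hI.push (c := c) (d := ln k - j) (i := k)
        (s := M + st k - 1 + j) ?_ ?_ ?_ ?_ ?_ ?_ ?_ ?_ hcd (by omega) ?_ (by omega) ?_, ?_, rfl,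
        by trivial, ?_⟩
      iterate 8 simp [upd, Function.update_of_ne, Nat.add_assoc]
      · rw [hI.E k (by omega)]; omega
      · intro _
        refine ⟨st k - 1 + j, by omega, by omega, fun t ht => ?_⟩
        rw [Nat.add_assoc, hs2 (j + t) (by omega), Nat.add_assoc]
      · simp only [Nat.add_assoc, Nat.sub_sub]
      · omega
    · rintro ⟨e, m, o, t'⟩ ⟨A, hI, he, hm, ho, ht⟩
      simp only at he hm ho ht
      subst he hm ho
      have m5 : ∀ A, memOf base inp A (3 * k + 5) = bd k := fun A => by
        rw [memOf_lt (by omega), h5 k hk]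
      have hc := hch (phraseStart ln k + ln k)
      rw [hp.border] at hc
      refine ⟨by simp [WP.TestOn, Test.Holds], WP.block ?_ ?_⟩
      · generalize 2 ^ w = B at *
        simp [Oks, Instr.run, Instr.Ok, numVars, m5]
        omega
      simp only [runs, Instr.run, List.set_cons_zero, List.set_cons_succ]
      simp only [val_var, val_add, val_mul, val_ld, val_lit, cost_var, cost_add,
        cost_mul, cost_ld, cost_lit, List.getD_cons_zero, List.getD_cons_succ, m5,
        update_memOf 0 _ _ (show 0 < 8 by decide),
        update_memOf 2 _ _ (show 2 < 8 by decide), update_memOf 3 _ _ (show 3 < 8 by decide)]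
      rw [phraseStart_succ]
      refine ⟨_, M + st k - 1 + ln k, hI.push (c := bd k) (d := 0) (i := k)
        (s := M + phraseStart ln k + ln k) ?_ ?_ ?_ ?_ ?_ ?_ ?_ ?_ hp.border.symm (by omega) ?_
        (by omega) (by omega), ?_, rfl, by trivial, ?_⟩
      · simp [upd, Function.update_of_ne, Nat.add_assoc]
      -- The program does not write the distance of a border: that field still has its initial value
      -- 0.
      · have : A 1 (M + (phraseStart ln k + ln k)) = 0 := hI.out1 _ (by omega)
        rw [upd_ne _ _ (by decide), upd_ne _ _ (by decide), upd_ne _ _ (by decide),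
          ← this, Function.update_eq_self]
      iterate 6 simp [upd, Function.update_of_ne, Nat.add_assoc]
      · rw [hI.E k (by omega)]; omega
      · simp only [Nat.add_assoc, Nat.sub_self]
      · omega
    · refine ⟨_, hI.border, ?_, rfl, by trivial, ?_⟩
      · simp
      · simp only; omega
  · rintro ⟨e, m, o, t'⟩ ⟨A, a11, hI, he, hm, ho, ht⟩
    simp only at he hm ho ht
    subst he hm ho
    rw [hzn] at hI ht ⊢
    refine ⟨by simp [WP.TestOn, Test.Holds], A, _, a11, hI, rfl, rfl, rfl, ?_⟩
    simp only; omega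
  · exact ⟨A₀, 0, hA, by simp [phraseStart], rfl, rfl, by simp⟩

end RAM

/-! ### The inverse base and the tables of powers and prefix fingerprints -/

namespace Layout

variable (L : Layout)

theorem pw_succ (k : ℕ) : L.pw k * L.r % L.p = L.pw (k + 1) := by
  rw [pw, pw, pow_succ, Nat.mod_mul_mod]

theorem ip_succ (k : ℕ) : L.ip k * L.ri % L.p = L.ip (k + 1) := by
  rw [ip, ip, pow_succ, Nat.mod_mul_mod]

theorem pf_succ (k : ℕ) : (L.pf k + L.T k * L.pw k) % L.p = L.pf (k + 1) := by
  rw [pf, pf, pw, Finset.sum_range_succ, Nat.mod_add_mod, Nat.add_mod, Nat.mul_mod_mod,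
    ← Nat.add_mod]

/-- The number of records in use. -/
def size : ℕ := 2 * L.M + 8 * L.z * L.s 0

/-- The contents of the arrays. -/
structure Arrays (A : ℕ → ℕ → ℕ) : Prop where
  T : A 0 = L.T
  dist : A 1 = L.dist
  idx : A 2 = L.idx
  src : A 3 = L.src
  pf : ∀ x < L.size, A 4 x = L.pf x
  pw : ∀ x < L.size, A 5 x = L.pw x
  ip : ∀ x < L.size, A 6 x = L.ip x
  E : A 7 = L.E

end Layout

namespace RAM

open Ex Instr

/-- The inverse of the base of the fingerprint function, as a power. -/
def inverse : Prog :=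
  .seq (block [asg 16 (lit 1), asg 15 (var 2), asg 12 (var 1 - lit 2)])
    (.seq (.loop (.lt 18 12)
      (block [asg 16 (var 16 * (var 12 % lit 2 * var 15 + (lit 1 - var 12 % lit 2)) % var 1),
        asg 15 (var 15 * var 15 % var 1), asg 12 (var 12 / lit 2)]))
      (block [asg 8 (var 16)]))

/-- Tables of powers and of prefix fingerprints. -/
def tables : Prog :=
  .seq (block [asg 10 (lit 0), asg 13 (lit 2 * var 6 + lit 8 * var 0 * var 5), asg 14 (lit 1),
      asg 15 (lit 1), asg 16 (lit 0)])
    (.loop (.lt 10 13)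
      (block [sto (fa 5 (var 10)) (var 14), sto (fa 6 (var 10)) (var 15),
        sto (fa 4 (var 10)) (var 16),
        asg 16 ((var 16 + ld (fa 0 (var 10)) * var 14) % var 1),
        asg 14 (var 14 * var 2 % var 1), asg 15 (var 15 * var 8 % var 1),
        asg 10 (var 10 + lit 1)]))

/-- Square and multiply, with invariant `a * b ^ e = r ^ (p - 2)` for the remaining exponent `e`.
The low bit selects the factor `b` or 1 arithmetically, so the body has no branch. -/
theorem wp_inverse {w z p r n cl s M base a9 a10 a11 a16 t : ℕ} {mem : ℕ → ℕ} (hp : 2 ≤ p)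
    (hr : r < p) (hw : 4 * (p * p) < 2 ^ w) :
    WP w inverse ⟨[z, p, r, n, cl, s, M, base, 0, a9, a10, a11, 0, 0, 0, 0, a16, 0, 0, 0],
        mem, [], t⟩
      (fun σ => ∃ ri b15 b16, ri < p ∧ (ri : ZMod p) = (r : ZMod p) ^ (p - 2) ∧
        σ.env = [z, p, r, n, cl, s, M, base, ri, a9, a10, a11, 0, 0, 0, b15, b16, 0, 0, 0] ∧
        σ.mem = mem ∧ σ.out = [] ∧ σ.time ≤ t + 20 + 40 * Nat.size (p - 2)) := by
  have hpp : p ≤ p * p := Nat.le_mul_self p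
  refine WP.seq (WP.block ?_ ?_)
  · generalize 2 ^ w = B at *
    simp [Oks, Instr.run, Instr.Ok, numVars]
    omega
  simp only [runs, Instr.run, List.set_cons_zero, List.set_cons_succ]
  simp only [val_var, val_lit, val_sub, cost_var, cost_lit, cost_sub, List.getD_cons_zero,
    List.getD_cons_succ]
  refine WP.seq (WP.loop_count (b := .lt 18 12) ⟨by decide, by decide⟩ (Nat.size (p - 2))
    (fun k σ => ∃ a b, a < p ∧ b < p ∧
      (a : ZMod p) * (b : ZMod p) ^ ((p - 2) / 2 ^ k) = (r : ZMod p) ^ (p - 2) ∧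
      σ.env = [z, p, r, n, cl, s, M, base, 0, a9, a10, a11, (p - 2) / 2 ^ k, 0, 0, b, a, 0, 0, 0] ∧
      σ.mem = mem ∧ σ.out = [] ∧ σ.time ≤ t + 10 + 40 * k) ?_ ?_ ?_)
  · rintro k hk ⟨e, m, o, t'⟩ ⟨a, b, ha, hb, hab, he, hm, ho, ht⟩
    simp only at he hm ho ht
    subst he hm ho
    have hpos : 0 < (p - 2) / 2 ^ k := Nat.div_pos (Nat.lt_size.1 hk) (by positivity)
    have hle : (p - 2) / 2 ^ k ≤ p - 2 := Nat.div_le_self _ _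
    have hnext : (p - 2) / 2 ^ (k + 1) = (p - 2) / 2 ^ k / 2 := by
      rw [pow_succ, Nat.div_div_eq_div_mul]
    rw [hnext]
    generalize (p - 2) / 2 ^ k = e at *
    have hbb := Nat.mul_le_mul hb.le hb.le
    have hab' := Nat.mul_le_mul ha.le hb.le
    refine ⟨by simpa [WP.TestOn, Test.Holds] using hpos, ?_⟩
    rcases Nat.mod_two_eq_zero_or_one e with h2 | h2
    · refine WP.block ?_ ?_
      · generalize 2 ^ w = B at *
        simp [Oks, Instr.run, Instr.Ok, numVars, h2]
        omega
      simp only [runs, Instr.run, List.set_cons_zero, List.set_cons_succ]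
      simp only [val_var, val_lit, val_sub, val_mul, val_mod, val_add, val_div, cost_var, cost_lit,
        cost_sub, cost_mul, cost_mod, cost_add, cost_div, List.getD_cons_zero, List.getD_cons_succ,
        h2]
      refine ⟨_, _, Nat.mod_lt _ (by omega), Nat.mod_lt _ (by omega), ?_, rfl, by trivial,
        by trivial, by omega⟩
      rw [← hab]
      obtain ⟨d, hd⟩ : ∃ d, e = 2 * d := ⟨e / 2, by omega⟩
      rw [hd, Nat.mul_div_cancel_left _ (by norm_num)]
      simp [pow_mul, pow_two]
    · refine WP.block ?_ ?_
      · generalize 2 ^ w = B at *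
        simp [Oks, Instr.run, Instr.Ok, numVars, h2]
        omega
      simp only [runs, Instr.run, List.set_cons_zero, List.set_cons_succ]
      simp only [val_var, val_lit, val_sub, val_mul, val_mod, val_add, val_div, cost_var, cost_lit,
        cost_sub, cost_mul, cost_mod, cost_add, cost_div, List.getD_cons_zero, List.getD_cons_succ,
        h2]
      refine ⟨_, _, Nat.mod_lt _ (by omega), Nat.mod_lt _ (by omega), ?_, rfl, by trivial,
        by trivial, by omega⟩
      rw [← hab]
      obtain ⟨d, hd⟩ : ∃ d, e = 2 * d + 1 := ⟨e / 2, by omega⟩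
      have : (2 * d + 1) / 2 = d := by omega
      rw [hd, this]
      simp [pow_mul, pow_succ]
      ring
  · rintro ⟨e, m, o, t'⟩ ⟨a, b, ha, hb, hab, he, hm, ho, ht⟩
    simp only at he hm ho ht
    subst he hm ho
    have h0 : (p - 2) / 2 ^ Nat.size (p - 2) = 0 := Nat.div_eq_of_lt (Nat.lt_size_self _)
    rw [h0] at hab ⊢
    refine ⟨by simp [WP.TestOn, Test.Holds], WP.block ?_ ?_⟩
    · generalize 2 ^ w = B at *
      simp [Oks, Instr.Ok, numVars]
      omega
    · simp only [runs, Instr.run, List.set_cons_zero, List.set_cons_succ]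
      simp only [val_var, cost_var, List.getD_cons_zero, List.getD_cons_succ]
      exact ⟨a, b, a, ha, by simpa using hab, rfl, by trivial, by trivial, by omega⟩
  · refine ⟨1, r, by omega, hr, by simp, by simp, rfl, rfl, ?_⟩
    simp only; omega

theorem wp_tables {L : Layout} {w base a9 a10 a11 a15 a16 t : ℕ} {inp : ℕ → ℕ} {A : ℕ → ℕ → ℕ}
    (e0 : A 0 = L.T) (e1 : A 1 = L.dist) (e2 : A 2 = L.idx) (e3 : A 3 = L.src) (e7 : A 7 = L.E)
    (hs0 : 0 < L.s 0) (hp : 2 ≤ L.p) (hr : L.r < L.p) (hri : L.ri < L.p) {X : ℕ} (hT : ∀ x, L.T x ≤ X)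
    (hw : base + 8 * L.size + 100 < 2 ^ w) (hX : L.p + X * L.p < 2 ^ w)
    (hpp : L.p * L.p < 2 ^ w) :
    WP w tables ⟨[L.z, L.p, L.r, L.n, L.cl, L.s 0, L.M, base, L.ri, a9, a10, a11, 0, 0, 0, a15, a16,
        0, 0, 0], memOf base inp A, [], t⟩
      (fun σ => ∃ A' b10 b13 b14 b15 b16, L.Arrays A' ∧ σ.env = [L.z, L.p, L.r, L.n, L.cl, L.s 0,
          L.M, base, L.ri, a9, b10, a11, 0, b13, b14, b15, b16, 0, 0, 0] ∧
        σ.mem = memOf base inp A' ∧ σ.out = [] ∧ σ.time ≤ t + 40 + 100 * L.size) := by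
  have hple : L.p ≤ L.p * L.p := Nat.le_mul_self _
  have hXle : X ≤ X * L.p := Nat.le_mul_of_pos_right _ (by omega)
  have hzs : 8 * L.z * L.s 0 ≤ L.size := by unfold Layout.size; omega
  have hM : 2 * L.M ≤ L.size := by unfold Layout.size; omega
  have hs : L.s 0 ≤ L.M := by unfold Layout.M; omega
  refine WP.seq (WP.block ?_ ?_)
  · have hz : 8 * L.z ≤ 8 * L.z * L.s 0 := Nat.le_mul_of_pos_right _ hs0
    generalize 2 ^ w = B at *
    simp [Oks, Instr.run, Instr.Ok, numVars]
    omega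
  simp only [runs, Instr.run, List.set_cons_zero, List.set_cons_succ]
  simp only [val_var, val_lit, val_add, val_mul, cost_var, cost_lit, cost_add, cost_mul,
    List.getD_cons_zero, List.getD_cons_succ]
  have h1 : ∀ x, L.pf x < L.p := fun x => Nat.mod_lt _ (by omega)
  have h2 : ∀ x, L.pw x < L.p := fun x => Nat.mod_lt _ (by omega)
  have h3 : ∀ x, L.ip x < L.p := fun x => Nat.mod_lt _ (by omega)
  refine WP.loop_count (b := .lt 10 13) ⟨by decide, by decide⟩ L.size
    (fun k σ => ∃ A', (A' 0 = A 0 ∧ A' 1 = A 1 ∧ A' 2 = A 2 ∧ A' 3 = A 3 ∧ A' 7 = A 7) ∧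
      (∀ x < k, A' 4 x = L.pf x ∧ A' 5 x = L.pw x ∧ A' 6 x = L.ip x) ∧
      σ.env = [L.z, L.p, L.r, L.n, L.cl, L.s 0, L.M, base, L.ri, a9, k, a11, 0, L.size, L.pw k,
        L.ip k, L.pf k, 0, 0, 0] ∧ σ.mem = memOf base inp A' ∧ σ.out = [] ∧
      σ.time ≤ t + 30 + 100 * k) ?_ ?_ ?_
  · rintro k hk ⟨e, m, o, t'⟩ ⟨A', ⟨g0, g1, g2, g3, g7⟩, hA, he, hm, ho, ht⟩
    simp only at he hm ho ht
    subst he hm ho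
    have u1 := h1 k
    have u2 := h2 k
    have u3 := h3 k
    have hTk := hT k
    have v1 := Nat.mul_le_mul hTk u2.le
    have v2 := Nat.mul_le_mul u2.le hr.le
    have v3 := Nat.mul_le_mul u3.le hri.le
    have hT0 : A' 0 k = L.T k := by rw [g0, e0]
    refine ⟨by simpa [WP.TestOn, Test.Holds] using hk, WP.block ?_ ?_⟩
    · generalize 2 ^ w = B at *
      simp [Oks, Instr.run, Instr.Ok, numVars, fa, memOf_zero, update_memOf, upd_ne, hT0]
      omega
    simp only [runs, Instr.run, List.set_cons_zero, List.set_cons_succ]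
    simp only [fa, val_var, val_lit, val_add, val_mul, val_mod, val_ld, cost_var, cost_lit,
      cost_add, cost_mul, cost_mod, cost_ld, List.getD_cons_zero, List.getD_cons_succ,
      update_memOf 4 _ _ (show 4 < 8 by decide), update_memOf 5 _ _ (show 5 < 8 by decide),
      update_memOf 6 _ _ (show 6 < 8 by decide), memOf_add 0 _ (show 0 < 8 by decide),
      upd_ne _ _ (show 0 ≠ 4 by decide), upd_ne _ _ (show 0 ≠ 5 by decide),
      upd_ne _ _ (show 0 ≠ 6 by decide), hT0, Layout.pw_succ, Layout.ip_succ, Layout.pf_succ]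
    refine ⟨_, ?_, ?_, by trivial, rfl, by trivial, by omega⟩
    · simp [upd, g0, g1, g2, g3, g7]
    · intro x hx
      simp only [upd, Function.update_apply]
      rcases Nat.lt_succ_iff_lt_or_eq.1 hx with h | rfl
      · simp [h.ne, hA x h]
      · simp
  · rintro ⟨e, m, o, t'⟩ ⟨A', ⟨g0, g1, g2, g3, g7⟩, hA, he, hm, ho, ht⟩
    simp only at he hm ho ht
    subst he hm ho
    refine ⟨by simp [WP.TestOn, Test.Holds], A', _, _, _, _, _, ⟨g0.trans e0, g1.trans e1,
      g2.trans e2, g3.trans e3, fun x hx => (hA x hx).1, fun x hx => (hA x hx).2.1,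
      fun x hx => (hA x hx).2.2, g7.trans e7⟩, rfl, rfl, rfl, ?_⟩
    simp only; omega
  · refine ⟨A, ⟨rfl, rfl, rfl, rfl, rfl⟩, by omega, ?_, rfl, rfl, ?_⟩
    · simp [Layout.pw, Layout.ip, Layout.pf, Layout.size, Nat.mod_eq_of_lt (show 1 < L.p by omega)]
    · simp only; omega

end RAM

/-! ### All positions and pointers stay inside the arrays -/

namespace Layout

variable {L : Layout}

/-- The padding on the right takes in the windows that overhang the text, so the table accesses need
no range tests. -/
theorem Good.window_le (h : L.Good) {l q : ℕ} (hl : l ≤ L.m) (hq : q < L.z) :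
    L.W l q + 8 * L.s l ≤ L.size := by
  cases l with
  | zero =>
    have : (q + 1) * (8 * L.s 0) ≤ L.z * (8 * L.s 0) := Nat.mul_le_mul_right _ hq
    have e1 : (q + 1) * (8 * L.s 0) = 8 * q * L.s 0 + 8 * L.s 0 := by ring
    have e2 : L.z * (8 * L.s 0) = 8 * L.z * L.s 0 := by ring
    simp only [W, size]; omega
  | succ l =>
    have e := s_succ (L := L) (l := l) (by omega)
    have h1 := h.E_real q hq
    have h2 := h.n_le
    have e2 : L.z * L.s 0 * 8 = 8 * L.z * L.s 0 := by ring
    have hM : 4 * L.s l ≤ L.M := Nat.mul_le_mul_left _ (s_le_zero l)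
    have h3 := h1.2
    have h4 := h1.1
    simp only [W, size]; omega

theorem Good.real_lt_size (h : L.Good) {x : ℕ} (hx : L.Real x) : x + L.M < L.size := by
  have h2 := h.n_le
  have e2 : L.z * L.s 0 * 8 = 8 * L.z * L.s 0 := by ring
  have h3 := hx.2
  simp only [size]; omega

theorem Good.E_lt_size (h : L.Good) {q : ℕ} (hq : q < L.z) : L.E q + L.M < L.size :=
  h.real_lt_size (h.E_real q hq)

theorem Good.n_le_size (h : L.Good) : L.n + L.M < L.size := by
  have h2 := h.n_le
  have e2 : L.z * L.s 0 * 8 = 8 * L.z * L.s 0 := by ring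
  have := h.M_pos
  simp only [size]; omega

theorem Good.dist_lt_size (h : L.Good) (x : ℕ) : L.dist x < L.size := by
  have h1 := h.dist_lt x
  have h2 := h.n_le_size
  omega

theorem Good.src_lt_size (h : L.Good) (x : ℕ) : L.src x < L.size := by
  have h2 := h.n_le_size
  by_cases hx : L.Real x
  · have := h.real_lt_size hx
    rcases Nat.eq_zero_or_pos (L.dist x) with h0 | h0
    · rw [h.src_self x hx h0]; omega
    · have := (h.src_lt x hx h0).2; omega
  · rw [h.src_out x hx]; omega

end Layout

theorem sweepStep_lt {dist g : ℕ → ℕ} {b N : ℕ} (hg : ∀ x, g x < N) (x y : ℕ) :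
    sweepStep dist b g x y < N := by
  rw [sweepStep, Function.update_apply]
  split_ifs <;> exact hg _

theorem sweep_lt {dist g : ℕ → ℕ} {b lo N : ℕ} (hg : ∀ x, g x < N) (k : ℕ) :
    ∀ x, sweep dist b lo k g x < N := by
  induction k with
  | zero => exact hg
  | succ k ih => exact sweepStep_lt ih _

theorem sweeps_lt {dist W g : ℕ → ℕ} {b len N : ℕ} (hg : ∀ x, g x < N) (q : ℕ) :
    ∀ x, sweeps dist W b len q g x < N := by
  induction q with
  | zero => exact hg
  | succ q ih => exact sweep_lt ih _

/-! ### One level: shortening the chains and output of the windows -/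

namespace RAM

open Ex Instr

theorem upd_update {A : ℕ → ℕ → ℕ} {g : ℕ → ℕ} (x v : ℕ) :
    upd (Function.update A 3 g) 3 x v = Function.update A 3 (Function.update g x v) := by
  rw [upd, Function.update_self, Function.update_idem]

/-- Truth value of `2 * s ≤ d`. -/
def farFrom (d : Ex) : Ex := lit 1 - (lit 1 - (d + lit 1 - lit 2 * var 5))

/-- Shortening of the copy chains in the neighbourhoods of one level, which start at `W`. -/
def sweepLevel (W : Ex) : Prog :=
  .seq (block [asg 9 (lit 0)])
    (.loop (.lt 9 0)
      (.seq (block [asg 10 W, asg 13 (W + lit 8 * var 5)])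
        (.seq (.loop (.lt 10 13)
          (block [asg 19 (ld (fa 3 (var 10))), asg 17 (farFrom (ld (fa 1 (var 19)))),
            sto (fa 3 (var 10)) (var 17 * ld (fa 3 (var 19)) + (lit 1 - var 17) * var 19),
            asg 10 (var 10 + lit 1)]))
          (block [asg 9 (var 9 + lit 1)]))))

/-- Output of the records of one level. -/
def emitLevel (W : Ex) : Prog :=
  .seq (block [asg 9 (lit 0)])
    (.loop (.lt 9 0)
      (.seq (block [asg 10 W, asg 11 (lit 0)])
        (.seq (.loop (.lt 11 12)
          (block [asg 17 (farFrom (ld (fa 1 (var 10)))),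
            asg 19 (var 17 * ld (fa 3 (var 10)) + (lit 1 - var 17) * var 10),
            asg 16 (ld (fa 2 (var 19))),
            emi (var 19 + lit 2 * var 5 - ld (fa 7 (var 16))), emi (var 16),
            emi ((ld (fa 4 (var 10)) + var 1 -
              ld (fa 5 (var 10 - var 19)) * ld (fa 4 (var 19)) % var 1) % var 1),
            emi (ld (fa 5 (var 10 - var 19))), emi (ld (fa 6 (var 10 - var 19))),
            asg 10 (var 10 + var 5), asg 11 (var 11 + lit 1)]))
          (block [asg 9 (var 9 + lit 1)]))))

/-- The expression `We` evaluates to the start of the neighbourhood of phrase `q` at level `l`. -/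
structure Starts (L : Layout) (w base l : ℕ) (We : Ex) (mem : ℕ → ℕ) : Prop where
  cost : We.cost ≤ 20
  ok : ∀ q < L.z, ∀ x i hi c d u v y, We.Ok (2 ^ w) [L.z, L.p, L.r, L.n, L.cl, L.s l, L.M, base, L.ri, q, x, i, 8, hi,
    c, d, u, v, 0, y] mem
  val : ∀ q < L.z, ∀ x i hi c d u v y, We.val [L.z, L.p, L.r, L.n, L.cl, L.s l, L.M, base, L.ri, q, x, i, 8, hi,
    c, d, u, v, 0, y] mem = L.W l q

section

variable {L : Layout} {A : ℕ → ℕ → ℕ} {inp g : ℕ → ℕ} {w base l c d : ℕ} {We : Ex}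

theorem wp_sweepLevel (h : L.Good) (hA : L.Arrays A) (hl : l ≤ L.m) (hg : ∀ x, g x < L.size)
    (hw : base + 8 * L.size + 100 < 2 ^ w)
    (hW : ∀ g, Starts L w base l We (memOf base inp (Function.update A 3 g)))
    {b9 x i hi u v y t : ℕ} {o : List ℕ} :
    WP w (sweepLevel We) ⟨[L.z, L.p, L.r, L.n, L.cl, L.s l, L.M, base, L.ri, b9, x, i, 8, hi, c, d,
        u, v, 0, y], memOf base inp (Function.update A 3 g), o, t⟩
      (fun σ => ∃ b9 x hi v y, σ.env = [L.z, L.p, L.r, L.n, L.cl, L.s l, L.M, base, L.ri, b9, x, i,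
          8, hi, c, d, u, v, 0, y] ∧
        σ.mem = memOf base inp (Function.update A 3
          (sweeps L.dist (L.W l) (2 * L.s l) (8 * L.s l) L.z g)) ∧
        σ.out = o ∧ σ.time ≤ t + 10 + L.z * (100 + 800 * L.s l)) := by
  have hs := h.s_pos l
  refine WP.seq (WP.block ?_ ?_)
  · generalize 2 ^ w = B at *
    simp [Oks, Instr.Ok, numVars]
    omega
  simp only [runs, Instr.run, List.set_cons_zero, List.set_cons_succ, val_lit, cost_lit]
  refine WP.loop_count (b := .lt 9 0) ⟨by decide, by decide⟩ L.z
    (fun q σ => ∃ x hi v y, σ.env = [L.z, L.p, L.r, L.n, L.cl, L.s l, L.M, base, L.ri, q, x, i,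
          8, hi, c, d, u, v, 0, y] ∧
        σ.mem = memOf base inp (Function.update A 3
          (sweeps L.dist (L.W l) (2 * L.s l) (8 * L.s l) q g)) ∧
        σ.out = o ∧ σ.time ≤ t + 5 + q * (100 + 800 * L.s l)) ?_ ?_ ?_
  · rintro q hq ⟨e, m, o, t'⟩ ⟨x, hi, v, y, he, hm, ho, ht⟩
    simp only at he hm ho ht
    subst he hm ho
    refine ⟨by simpa [WP.TestOn, Test.Holds] using hq, ?_⟩
    obtain ⟨Wc, Wo, Wv⟩ := hW (sweeps L.dist (L.W l) (2 * L.s l) (8 * L.s l) q g)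
    have hlt := sweeps_lt (dist := L.dist) (W := L.W l) (b := 2 * L.s l) (len := 8 * L.s l) hg q
    have hle := h.window_le hl hq
    have hz := h.E_lt_size hq
    refine WP.seq (WP.block ?_ ?_)
    · generalize 2 ^ w = B at *
      simp [Oks, Instr.run, Instr.Ok, numVars, Wo q hq, Wv q hq]
      omega
    simp only [runs, Instr.run, List.set_cons_zero, List.set_cons_succ, val_add, val_mul, val_var,
      val_lit, cost_add, cost_mul, cost_var, cost_lit, Wv q hq, List.getD_cons_zero,
      List.getD_cons_succ]
    refine WP.seq (WP.loop_count (b := .lt 10 13) ⟨by decide, by decide⟩ (8 * L.s l)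
      (fun k σ => ∃ v y, σ.env = [L.z, L.p, L.r, L.n, L.cl, L.s l, L.M, base, L.ri, q, L.W l q + k,
          i, 8, L.W l q + 8 * L.s l, c, d, u, v, 0, y] ∧
        σ.mem = memOf base inp (Function.update A 3 (sweep L.dist (2 * L.s l) (L.W l q) k
          (sweeps L.dist (L.W l) (2 * L.s l) (8 * L.s l) q g))) ∧
        σ.out = o ∧ σ.time ≤ t' + 60 + 100 * k) ?_ ?_ ?_)
    · rintro k hk ⟨e, m, o, t''⟩ ⟨v, y, he, hm, ho, ht''⟩
      simp only at he hm ho ht''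
      subst he hm ho
      have hlt' := sweep_lt (dist := L.dist) (lo := L.W l q) (b := 2 * L.s l) hlt k
      have hd := h.dist_lt_size
      have hst : sweep L.dist (2 * L.s l) (L.W l q) (k + 1)
          (sweeps L.dist (L.W l) (2 * L.s l) (8 * L.s l) q g) = sweepStep L.dist (2 * L.s l)
          (sweep L.dist (2 * L.s l) (L.W l q) k
          (sweeps L.dist (L.W l) (2 * L.s l) (8 * L.s l) q g)) (L.W l q + k) := rfl
      rw [hst]
      generalize sweep L.dist (2 * L.s l) (L.W l q) k
          (sweeps L.dist (L.W l) (2 * L.s l) (8 * L.s l) q g) = g at *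
      have hk' := hlt' (L.W l q + k)
      have hk'' := hlt' (g (L.W l q + k))
      have hdk := hd (g (L.W l q + k))
      refine ⟨by simpa [WP.TestOn, Test.Holds] using hk, ?_⟩
      have a1 := hA.dist
      by_cases hf : 2 * L.s l ≤ L.dist (g (L.W l q + k))
      -- With truncated subtraction this expression is 1 if `2 * s l ≤ dist` and 0 otherwise; it
      -- replaces a branch by a weighted sum.
      · have hflag : 1 - (1 - (L.dist (g (L.W l q + k)) + 1 - 2 * L.s l)) = 1 := by omega
        refine WP.block ?_ ?_
        · generalize 2 ^ w = B at *
          simp [Oks, Instr.run, Instr.Ok, numVars, fa, farFrom, memOf_add, a1, hflag]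
          omega
        · simp only [runs, Instr.run, List.set_cons_zero, List.set_cons_succ]
          simp only [fa, farFrom, val_var, val_lit, val_add, val_mul, val_sub, val_ld, cost_var,
            cost_lit, cost_add, cost_mul, cost_sub, cost_ld, List.getD_cons_zero,
            List.getD_cons_succ, update_memOf 3 _ _ (show 3 < 8 by decide), upd_update,
            memOf_add 3 _ (show 3 < 8 by decide), memOf_add 1 _ (show 1 < 8 by decide),
            Function.update_self, Function.update_of_ne (show 1 ≠ 3 by decide), a1, hflag]
          refine ⟨1, _, by rfl, ?_, by trivial, by omega⟩
          rw [sweepStep, if_pos hf, one_mul, Nat.sub_self, zero_mul, add_zero]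
      · have hflag : 1 - (1 - (L.dist (g (L.W l q + k)) + 1 - 2 * L.s l)) = 0 := by omega
        refine WP.block ?_ ?_
        · generalize 2 ^ w = B at *
          simp [Oks, Instr.run, Instr.Ok, numVars, fa, farFrom, memOf_add, a1, hflag]
          omega
        · simp only [runs, Instr.run, List.set_cons_zero, List.set_cons_succ]
          simp only [fa, farFrom, val_var, val_lit, val_add, val_mul, val_sub, val_ld, cost_var,
            cost_lit, cost_add, cost_mul, cost_sub, cost_ld, List.getD_cons_zero,
            List.getD_cons_succ, update_memOf 3 _ _ (show 3 < 8 by decide), upd_update,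
            memOf_add 3 _ (show 3 < 8 by decide), memOf_add 1 _ (show 1 < 8 by decide),
            Function.update_self, Function.update_of_ne (show 1 ≠ 3 by decide), a1, hflag]
          refine ⟨0, _, by rfl, ?_, by trivial, by omega⟩
          rw [sweepStep, if_neg hf, zero_mul, Nat.sub_zero, one_mul, zero_add]
    · rintro ⟨e, m, o, t''⟩ ⟨v, y, he, hm, ho, ht''⟩
      simp only at he hm ho ht''
      subst he hm ho
      refine ⟨by simp [WP.TestOn, Test.Holds], WP.block ?_ ?_⟩
      · have := h.z_le
        have := h.n_le_size
        generalize 2 ^ w = B at *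
        simp [Oks, Instr.Ok, numVars]
        omega
      · simp only [runs, Instr.run, List.set_cons_zero, List.set_cons_succ, val_add, val_var,
          val_lit, cost_add, cost_var, cost_lit, List.getD_cons_zero, List.getD_cons_succ]
        refine ⟨_, _, _, _, by rfl, by rfl, by trivial, ?_⟩
        have : (q + 1) * (100 + 800 * L.s l) = q * (100 + 800 * L.s l) + (100 + 800 * L.s l) := by
          ring
        omega
    · refine ⟨v, y, by simp, rfl, rfl, ?_⟩
      simp only; omega
  · rintro ⟨e, m, o, t'⟩ ⟨x, hi, v, y, he, hm, ho, ht⟩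
    simp only at he hm ho ht
    subst he hm ho
    refine ⟨by simp [WP.TestOn, Test.Holds], _, _, _, _, _, rfl, rfl, rfl, ?_⟩
    simp only; omega
  · exact ⟨_, _, _, _, rfl, rfl, rfl, by simp only; omega⟩

end

end RAM

theorem Layout.Y_lt {L : Layout} {l x : ℕ} (hg : ∀ x, L.G l x < L.size)
    (hx : x < L.size) : L.Y l x < L.size := by
  unfold Layout.Y
  split_ifs
  · exact hg x
  · exact hx

namespace RAM

open Ex Instr

section

variable {L : Layout} {A : ℕ → ℕ → ℕ} {inp g : ℕ → ℕ} {w base l c d : ℕ} {We : Ex}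

theorem wp_emitLevel (h : L.Good) (hA : L.Arrays A) (hl : l ≤ L.m) (hg : ∀ x, L.G l x < L.size)
    (hp : 0 < L.p)
    (hw : base + 8 * L.size + 100 < 2 ^ w) (hpp : 2 * (L.p * L.p) < 2 ^ w)
    (hW : Starts L w base l We (memOf base inp (Function.update A 3 (L.G l))))
    {b9 x i hi u v y t : ℕ} {o : List ℕ} :
    WP w (emitLevel We) ⟨[L.z, L.p, L.r, L.n, L.cl, L.s l, L.M, base, L.ri, b9, x, i, 8, hi, c, d,
        u, v, 0, y], memOf base inp (Function.update A 3 (L.G l)), o, t⟩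
      (fun σ => ∃ b9 x i u v y, σ.env = [L.z, L.p, L.r, L.n, L.cl, L.s l, L.M, base, L.ri, b9, x, i,
          8, hi, c, d, u, v, 0, y] ∧
        σ.mem = memOf base inp (Function.update A 3 (L.G l)) ∧
        σ.out = o ++ L.level l ∧ σ.time ≤ t + 10 + L.z * 2000) := by
  have hs := h.s_pos l
  have hple : L.p ≤ L.p * L.p := Nat.le_mul_self _
  obtain ⟨Wc, Wo, Wv⟩ := hW
  have h1 : ∀ x, L.pf x < L.p := fun x => Nat.mod_lt _ (by omega)
  have h2 : ∀ x, L.pw x < L.p := fun x => Nat.mod_lt _ (by omega)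
  have h3 : ∀ x, L.ip x < L.p := fun x => Nat.mod_lt _ (by omega)
  refine WP.seq (WP.block ?_ ?_)
  · generalize 2 ^ w = B at *
    simp [Oks, Instr.Ok, numVars]
    omega
  simp only [runs, Instr.run, List.set_cons_zero, List.set_cons_succ, val_lit, cost_lit]
  refine WP.loop_count (b := .lt 9 0) ⟨by decide, by decide⟩ L.z
    (fun q σ => ∃ x i u v y, σ.env = [L.z, L.p, L.r, L.n, L.cl, L.s l, L.M, base, L.ri, q, x, i,
          8, hi, c, d, u, v, 0, y] ∧
        σ.mem = memOf base inp (Function.update A 3 (L.G l)) ∧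
        σ.out = o ++ (List.range (8 * q)).flatMap (fun j => L.node l (L.A l j)) ∧
        σ.time ≤ t + 5 + q * 2000) ?_ ?_ ?_
  · rintro q hq ⟨e, m, o', t'⟩ ⟨x, i, u, v, y, he, hm, ho, ht⟩
    simp only at he hm ho ht
    subst he hm ho
    refine ⟨by simpa [WP.TestOn, Test.Holds] using hq, ?_⟩
    have hle := h.window_le hl hq
    have hz := h.E_lt_size hq
    refine WP.seq (WP.block ?_ ?_)
    · generalize 2 ^ w = B at *
      simp [Oks, Instr.run, Instr.Ok, numVars, Wo q hq]
      omega
    simp only [runs, Instr.run, List.set_cons_zero, List.set_cons_succ,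
      val_lit, cost_lit, Wv q hq]
    refine WP.seq (WP.loop_count (b := .lt 11 12) ⟨by decide, by decide⟩ 8
      (fun k σ => ∃ u v y, σ.env = [L.z, L.p, L.r, L.n, L.cl, L.s l, L.M, base, L.ri, q,
          L.W l q + k * L.s l, k, 8, hi, c, d, u, v, 0, y] ∧
        σ.mem = memOf base inp (Function.update A 3 (L.G l)) ∧
        σ.out = o ++ (List.range (8 * q + k)).flatMap (fun j => L.node l (L.A l j)) ∧
        σ.time ≤ t' + 30 + 200 * k) ?_ ?_ ?_)
    · rintro k hk ⟨e, m, o', t''⟩ ⟨u, v, y, he, hm, ho, ht''⟩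
      simp only at he hm ho ht''
      subst he hm ho
      have hks : k * L.s l + L.s l ≤ 8 * L.s l := by
        rw [← Nat.succ_mul]; exact Nat.mul_le_mul_right _ hk
      have hAx : L.A l (8 * q + k) = L.W l q + k * L.s l := by
        rw [Layout.A, show (8 * q + k) / 8 = q by omega, show (8 * q + k) % 8 = k by omega]
      have hnext : L.W l q + (k + 1) * L.s l = L.W l q + k * L.s l + L.s l := by ring
      rw [← Nat.add_assoc, List.range_succ, List.flatMap_append, List.flatMap_singleton, hAx,
        hnext]
      have hx : L.W l q + k * L.s l + L.s l ≤ L.size := by omega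
      generalize L.W l q + k * L.s l = x at *
      have hd := h.dist_lt_size x
      have hgx := hg x
      have hY := Layout.Y_lt hg (show x < L.size by omega)
      have hi := h.idx_lt (L.Y l x)
      have hE := h.E_lt_size hi
      have i1 := h1 x
      have i2 := h1 (L.Y l x)
      have i3 := h2 (x - L.Y l x)
      have i4 := h3 (x - L.Y l x)
      have i5 := Nat.mul_le_mul i3.le i2.le
      have i6 : (L.pw (x - L.Y l x) * L.pf (L.Y l x)) % L.p < L.p := Nat.mod_lt _ hp
      have a1 := hA.dist
      have a2 := hA.idx
      have a7 := hA.E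
      have a4 := hA.pf x (by omega)
      have a4' := hA.pf (L.Y l x) hY
      have a5 := hA.pw (x - L.Y l x) (by omega)
      have a6 := hA.ip (x - L.Y l x) (by omega)
      have hsz : 2 * L.s l ≤ L.size := by omega
      have hidx : L.idx (L.Y l x) < L.size := by
        have := h.z_le
        have := h.n_le_size
        omega
      refine ⟨by simpa [WP.TestOn, Test.Holds] using hk, ?_⟩
      rcases Decidable.em (2 * L.s l ≤ L.dist x) with hf | hf
      · have hflag : 1 - (1 - (L.dist x + 1 - 2 * L.s l)) = 1 := by omega
        have hYx : L.Y l x = L.G l x := if_pos hf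
        rw [← hYx] at hgx
        refine WP.block ?_ ?_
        · generalize 2 ^ w = B at *
          simp [Oks, Instr.run, Instr.Ok, numVars, fa, farFrom, memOf_add, a1, a2, a7,
            a4, a4', a5, a6, hflag, ← hYx]
          omega
        · simp only [runs, Instr.run, List.set_cons_zero, List.set_cons_succ]
          simp only [fa, farFrom, val_var, val_lit, val_add, val_mul, val_sub, val_ld, val_mod,
            cost_var, cost_lit, cost_add, cost_mul, cost_sub, cost_ld, cost_mod,
            List.getD_cons_zero, List.getD_cons_succ,
            memOf_add 1 _ (show 1 < 8 by decide), memOf_add 2 _ (show 2 < 8 by decide),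
            memOf_add 3 _ (show 3 < 8 by decide), memOf_add 4 _ (show 4 < 8 by decide),
            memOf_add 5 _ (show 5 < 8 by decide), memOf_add 6 _ (show 6 < 8 by decide),
            memOf_add 7 _ (show 7 < 8 by decide), Function.update_self,
            Function.update_of_ne (show 1 ≠ 3 by decide),
            Function.update_of_ne (show 2 ≠ 3 by decide),
            Function.update_of_ne (show 4 ≠ 3 by decide),
            Function.update_of_ne (show 5 ≠ 3 by decide),
            Function.update_of_ne (show 6 ≠ 3 by decide),
            Function.update_of_ne (show 7 ≠ 3 by decide), a1, a2, a7, a4, hflag, ← hYx, one_mul,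
            Nat.sub_self, zero_mul, add_zero, a4', a5, a6]
          refine ⟨_, _, _, by rfl, by trivial, ?_, by omega⟩
          simp [Layout.node]
      · have hflag : 1 - (1 - (L.dist x + 1 - 2 * L.s l)) = 0 := by omega
        have hYx : L.Y l x = x := if_neg hf
        simp only [hYx, Nat.sub_self] at hi hE i2 i3 i4 i5 i6 a5 a6 hidx
        -- Here the copy is the window itself, so the shift is 0 and the tables are read at record
        -- 0.
        have m5 : memOf base inp (Function.update A 3 (L.G l)) (base + 5) = L.pw 0 := by
          simpa [a5] using memOf_add (base := base) (inp := inp)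
            (A := Function.update A 3 (L.G l)) 5 0 (by norm_num)
        have m6 : memOf base inp (Function.update A 3 (L.G l)) (base + 6) = L.ip 0 := by
          simpa [a6] using memOf_add (base := base) (inp := inp)
            (A := Function.update A 3 (L.G l)) 6 0 (by norm_num)
        refine WP.block ?_ ?_
        · generalize 2 ^ w = B at *
          simp [Oks, Instr.run, Instr.Ok, numVars, fa, farFrom, memOf_add, a1, a2, a7,
            a4, m5, m6, hflag]
          omega
        · simp only [runs, Instr.run, List.set_cons_zero, List.set_cons_succ]
          simp only [fa, farFrom, val_var, val_lit, val_add, val_mul, val_sub, val_ld, val_mod,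
            cost_var, cost_lit, cost_add, cost_mul, cost_sub, cost_ld, cost_mod,
            List.getD_cons_zero, List.getD_cons_succ,
            memOf_add 1 _ (show 1 < 8 by decide), memOf_add 2 _ (show 2 < 8 by decide),
            memOf_add 3 _ (show 3 < 8 by decide), memOf_add 4 _ (show 4 < 8 by decide),
            memOf_add 7 _ (show 7 < 8 by decide), Function.update_self,
            Function.update_of_ne (show 1 ≠ 3 by decide),
            Function.update_of_ne (show 2 ≠ 3 by decide),
            Function.update_of_ne (show 4 ≠ 3 by decide),
            Function.update_of_ne (show 7 ≠ 3 by decide), a1, a2, a7, a4, hflag, one_mul,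
            Nat.sub_zero, Nat.sub_self, zero_mul, zero_add, m5, m6]
          refine ⟨_, _, _, by rfl, by trivial, ?_, by omega⟩
          simp [Layout.node, hYx]
    · rintro ⟨e, m, o', t''⟩ ⟨u, v, y, he, hm, ho, ht''⟩
      simp only at he hm ho ht''
      subst he hm ho
      refine ⟨by simp [WP.TestOn, Test.Holds], WP.block ?_ ?_⟩
      · have := h.z_le
        have := h.n_le_size
        generalize 2 ^ w = B at *
        simp [Oks, Instr.Ok, numVars]
        omega
      · simp only [runs, Instr.run, List.set_cons_zero, List.set_cons_succ, val_add, val_var,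
          val_lit, cost_add, cost_var, cost_lit, List.getD_cons_zero, List.getD_cons_succ]
        exact ⟨_, _, _, _, _, by rfl, by trivial, by rfl, by omega⟩
    · refine ⟨u, v, y, by simp, rfl, rfl, ?_⟩
      simp only; omega
  · rintro ⟨e, m, o', t'⟩ ⟨x, i, u, v, y, he, hm, ho, ht⟩
    simp only at he hm ho ht
    subst he hm ho
    refine ⟨by simp [WP.TestOn, Test.Holds], _, _, _, _, _, _, rfl, rfl, rfl, ?_⟩
    simp only; omega
  · exact ⟨_, _, _, _, _, rfl, rfl, by simp, by simp only; omega⟩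

end

end RAM

theorem Layout.Good.G_lt {L : Layout} (h : L.Good) (l : ℕ) : ∀ x, L.G l x < L.size := by
  induction l with
  | zero => exact sweeps_lt h.src_lt_size _
  | succ l ih => exact sweeps_lt ih _

/-! ### All levels and the leaves -/

namespace RAM

open Ex Instr

/-- The start of a neighbourhood at the top level. -/
def startTop : Ex := var 6 + lit 8 * var 9 * var 5

/-- The start of a neighbourhood at the other levels. -/
def startBelow : Ex := ld (fa 7 (var 9)) - lit 4 * var 5

/-- The records of one level. -/
def level (W : Ex) : Prog :=
  .seq (sweepLevel W) (.seq (emitLevel W) (block [asg 5 (var 5 / lit 2)]))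

/-- Output of the leaves. -/
def emitLeaves : Prog :=
  .seq (block [asg 9 (lit 0)])
    (.loop (.lt 9 0)
      (.seq (block [asg 10 (ld (fa 7 (var 9)) - lit 2 * var 4), asg 13 (var 10 + lit 4 * var 4)])
        (.seq (.loop (.lt 10 13)
          (block [emi (ld (fa 0 (var 10))), emi (ld (fa 4 (var 10))),
            emi ((ld (fa 4 (var 10)) + ld (fa 0 (var 10)) * ld (fa 5 (var 10))) % var 1),
            emi (ld (fa 6 (var 10))), asg 10 (var 10 + lit 1)]))
          (block [asg 9 (var 9 + lit 1)]))))

/-- Output of the data structure from the arrays. -/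
def emitAll : Prog :=
  .seq (block [emi (var 0), emi (var 1), emi (var 2), emi (var 4), emi (var 5), asg 12 (lit 8)])
    (.seq (level startTop) (.seq (.loop (.le 4 5) (level startBelow)) emitLeaves))

section

variable {L : Layout} {A : ℕ → ℕ → ℕ} {inp g : ℕ → ℕ} {w base l c d : ℕ}

theorem starts_top (h : L.Good) (hw : base + 8 * L.size + 100 < 2 ^ w) (mem : ℕ → ℕ) :
    Starts L w base 0 startTop mem := by
  have hs := h.s_pos 0
  refine ⟨by simp [startTop], fun q hq x i hi c d u v y => ?_, fun q hq x i hi c d u v y => ?_⟩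
  · have h1 := h.window_le (Nat.zero_le _) hq
    have h2 : 8 * q ≤ 8 * q * L.s 0 := Nat.le_mul_of_pos_right _ hs
    simp only [Layout.W] at h1
    generalize 2 ^ w = B at *
    simp [startTop, numVars]
    omega
  · simp [startTop, Layout.W]

/-- The register holds `s (l + 1)`, and `E q - 2 * s l` equals `E q - 4 * s (l + 1)`. -/
theorem starts_below (h : L.Good) (hE : A 7 = L.E) (hl : l < L.m)
    (hw : base + 8 * L.size + 100 < 2 ^ w) (g : ℕ → ℕ) :
    Starts L w base (l + 1) startBelow (memOf base inp (Function.update A 3 g)) := by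
  have e := Layout.s_succ hl
  refine ⟨by simp [startBelow, fa], fun q hq x i hi c d u v y => ?_,
    fun q hq x i hi c d u v y => ?_⟩
  · have h1 := h.E_lt_size hq
    have h2 := h.z_le
    have h3 := h.n_le_size
    have hM : 4 * L.s l ≤ L.M := Nat.mul_le_mul_left _ (Layout.s_le_zero l)
    generalize 2 ^ w = B at *
    simp [startBelow, fa, numVars, memOf_add, hE]
    omega
  · simp [startBelow, fa, memOf_add, hE, Layout.W]
    omega

theorem wp_level (h : L.Good) (hA : L.Arrays A) (hl : l ≤ L.m) (hg : ∀ x, g x < L.size)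
    (hG : L.G l = sweeps L.dist (L.W l) (2 * L.s l) (8 * L.s l) L.z g) (hp : 0 < L.p)
    (hw : base + 8 * L.size + 100 < 2 ^ w) (hpp : 2 * (L.p * L.p) < 2 ^ w) {We : Ex}
    (hW : ∀ g, Starts L w base l We (memOf base inp (Function.update A 3 g)))
    {b9 x i hi u v y t : ℕ} {o : List ℕ} :
    WP w (level We) ⟨[L.z, L.p, L.r, L.n, L.cl, L.s l, L.M, base, L.ri, b9, x, i, 8, hi, c, d,
        u, v, 0, y], memOf base inp (Function.update A 3 g), o, t⟩
      (fun σ => ∃ b9 x i hi u v y, σ.env = [L.z, L.p, L.r, L.n, L.cl, L.s l / 2, L.M, base, L.ri,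
          b9, x, i, 8, hi, c, d, u, v, 0, y] ∧
        σ.mem = memOf base inp (Function.update A 3 (L.G l)) ∧
        σ.out = o ++ L.level l ∧ σ.time ≤ t + 50 + 2100 * L.z + 800 * (L.z * L.s l)) := by
  refine WP.seq ((wp_sweepLevel h hA hl hg hw hW).mono ?_)
  rintro ⟨e, m, o', t'⟩ ⟨b9, x, hi, v, y, he, hm, ho, ht⟩
  simp only at he hm ho ht
  subst he hm ho
  rw [← hG]
  refine WP.seq ((wp_emitLevel h hA hl (h.G_lt l) hp hw hpp (hW _)).mono ?_)
  rintro ⟨e, m, o', t''⟩ ⟨b9, x, i, u, v, y, he, hm, ho, ht''⟩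
  simp only at he hm ho ht''
  subst he hm ho
  refine WP.block ?_ ?_
  · have hle := h.window_le hl h.z_pos
    generalize 2 ^ w = B at *
    simp [Oks, Instr.Ok, numVars]
    omega
  · simp only [runs, Instr.run, List.set_cons_zero, List.set_cons_succ, val_div, val_var,
      val_lit, cost_div, cost_var, cost_lit, List.getD_cons_zero, List.getD_cons_succ]
    refine ⟨_, _, _, _, _, _, _, by rfl, by trivial, by trivial, ?_⟩
    have : L.z * (100 + 800 * L.s l) = 100 * L.z + 800 * (L.z * L.s l) := by ring
    omega

theorem wp_emitLeaves (h : L.Good) (hA : L.Arrays A) (hp : 0 < L.p) {X : ℕ}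
    (hT : ∀ x, L.T x ≤ X) (hw : base + 8 * L.size + 100 < 2 ^ w) (hX : L.p + X * L.p < 2 ^ w)
    {sv b9 x i b12 hi u v y t : ℕ} {o : List ℕ} :
    WP w emitLeaves ⟨[L.z, L.p, L.r, L.n, L.cl, sv, L.M, base, L.ri, b9, x, i, b12, hi, c, d,
        u, v, 0, y], memOf base inp (Function.update A 3 g), o, t⟩
      (fun σ => σ.out = o ++ L.leaves ∧
        σ.time ≤ t + 10 + 100 * L.z + 400 * (L.z * L.cl)) := by
  have hcl := Layout.cl_le (L := L) 0
  have hcl0 := h.cl_pos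
  have hM : L.M = 4 * L.s 0 := rfl
  have hXle : X ≤ X * L.p := Nat.le_mul_of_pos_right _ hp
  have hzn := h.z_le
  have hns := h.n_le_size
  have hW : ∀ q, L.W (L.m + 1) q = L.E q - 2 * L.cl := fun q => by
    rw [Layout.W, Layout.s_last]
  have h1 : ∀ x, L.pf x < L.p := fun x => Nat.mod_lt _ (by omega)
  have h2 : ∀ x, L.pw x < L.p := fun x => Nat.mod_lt _ (by omega)
  have h3 : ∀ x, L.ip x < L.p := fun x => Nat.mod_lt _ (by omega)
  refine WP.seq (WP.block ?_ ?_)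
  · generalize 2 ^ w = B at *
    simp [Oks, Instr.Ok, numVars]
    omega
  simp only [runs, Instr.run, List.set_cons_zero, List.set_cons_succ, val_lit, cost_lit]
  refine WP.loop_count (b := .lt 9 0) ⟨by decide, by decide⟩ L.z
    (fun q σ => ∃ x hi, σ.env = [L.z, L.p, L.r, L.n, L.cl, sv, L.M, base, L.ri, q, x, i,
          b12, hi, c, d, u, v, 0, y] ∧
        σ.mem = memOf base inp (Function.update A 3 g) ∧
        σ.out = o ++ (List.range (q * (4 * L.cl))).flatMap (fun k =>
          L.leaf (L.W (L.m + 1) (k / (4 * L.cl)) + k % (4 * L.cl))) ∧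
        σ.time ≤ t + 5 + q * (100 + 400 * L.cl)) ?_ ?_ ?_
  · rintro q hq ⟨e, m, o', t'⟩ ⟨x, hi, he, hm, ho, ht⟩
    simp only at he hm ho ht
    subst he hm ho
    refine ⟨by simpa [WP.TestOn, Test.Holds] using hq, ?_⟩
    have hz := h.E_lt_size hq
    have hzr := (h.E_real q hq).1
    have a7 := hA.E
    refine WP.seq (WP.block ?_ ?_)
    · generalize 2 ^ w = B at *
      simp [Oks, Instr.run, Instr.Ok, numVars, fa, memOf_add, a7]
      omega
    simp only [runs, Instr.run, List.set_cons_zero, List.set_cons_succ, fa, val_ld, val_add,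
      val_sub, val_mul, val_var, cost_ld, cost_add, cost_sub, cost_mul, cost_var,
      val_lit, cost_lit, List.getD_cons_zero, List.getD_cons_succ,
      memOf_add 7 _ (show 7 < 8 by decide), Function.update_of_ne (show 7 ≠ 3 by decide), a7]
    refine WP.seq (WP.loop_count (b := .lt 10 13) ⟨by decide, by decide⟩ (4 * L.cl)
      (fun k σ => σ.env = [L.z, L.p, L.r, L.n, L.cl, sv, L.M, base, L.ri, q,
          L.E q - 2 * L.cl + k, i, b12, L.E q - 2 * L.cl + 4 * L.cl, c, d, u, v, 0, y] ∧
        σ.mem = memOf base inp (Function.update A 3 g) ∧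
        σ.out = o ++ (List.range (q * (4 * L.cl) + k)).flatMap (fun k =>
          L.leaf (L.W (L.m + 1) (k / (4 * L.cl)) + k % (4 * L.cl))) ∧
        σ.time ≤ t' + 50 + 100 * k) ?_ ?_ ?_)
    · rintro k hk ⟨e, m, o', t''⟩ ⟨he, hm, ho, ht''⟩
      simp only at he hm ho ht''
      subst he hm ho
      have hAx : L.W (L.m + 1) ((q * (4 * L.cl) + k) / (4 * L.cl)) + (q * (4 * L.cl) + k) %
          (4 * L.cl) = L.E q - 2 * L.cl + k := by
        rw [add_comm (q * _), Nat.add_mul_div_right _ _ (by omega), Nat.add_mul_mod_self_right,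
          Nat.div_eq_of_lt hk, Nat.mod_eq_of_lt hk, zero_add, hW]
      have hnext : L.E q - 2 * L.cl + (k + 1) = L.E q - 2 * L.cl + k + 1 := by ring
      rw [← Nat.add_assoc (q * _), List.range_succ, List.flatMap_append, List.flatMap_singleton,
        hAx, hnext]
      have hx : L.E q - 2 * L.cl + k < L.size := by omega
      refine ⟨by simpa [WP.TestOn, Test.Holds] using hk, ?_⟩
      generalize L.E q - 2 * L.cl + 4 * L.cl = hi at *
      generalize L.E q - 2 * L.cl + k = x at *
      have i1 := h1 x
      have i3 := h2 x
      have i4 := h3 x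
      have hTx := hT x
      have i5 := Nat.mul_le_mul hTx i3.le
      have a0 := hA.T
      have a4 := hA.pf x (by omega)
      have a5 := hA.pw x (by omega)
      have a6 := hA.ip x (by omega)
      refine WP.block ?_ ?_
      · generalize 2 ^ w = B at *
        simp [Oks, Instr.run, Instr.Ok, numVars, memOf_add, memOf_zero, a0, a4, a5, a6]
        omega
      · simp only [runs, Instr.run, List.set_cons_zero, List.set_cons_succ]
        simp only [val_var, val_lit, val_add, val_mul, val_ld, val_mod,
          cost_var, cost_lit, cost_add, cost_mul, cost_ld, cost_mod,
          List.getD_cons_zero, List.getD_cons_succ,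
          memOf_add 0 _ (show 0 < 8 by decide), memOf_add 4 _ (show 4 < 8 by decide),
          memOf_add 5 _ (show 5 < 8 by decide), memOf_add 6 _ (show 6 < 8 by decide),
          Function.update_of_ne (show 0 ≠ 3 by decide),
          Function.update_of_ne (show 4 ≠ 3 by decide),
          Function.update_of_ne (show 5 ≠ 3 by decide),
          Function.update_of_ne (show 6 ≠ 3 by decide), a0, a4, a5, a6]
        refine ⟨by trivial, by trivial, ?_, by omega⟩
        simp [Layout.leaf]
    · rintro ⟨e, m, o', t''⟩ ⟨he, hm, ho, ht''⟩
      simp only at he hm ho ht''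
      subst he hm ho
      refine ⟨by simp [WP.TestOn, Test.Holds], WP.block ?_ ?_⟩
      · generalize 2 ^ w = B at *
        simp [Oks, Instr.Ok, numVars]
        omega
      · simp only [runs, Instr.run, List.set_cons_zero, List.set_cons_succ, val_add, val_var,
          val_lit, cost_add, cost_var, cost_lit, List.getD_cons_zero, List.getD_cons_succ]
        rw [← Nat.succ_mul]
        refine ⟨_, _, by rfl, by trivial, by rfl, ?_⟩
        have : (q + 1) * (100 + 400 * L.cl) = q * (100 + 400 * L.cl) + (100 + 400 * L.cl) := by
          ring
        omega
    · refine ⟨by simp, rfl, by simp, ?_⟩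
      simp only; omega
  · rintro ⟨e, m, o', t'⟩ ⟨x, hi, he, hm, ho, ht⟩
    simp only at he hm ho ht
    subst he hm ho
    refine ⟨by simp [WP.TestOn, Test.Holds], rfl, ?_⟩
    have : L.z * (100 + 400 * L.cl) = 100 * L.z + 400 * (L.z * L.cl) := by ring
    simp only; omega
  · exact ⟨_, _, rfl, rfl, by simp, by simp only; omega⟩

/-- The sweep of level `k` overwrites the pointers of the level before, which have just been output
and serve as its starting point, so one array holds all the chains. -/
theorem wp_emitAll (h : L.Good) (hA : L.Arrays A) (hp : 2 ≤ L.p) (hr : L.r < L.p) {X : ℕ}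
    (hT : ∀ x, L.T x ≤ X) (hw : base + 8 * L.size + 100 < 2 ^ w) (hX : L.p + X * L.p < 2 ^ w)
    (hpp : 2 * (L.p * L.p) < 2 ^ w) {b9 x i b12 hi u v y t : ℕ} :
    WP w emitAll ⟨[L.z, L.p, L.r, L.n, L.cl, L.s 0, L.M, base, L.ri, b9, x, i, b12, hi, c, d,
        u, v, 0, y], memOf base inp A, [], t⟩
      (fun σ => σ.out = L.D ∧
        σ.time ≤ t + 200 + 2300 * ((L.m + 1) * L.z) + 1600 * (L.z * L.s 0) + 400 * (L.z * L.cl)) := by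
  have hple : L.p ≤ L.p * L.p := Nat.le_mul_self _
  have hMs : L.M = 4 * L.s 0 := rfl
  have hcl := Layout.cl_le (L := L) 0
  have hz1 := h.z_pos
  have hzn := h.z_le
  have hns := h.n_le_size
  refine WP.seq (WP.block ?_ ?_)
  · generalize 2 ^ w = B at *
    simp [Oks, Instr.run, Instr.Ok, numVars]
    omega
  simp only [runs, Instr.run, List.set_cons_zero, List.set_cons_succ]
  simp only [val_var, val_lit, cost_var, cost_lit, List.getD_cons_zero, List.getD_cons_succ,
    List.nil_append, List.cons_append]
  rw [show memOf base inp A = memOf base inp (Function.update A 3 L.src) by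
    rw [← hA.src, Function.update_eq_self]]
  refine WP.seq ((wp_level h hA (Nat.zero_le _) h.src_lt_size rfl (by omega) hw hpp
    (fun g => starts_top h hw _)).mono ?_)
  rintro ⟨e, m, o', t'⟩ ⟨b9, x, i, hi, u, v, y, he, hm, ho, ht⟩
  simp only at he hm ho ht
  subst he hm ho
  refine WP.seq (WP.loop_count (b := .le 4 5) ⟨by decide, by decide⟩ L.m
    (fun k σ => ∃ sv b9 x i hi u v y, sv = L.s k / 2 ∧
      σ.env = [L.z, L.p, L.r, L.n, L.cl, sv, L.M, base, L.ri,
          b9, x, i, 8, hi, c, d, u, v, 0, y] ∧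
        σ.mem = memOf base inp (Function.update A 3 (L.G k)) ∧
        σ.out = L.header ++ (List.range (k + 1)).flatMap L.level ∧
        -- The term with `sv` is a potential: a level costs `800 * z * sv` beyond its O(z) part and
        -- halves `sv`, so the released potential pays for it. This is the geometric sum.
        σ.time + 1600 * (L.z * sv) ≤ t + 100 + 2200 * ((k + 1) * L.z) +
          1600 * (L.z * L.s 0)) ?_ ?_ ?_)
  · rintro k hk ⟨e, m, o', t''⟩ ⟨sv, b9, x, i, hi, u, v, y, hsv, he, hm, ho, ht''⟩
    simp only at he hm ho ht''
    subst he hm ho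
    have e := Layout.s_succ hk
    have hcl' := Layout.cl_le (L := L) (k + 1)
    obtain rfl : sv = L.s (k + 1) := by omega
    refine ⟨by simpa [WP.TestOn, Test.Holds] using hcl', ?_⟩
    refine (wp_level h hA (l := k + 1) (by omega) (h.G_lt k) rfl (by omega) hw hpp
      (fun g => starts_below h hA.E hk hw g)).mono ?_
    rintro ⟨e, m, o', t1⟩ ⟨b9, x, i, hi, u, v, y, he, hm, ho, ht1⟩
    simp only at he hm ho ht1
    subst he hm ho
    refine ⟨_, _, _, _, _, _, _, _, rfl, rfl, rfl, ?_, ?_⟩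
    · rw [List.range_succ (n := k + 1), List.flatMap_append, List.flatMap_singleton,
        List.append_assoc]
    · have h1 : L.z * (L.s (k + 1) / 2) * 2 ≤ L.z * L.s (k + 1) := by
        rw [mul_assoc]; exact Nat.mul_le_mul_left _ (by omega)
      have h2 : (k + 1 + 1) * L.z = (k + 1) * L.z + L.z := by ring
      simp only
      omega
  · rintro ⟨e, m, o', t''⟩ ⟨sv, b9, x, i, hi, u, v, y, hsv, he, hm, ho, ht''⟩
    simp only at he hm ho ht''
    subst he hm ho
    rw [Layout.s_last] at hsv
    have hc := h.cl_pos
    refine ⟨?_, ?_⟩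
    · simp [WP.TestOn, Test.Holds]; omega
    refine (wp_emitLeaves h hA (by omega) hT hw hX).mono ?_
    rintro σ ⟨ho, ht⟩
    refine ⟨ho, ht.trans ?_⟩
    have : L.z ≤ (L.m + 1) * L.z := Nat.le_mul_of_pos_left _ (by omega)
    simp only
    omega
  · refine ⟨_, _, _, _, _, _, _, _, rfl, rfl, rfl, ?_, ?_⟩
    · simp [Layout.header]
    · have h1 : L.z * (L.s 0 / 2) * 2 ≤ L.z * L.s 0 := by
        rw [mul_assoc]; exact Nat.mul_le_mul_left _ (by omega)
      simp only
      omega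

end

end RAM

/-! ### The construction from the input -/

namespace LZ

/-- The phrase with number `k`. -/
def phrase (Z : List Phrase) (k : ℕ) : Phrase := Z.getD k ⟨0, 0, 0⟩

/-- Turns the recursive definition of the parse into a statement about each phrase number, with
partial sums of phrase lengths as starting positions. -/
theorem IsLZ77ParseFrom.spec {S : List ℕ} {Z : List Phrase} : ∀ {k : ℕ}, IsLZ77ParseFrom S k Z →
    (∀ i < Z.length, IsNextPhrase S (k + RAM.phraseStart (fun i => (phrase Z i).len) i)
      (phrase Z i)) ∧
    k + RAM.phraseStart (fun i => (phrase Z i).len) Z.length = S.length := by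
  induction Z with
  | nil =>
    intro k h
    change k = S.length at h
    exact ⟨by simp, by simpa [RAM.phraseStart] using h⟩
  | cons q Z ih =>
    intro k h
    obtain ⟨h1, h2⟩ := ih h.2
    have e : ∀ i, RAM.phraseStart (fun i => (phrase (q :: Z) i).len) (i + 1)
        = q.len + 1 + RAM.phraseStart (fun i => (phrase Z i).len) i := fun i => by
      rw [RAM.phraseStart, Finset.sum_range_succ', add_comm]
      simp [phrase, RAM.phraseStart]
    refine ⟨fun i hi => ?_, ?_⟩
    · cases i with
      | zero => simpa [RAM.phraseStart, phrase] using h.1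
      | succ i =>
        rw [e, ← add_assoc, ← add_assoc]
        simpa [phrase] using h1 i (by simpa using hi)
    · rw [List.length_cons, e]
      omega

theorem IsNextPhrase.spec {S : List ℕ} {st ln bd : ℕ → ℕ} {k : ℕ}
    (h : IsNextPhrase S (RAM.phraseStart ln k) ⟨st k, ln k, bd k⟩) : PhraseSpec S st ln bd k := by
  have hb := h.border_eq
  simp only at hb
  have hlt : RAM.phraseStart ln k + ln k < S.length := by
    by_contra hc
    rw [List.getElem?_eq_none (by omega)] at hb
    simp at hb
  refine ⟨hlt, by simp [List.getD_eq_getElem?_getD, hb], ?_, fun h0 => ?_⟩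
  · rcases h.source_eq with h1 | h1
    · simp only at h1; omega
    · simp only at h1; omega
  · rcases h.source_eq with h1 | ⟨h1, h2, h3, h4⟩
    · simp only at h1; omega
    · simp only at h2 h3 h4
      refine ⟨h2, fun t ht => ?_⟩
      rw [← Layout.getD_substr S _ (RAM.phraseStart ln k + ln k) t (by omega), ← h4]
      obtain ⟨s, hs⟩ : ∃ s, st k = s + 1 := ⟨st k - 1, by omega⟩
      rw [hs, Layout.getD_substr S _ _ t (by omega)]
      simp

theorem length_inputWords (p r : ℕ) (Z : List Phrase) :
    (inputWords p r Z).length = 3 + 3 * Z.length := by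
  simp [inputWords]
  ring

theorem inputWords_phrase (p r : ℕ) (Z : List Phrase) {k : ℕ} (hk : k < Z.length) :
    (inputWords p r Z).getD (3 * k + 3) 0 = (phrase Z k).start ∧
    (inputWords p r Z).getD (3 * k + 4) 0 = (phrase Z k).len ∧
    (inputWords p r Z).getD (3 * k + 5) 0 = (phrase Z k).border := by
  have key : ∀ (Z : List Phrase) k, k < Z.length →
      (Z.flatMap (fun q => [q.start, q.len, q.border])).getD (3 * k) 0 = (phrase Z k).start ∧
      (Z.flatMap (fun q => [q.start, q.len, q.border])).getD (3 * k + 1) 0 = (phrase Z k).len ∧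
      (Z.flatMap (fun q => [q.start, q.len, q.border])).getD (3 * k + 2) 0
        = (phrase Z k).border := by
    intro Z
    induction Z with
    | nil => intro k hk; simp at hk
    | cons q Z ih =>
      intro k hk
      cases k with
      | zero => simp [phrase]
      | succ k =>
        have := ih k (by simpa using hk)
        simpa [phrase, Nat.mul_succ] using this
  simpa [inputWords] using key Z k hk

theorem IsLZ77Parse.length_le {S : List ℕ} {Z : List Phrase} (h : IsLZ77Parse S Z) :
    Z.length ≤ S.length := by
  have h2 := h.spec.2
  have : ∑ i ∈ Finset.range Z.length, 1 ≤ RAM.phraseStart (fun i => (phrase Z i).len) Z.length :=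
    Finset.sum_le_sum fun i _ => by omega
  simp at this
  omega

end LZ

/-- Both `cl - 1` and `m` are chosen least. Minimality gives the bounds by `2 * n`, for `cl * z`
through `j + 1 ≤ 2 ^ j`, and `m ≤ cl - 1` because the second inequality follows from the first. -/
theorem exists_parameters {z n : ℕ} (hz0 : 0 < z) (hz : z ≤ n) : ∃ cl m, 0 < cl ∧
    n ≤ z * 2 ^ (cl - 1) ∧ (∀ k < cl - 1, z * 2 ^ k < n) ∧ n ≤ z * cl * 2 ^ m ∧
    (∀ k < m, z * cl * 2 ^ k < n) ∧ m + 1 ≤ cl ∧ cl * z ≤ 2 * n ∧ z * cl * 2 ^ m ≤ 2 * n := by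
  have ex : ∃ k, n ≤ z * 2 ^ k := ⟨n, Nat.lt_two_pow_self.le.trans (Nat.le_mul_of_pos_left _ hz0)⟩
  classical
  have h1 := Nat.find_spec ex
  have h2 : ∀ k < Nat.find ex, z * 2 ^ k < n := fun k hk => not_le.1 (Nat.find_min ex hk)
  generalize Nat.find ex = j at h1 h2
  have h3 : n ≤ z * (j + 1) * 2 ^ j := h1.trans (by gcongr; exact Nat.le_mul_of_pos_right _ (by omega))
  have ex' : ∃ m, n ≤ z * (j + 1) * 2 ^ m := ⟨j, h3⟩
  have h4 := Nat.find_spec ex'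
  have h5 : ∀ k < Nat.find ex', z * (j + 1) * 2 ^ k < n := fun k hk =>
    not_le.1 (Nat.find_min ex' hk)
  have h6 : Nat.find ex' ≤ j := Nat.find_min' ex' h3
  have h7 : (j + 1) * z ≤ 2 * n := by
    cases j with
    | zero => omega
    | succ j =>
      have := h2 j (by omega)
      have hj : j + 1 ≤ 2 ^ j := Nat.lt_two_pow_self
      have : (j + 1 + 1) * z ≤ 2 * (z * 2 ^ j) := by
        calc (j + 1 + 1) * z ≤ (2 * 2 ^ j) * z := Nat.mul_le_mul_right _ (by omega)
          _ = 2 * (z * 2 ^ j) := by ring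
      omega
  refine ⟨j + 1, Nat.find ex', by omega, h1, h2, h4, h5, by omega, h7, ?_⟩
  generalize Nat.find ex' = m at *
  cases m with
  | zero => rw [pow_zero, mul_one, mul_comm]; exact h7
  | succ m =>
    have := h5 m (by omega)
    rw [pow_succ, ← mul_assoc]; omega

namespace RAM

open LZ

variable {S : List ℕ} {st ln bd : ℕ → ℕ}

/-- The first phrase has no source, since a source would start at 1 or later but no later than the
parsed prefix, which is empty. So its border is the first character, as `E_zero` demands. -/
theorem DecInv.good {A : ℕ → ℕ → ℕ} {n z cl m p r ri : ℕ}
    (hA : DecInv S ln (4 * (cl * 2 ^ m)) A z n) (hS : ∀ k < z, PhraseSpec S st ln bd k)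
    (hn : S.length = n) (hz0 : 0 < z) (hz : z ≤ n) (hcl : 0 < cl)
    (hm : n ≤ z * cl * 2 ^ m) :
    (⟨n, z, cl, m, p, r, ri, A 0, A 1, A 2, A 3, A 7⟩ : Layout).Good := by
  set M := 4 * (cl * 2 ^ m) with hMdef
  have hM : ∀ x, M ≤ x ∧ x < M + n → ∃ y < n, x = M + y := fun x hx => ⟨x - M, by omega, by omega⟩
  have hE : ∀ q < z, M ≤ A 7 q ∧ A 7 q < M + n := fun q hq => by
    have := (hS q hq).lt
    rw [hA.E q hq]; omega
  have hlen : ln 0 = 0 := by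
    by_contra hc
    have h1 := ((hS 0 hz0).src (by omega)).1
    have h2 := (hS 0 hz0).start_le
    simp [phraseStart] at h2
    omega
  constructor
  · exact hz0
  · exact hz
  · exact hcl
  · simpa [Layout.s, mul_assoc] using hm
  · show A 7 0 = M
    rw [hA.E 0 hz0, hlen]; simp [phraseStart]
  · intro q₁ q₂ h12 h2
    show A 7 q₁ ≤ A 7 q₂
    rw [hA.E q₁ (lt_of_le_of_lt h12 h2), hA.E q₂ h2]
    rcases h12.eq_or_lt with rfl | h
    · exact le_rfl
    · have := phraseStart_mono (ln := ln) (show q₁ + 1 ≤ q₂ from h)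
      rw [phraseStart_succ] at this
      omega
  · exact hE
  · intro x
    by_cases hx : M ≤ x ∧ x < M + n
    · obtain ⟨y, hy, rfl⟩ := hM x hx
      exact (hA.idx y hy).1
    · show A 2 x < z
      rw [hA.out2 x hx]; exact hz0
  · intro x hx
    obtain ⟨y, hy, rfl⟩ := hM x hx
    exact (hA.idx y hy).2
  · exact hA.out1
  · exact hA.out2
  · exact hA.out3
  · intro x hx h0
    obtain ⟨y, hy, rfl⟩ := hM x hx
    exact hA.self y hy h0
  · intro x hx h0
    obtain ⟨y, hy, rfl⟩ := hM x hx
    obtain ⟨v, hv, h1, -⟩ := hA.src y hy h0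
    show M ≤ A 3 (M + y) ∧ A 3 (M + y) < M + y
    omega
  · intro x hx t ht
    obtain ⟨y, hy, rfl⟩ := hM x hx
    change t < A 1 (M + y) at ht
    obtain ⟨v, hv, h1, h2⟩ := hA.src y hy (by omega)
    obtain ⟨h3, h4⟩ := hA.idx y hy
    have h5 := hE _ h3
    show A 0 (M + y + t) = A 0 (A 3 (M + y) + t)
    rw [h1, add_assoc, add_assoc, hA.text _ (by omega), hA.text _ (by omega), h2 t ht]

end RAM

/-! ### Correctness and running time of the whole construction -/

namespace RAM

open LZ

/-- The construction program. -/
def build : Prog :=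
  .seq sumLengths (.seq parameters (.seq decode (.seq inverse (.seq tables emitAll))))

/-- The layout `L` describes the parse of `S` into `z` phrases, for the fingerprint function given
by `p` and `r`. -/
structure Describes (L : Layout) (S : List ℕ) (z p r : ℕ) : Prop where
  good : L.Good
  n_eq : L.n = S.length
  z_eq : L.z = z
  p_eq : L.p = p
  r_eq : L.r = r
  text : ∀ x < S.length, L.T (L.M + x) = S.getD x 0
  m_lt : L.m + 1 ≤ L.cl
  cl_lt : ∀ k < L.cl - 1, z * 2 ^ k < S.length
  mul_cl : L.z * L.cl ≤ 2 * S.length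
  mul_s : L.z * L.s 0 ≤ 2 * S.length
  inv : L.r ≠ 0 → (L.r : ZMod L.p) * L.ri = 1

/-- The records begin right after the input, where memory is still zero, so decoding starts from
zero arrays. -/
theorem memOf_input (p r : ℕ) (Z : List Phrase) :
    (fun a => (inputWords p r Z).getD a 0) =
      memOf (3 + 3 * Z.length) (fun a => (inputWords p r Z).getD a 0) 0 := by
  funext a
  unfold memOf
  split_ifs with h
  · rfl
  · rw [List.getD_eq_default _ _ (by rw [length_inputWords]; omega)]; rfl

theorem wp_build {w p r c : ℕ} {S : List ℕ} {Z : List Phrase} (hn : 1 ≤ S.length)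
    (hS : ∀ x ∈ S, x ≤ (S.length + 1) ^ c) (hZ : IsLZ77Parse S Z) (hp : p.Prime)
    (hpc : p ≤ (S.length + 1) ^ c) (hr : r < p)
    (hw : 1024 * (S.length + 1) * ((S.length + 1) ^ c * (S.length + 1) ^ c) ≤ 2 ^ w) :
    WP w build ⟨[0, 0, 0, 0, 0, 0, 0, 0, 0, 0, 0, 0, 0, 0, 0, 0, 0, 0, 0, 0],
        fun a => (inputWords p r Z).getD a 0, [], 0⟩
      (fun σ => ∃ L : Layout, Describes L S Z.length p r ∧ σ.out = L.D ∧
        σ.time ≤ (20000 + 40 * c) * S.length) := by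
  obtain ⟨hspec, hlen⟩ := hZ.spec
  simp only [zero_add] at hspec hlen
  have hzn := hZ.length_le
  have hz0 : 0 < Z.length := by
    rcases Nat.eq_zero_or_pos Z.length with h0 | h0
    · rw [h0] at hlen; simp [phraseStart] at hlen; omega
    · exact h0
  set ln := fun i => (phrase Z i).len with hln
  have hph : ∀ k < Z.length, PhraseSpec S (fun i => (phrase Z i).start) ln
      (fun i => (phrase Z i).border) k := fun k hk => (hspec k hk).spec
  obtain ⟨cl, m, hcl0, hcl, hcl', hm, hm', hmcl, hclz, hclm⟩ := exists_parameters hz0 hzn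
  have hin : ∀ k < Z.length, _ := fun k hk => inputWords_phrase p r Z hk
  set n := S.length with hndef
  set X := (n + 1) ^ c with hX
  have hX1 : 1 ≤ X := Nat.one_le_pow _ _ (by omega)
  have hXX : X ≤ X * X := Nat.le_mul_self _
  have hnX : 1024 * (n + 1) ≤ 2 ^ w := by
    refine le_trans ?_ hw
    exact Nat.le_mul_of_pos_right _ (by positivity)
  have hXw : 2048 * (X * X) ≤ 2 ^ w := by
    refine le_trans ?_ hw
    exact Nat.mul_le_mul_right _ (by omega)
  have hpp : p * p ≤ X * X := Nat.mul_le_mul hpc hpc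
  have hXp : X * p ≤ X * X := Nat.mul_le_mul_left _ hpc
  have hp2 := hp.two_le
  have hSX : ∀ x, S.getD x 0 ≤ X := by
    intro x
    rcases lt_or_ge x S.length with hx | hx
    · rw [List.getD_eq_getElem _ _ hx]; exact hS _ (List.getElem_mem hx)
    · rw [List.getD_eq_default _ _ hx]; omega
  refine WP.seq ((wp_sumLengths (z := Z.length) (p := p) (r := r) (n := n) (ln := ln)
    (by simp [inputWords]) (by simp [inputWords]) (by simp [inputWords])
    (fun k hk => (hin k hk).2.1) hlen hzn (by omega) (by omega) (by omega)).mono ?_)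
  rintro ⟨e, mem, o, t1⟩ ⟨he, hmem, ho, ht1⟩
  simp only at he hmem ho ht1
  subst he hmem ho
  refine WP.seq ((wp_parameters hz0 hzn hcl0 hcl hcl' hm hm' hmcl hclz (by omega)).mono ?_)
  rintro ⟨e, mem, o, t2⟩ ⟨⟨a, he⟩, hmem, ho, ht2⟩
  simp only at he hmem ho ht2
  subst he hmem ho
  have hclm' : cl * 2 ^ m ≤ 2 * n := by
    refine le_trans ?_ hclm
    rw [mul_assoc]; exact Nat.le_mul_of_pos_left _ hz0
  have hs0 : 0 < cl * 2 ^ m := by positivity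
  have hD0 : DecInv S ln (4 * (cl * 2 ^ m)) 0 0 0 := by
    refine ⟨?_, ?_, ?_, ?_, ?_, ?_, ?_, ?_, ?_, ?_⟩ <;> simp
  rw [memOf_input]
  refine WP.seq ((wp_decode (A₀ := 0) (fun k hk => (hin k hk).1) (fun k hk => (hin k hk).2.1)
    (fun k hk => (hin k hk).2.2) hph rfl hlen hzn (by omega) rfl hD0 (by omega)
    (fun x => by have := hSX x; omega)).mono ?_)
  rintro ⟨e, mem, o, t3⟩ ⟨A, a10, a11, hA, he, hmem, ho, ht3⟩
  simp only at he hmem ho ht3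
  subst he hmem ho
  refine WP.seq ((wp_inverse hp2 hr (by omega)).mono ?_)
  rintro ⟨e, mem, o, t4⟩ ⟨ri, b15, b16, hri, hrip, he, hmem, ho, ht4⟩
  simp only at he hmem ho ht4
  subst he hmem ho
  have hG : (⟨n, Z.length, cl, m, p, r, ri, A 0, A 1, A 2, A 3, A 7⟩ : Layout).Good :=
    hA.good hph rfl hz0 hzn hcl0 hm
  set L : Layout := ⟨n, Z.length, cl, m, p, r, ri, A 0, A 1, A 2, A 3, A 7⟩ with hL
  have hT : ∀ x, L.T x ≤ X := by
    intro x
    by_cases hx : 4 * (cl * 2 ^ m) ≤ x ∧ x < 4 * (cl * 2 ^ m) + n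
    · obtain ⟨y, rfl⟩ := Nat.exists_eq_add_of_le hx.1
      show A 0 _ ≤ X
      rw [hA.text y (by omega)]; exact hSX y
    · show A 0 x ≤ X
      rw [hA.out0 x hx]; omega
  have hzs : L.z * L.s 0 ≤ 2 * n := by
    rw [mul_assoc] at hclm; exact hclm
  have hsle : L.s 0 ≤ L.z * L.s 0 := Nat.le_mul_of_pos_left _ hz0
  -- The size is `8 * s 0 + 8 * (z * s 0)`, at most `16 * (z * s 0)`.
  have hsize : L.size ≤ 32 * n := by
    have : L.size = 8 * L.s 0 + 8 * (L.z * L.s 0) := by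
      simp only [Layout.size, Layout.M]; ring
    omega
  have hlw : 3 + 3 * Z.length + 8 * L.size + 100 < 2 ^ w := by omega
  refine WP.seq ((wp_tables (L := L) rfl rfl rfl rfl rfl hs0 hp2 hr hri hT hlw
    (show p + X * p < 2 ^ w by omega) (show p * p < 2 ^ w by omega)).mono ?_)
  rintro ⟨e, mem, o, t5⟩ ⟨A', b10, b13, b14, b15, b16, hA', he, hmem, ho, ht5⟩
  simp only at he hmem ho ht5
  subst he hmem ho
  refine (wp_emitAll hG hA' hp2 hr hT hlw (show p + X * p < 2 ^ w by omega)
    (show 2 * (p * p) < 2 ^ w by omega)).mono ?_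
  rintro ⟨e, mem, o, t6⟩ ⟨ho, ht6⟩
  simp only at ho ht6
  have hzcl : Z.length * cl ≤ 2 * n := by rw [mul_comm]; exact hclz
  refine ⟨L, ⟨hG, rfl, rfl, rfl, rfl, fun x hx => hA.text x hx, hmcl, hcl', hzcl, hzs, ?_⟩, ho, ?_⟩
  · intro hr0
    have : Fact p.Prime := ⟨hp⟩
    have h0 : (r : ZMod p) ≠ 0 := by
      rw [Ne, ZMod.natCast_eq_zero_iff]
      exact Nat.not_dvd_of_pos_of_lt (Nat.pos_of_ne_zero hr0) hr
    show (r : ZMod p) * (ri : ZMod p) = 1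
    -- Fermat's little theorem.
    rw [hrip, ← pow_succ', show p - 2 + 1 = p - 1 by omega]
    exact ZMod.pow_card_sub_one_eq_one h0
  -- From `p ≤ (n + 1) ^ c ≤ 2 ^ (n * c)`: computing the inverse takes linear time, with a factor
  -- that depends on `c`.
  · have h1 : Nat.size (p - 2) ≤ n * c := by
      rw [Nat.size_le, pow_mul]
      refine lt_of_lt_of_le (show p - 2 < p by omega) (hpc.trans ?_)
      exact Nat.pow_le_pow_left Nat.lt_two_pow_self c
    have h2 : (m + 1) * Z.length ≤ 2 * n := (Nat.mul_le_mul_right _ hmcl).trans hclz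
    have h3 : (20000 + 40 * c) * n = 20000 * n + 40 * (n * c) := by ring
    have h4 : cl ≤ cl * Z.length := Nat.le_mul_of_pos_right _ hz0
    change t6 ≤ t5 + 200 + 2300 * ((m + 1) * Z.length) + 1600 * (L.z * L.s 0) +
      400 * (Z.length * cl) at ht6
    simp only
    omega

end RAM

theorem pow_le_two_pow {n K w : ℕ} (h : K * Nat.clog 2 (n + 1) ≤ w) : (n + 1) ^ K ≤ 2 ^ w :=
  calc (n + 1) ^ K ≤ (2 ^ Nat.clog 2 (n + 1)) ^ K :=
        Nat.pow_le_pow_left (Nat.le_pow_clog (by norm_num) _) _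
    _ = 2 ^ (K * Nat.clog 2 (n + 1)) := by rw [← pow_mul, mul_comm]
    _ ≤ 2 ^ w := Nat.pow_le_pow_right (by norm_num) h

namespace LZ

theorem inputWords_lt {w p r B : ℕ} {S : List ℕ} {Z : List Phrase} (hZ : IsLZ77Parse S Z)
    (hS : ∀ x ∈ S, x < B) (hn : S.length < B) (hp : p < B) (hr : r < B) (hB : B ≤ 2 ^ w) :
    ∀ x ∈ inputWords p r Z, x < 2 ^ w := by
  intro x hx
  refine lt_of_lt_of_le ?_ hB
  have hZn := hZ.length_le
  rcases List.mem_append.1 hx with hx | hx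
  · simp only [List.mem_cons, List.not_mem_nil, or_false] at hx
    omega
  · obtain ⟨q, hq, hx⟩ := List.mem_flatMap.1 hx
    obtain ⟨k, hk, rfl⟩ := List.mem_iff_getElem.1 hq
    have e : Z[k] = phrase Z k := (List.getD_eq_getElem _ _ hk).symm
    have hs := hZ.spec.1 k hk
    rw [zero_add] at hs
    have h := IsNextPhrase.spec (st := fun i => (phrase Z i).start)
      (ln := fun i => (phrase Z i).len) (bd := fun i => (phrase Z i).border) hs
    have h1 := h.lt
    have h2 := h.start_le
    have h3 : (phrase Z k).border < B := by
      rw [← h.border, List.getD_eq_getElem _ _ h1]; exact hS _ (List.getElem_mem h1)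
    simp only [e, List.mem_cons, List.not_mem_nil, or_false] at hx
    omega

end LZ

/-! ### Size of the structure and the final bounds -/

namespace RAM

variable {L : Layout} {S : List ℕ} {z p r : ℕ}

theorem Describes.length_D_le (h : Describes L S z p r) :
    L.D.length ≤ 5 + 56 * (L.z * L.cl) := by
  rw [Layout.length_D]
  have h1 : (L.m + 1) * L.z ≤ L.cl * L.z := Nat.mul_le_mul_right _ h.m_lt
  have e1 : (L.m + 1) * (40 * L.z) = 40 * ((L.m + 1) * L.z) := by ring
  have e2 : L.z * (4 * L.cl) * 4 = 16 * (L.z * L.cl) := by ring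
  rw [mul_comm L.cl] at h1
  omega

/-- By minimality of `cl`, if `cl ≥ 2` then `z * 2 ^ (cl - 2) < n`; take logarithms. -/
theorem Describes.cl_le (h : Describes L S z p r) :
    (L.cl : ℝ) ≤ 2 + Real.logb 2 ((S.length : ℝ) / z) := by
  have hz := h.good.z_pos
  have hzn := h.good.z_le
  rw [h.z_eq] at hz hzn
  rw [h.n_eq] at hzn
  have hz' : (0 : ℝ) < z := by exact_mod_cast hz
  have h1 : (1 : ℝ) ≤ (S.length : ℝ) / z := by
    rw [le_div_iff₀ hz', one_mul]; exact_mod_cast hzn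
  rcases Nat.lt_or_ge L.cl 2 with hc | hc
  · have : (0 : ℝ) ≤ Real.logb 2 ((S.length : ℝ) / z) := Real.logb_nonneg (by norm_num) h1
    have : (L.cl : ℝ) ≤ 2 := by exact_mod_cast hc.le
    linarith
  · obtain ⟨k, hk⟩ := Nat.exists_eq_add_of_le hc
    have h2 := h.cl_lt k (by omega)
    have h3 : (k : ℝ) ≤ Real.logb 2 ((S.length : ℝ) / z) := by
      rw [Real.le_logb_iff_rpow_le (by norm_num) (by positivity), Real.rpow_natCast,
        le_div_iff₀ hz']
      rw [mul_comm] at h2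
      exact_mod_cast h2.le
    rw [hk]
    push_cast
    linarith

theorem Describes.substr_eq (h : Describes L S z p r) {i j : ℕ} (hi : 1 ≤ i) (hj : j ≤ S.length) :
    (List.range (j - (i - 1))).map (fun t => L.T (L.M + (i - 1) + t)) = LZ.substr S i j := by
  obtain ⟨i, rfl⟩ := Nat.exists_eq_add_of_le' hi
  have hl := Layout.length_substr S i j hj
  rw [Nat.add_sub_cancel]
  refine List.ext_getElem (by simp [hl]) fun t h1 h2 => ?_
  have ht : t < j - i := by simpa using h1
  rw [List.getElem_map, List.getElem_range, add_assoc, h.text _ (by omega),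
    ← Layout.getD_substr S i j t ht, List.getD_eq_getElem _ _ h2]

theorem args_getD (i j : ℕ) : ∀ k < numVars, [i, j].getD k 0 =
    [i, j, 0, 0, 0, 0, 0, 0, 0, 0, 0, 0, 0, 0, 0, 0, 0, 0, 0, 0].getD k 0 := by
  intro k hk
  unfold numVars at hk
  interval_cases k <;> rfl

theorem nil_getD : ∀ k < numVars, ([] : List ℕ).getD k 0 =
    [0, 0, 0, 0, 0, 0, 0, 0, 0, 0, 0, 0, 0, 0, 0, 0, 0, 0, 0, 0].getD k 0 := by
  intro k hk
  unfold numVars at hk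
  interval_cases k <;> rfl

end RAM

theorem mainTheorem5 (c : ℕ) :
    ∃ (build extract fprint : RAM.Prog) (C K : ℕ),
      ∀ (n z : ℕ) (S : List ℕ) (Z : List LZ.Phrase) (p r w : ℕ),
        S.length = n → 1 ≤ n → (∀ x ∈ S, 1 ≤ x ∧ x ≤ (n + 1) ^ c) →
        LZ.IsLZ77Parse S Z → Z.length = z →
        p.Prime → p ≤ (n + 1) ^ c → r < p →
        K * Nat.clog 2 (n + 1) ≤ w →
        ∃ (D : List ℕ) (tBuild : ℕ),
          RAM.Outputs w build (LZ.inputWords p r Z) [] tBuild D ∧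
          tBuild ≤ C * n ∧
          (D.length : ℝ) ≤ C * (z * (1 + Real.logb 2 ((n : ℝ) / z))) ∧
          ∀ i j : ℕ, 1 ≤ i → i ≤ n + 1 → j ≤ n →
            (∃ t : ℕ, RAM.Outputs w extract D [i, j] t (LZ.substr S i j) ∧
              (t : ℝ) ≤ C * (1 + Real.logb 2 ((n : ℝ) / z) + ((j - i : ℕ) : ℝ))) ∧
            (∃ t : ℕ, RAM.Outputs w fprint D [i, j] t [LZ.fingerprint p r (LZ.substr S i j)] ∧
              (t : ℝ) ≤ C * (1 + Real.logb 2 ((n : ℝ) / z))) := by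
  -- The part `40 * c` of `C` pays for the modular inverse. In `K`, `2 * c` allows for products of
  -- two numbers up to `(n + 1) ^ c`, and 11 for the factor `1024 * (n + 1)`, as `2 ≤ n + 1`.
  refine ⟨RAM.build, RAM.extract, RAM.fprint, 20000 + 40 * c, 2 * c + 11, ?_⟩
  rintro n z S Z p r w rfl hn hS hZ rfl hp hpc hr hK
  have hw : 1024 * (S.length + 1) * ((S.length + 1) ^ c * (S.length + 1) ^ c) ≤ 2 ^ w := by
    refine le_trans ?_ (pow_le_two_pow hK)
    have h1 : 2 ^ 10 ≤ (S.length + 1) ^ 10 := Nat.pow_le_pow_left (by omega) _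
    calc _ ≤ (S.length + 1) ^ 10 * (S.length + 1) * ((S.length + 1) ^ c * (S.length + 1) ^ c) := by
          gcongr
          exact h1
      _ = _ := by ring
  have hX1 : 1 ≤ (S.length + 1) ^ c := Nat.one_le_pow _ _ (by omega)
  have hXX := Nat.le_mul_self ((S.length + 1) ^ c)
  have hpp := Nat.mul_le_mul hpc hpc
  have hnw : 1024 * (S.length + 1) ≤ 2 ^ w :=
    (Nat.le_mul_of_pos_right _ (by positivity)).trans hw
  have hXw : 2048 * ((S.length + 1) ^ c * (S.length + 1) ^ c) ≤ 2 ^ w :=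
    (Nat.mul_le_mul_right _ (by omega)).trans hw
  have hp2 := hp.two_le
  obtain ⟨tB, σ, hout, htB, ⟨L, hL, hD, hσ⟩, hword⟩ := RAM.WP.outputs
    (LZ.inputWords_lt hZ (B := 2 ^ w) (fun x hx => by have := (hS x hx).2; omega) (by omega)
      (by omega) (by omega) le_rfl) (by simp) RAM.nil_getD
    (RAM.wp_build hn (fun x hx => (hS x hx).2) hZ hp hpc hr hw)
  rw [hD] at hout hword
  have hlen := hL.length_D_le
  have hmcl := hL.m_lt
  have hzcl := hL.mul_cl
  have hzs := hL.mul_s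
  have hz0 := hL.good.z_pos
  have hLn := hL.n_eq
  have h1 : L.cl ≤ L.z * L.cl := Nat.le_mul_of_pos_left _ hz0
  have h2 : L.s 0 ≤ L.z * L.s 0 := Nat.le_mul_of_pos_left _ hz0
  have hLz := hL.z_eq
  have hcl := hL.cl_le
  have hlog : 0 ≤ Real.logb 2 ((S.length : ℝ) / Z.length) := by
    refine Real.logb_nonneg (by norm_num) ?_
    rw [le_div_iff₀ (by rw [← hLz]; exact_mod_cast hz0), one_mul]
    exact_mod_cast hZ.length_le
  -- The words of `D` fit because the construction program has output them; all other bounds are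
  -- linear in `n` or quadratic in `p`.
  have hfit : RAM.QueryFits L w := by
    refine ⟨fun a => ?_, by omega, by rw [hL.p_eq]; omega, by omega, by rw [hL.p_eq]; exact hp2⟩
    rcases lt_or_ge a L.D.length with ha | ha
    · rw [List.getD_eq_getElem _ _ ha]; exact hword _ (List.getElem_mem ha)
    · rw [List.getD_eq_default _ _ ha]; positivity
  generalize Real.logb 2 ((S.length : ℝ) / Z.length) = lg at *
  have hc0 : (0 : ℝ) ≤ c := Nat.cast_nonneg c
  refine ⟨L.D, tB, hout, htB.trans hσ, ?_, ?_⟩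
  · have h3 : (L.D.length : ℝ) ≤ 5 + 56 * (L.z * L.cl) := by exact_mod_cast hlen
    have h4 : (1 : ℝ) ≤ L.z := by exact_mod_cast hz0
    rw [← hLz]
    have h5 : (L.z : ℝ) * L.cl ≤ L.z * (2 + lg) := by gcongr
    have h6 : (L.z : ℝ) ≤ L.z * (1 + lg) := le_mul_of_one_le_right (by linarith) (by linarith)
    have h7 : (0 : ℝ) ≤ c * (L.z * (1 + lg)) := by positivity
    push_cast
    nlinarith
  · intro i j hi hin hjn
    have hargs : ∀ x ∈ [i, j], x < 2 ^ w := by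
      intro x hx
      simp only [List.mem_cons, List.not_mem_nil, or_false] at hx
      omega
    constructor
    · obtain ⟨t, σ', ho, ht, ⟨hs, hs'⟩, -⟩ := RAM.WP.outputs hword hargs (RAM.args_getD i j)
        (RAM.wp_extract hL.good hfit hmcl (fun _ => rfl) (by omega) (by omega))
      rw [hs, hL.substr_eq hi hjn] at ho
      refine ⟨t, ho, ?_⟩
      -- The program counts `j - (i - 1)` characters, at most one more than `j - i`; the constant
      -- absorbs it.
      have h3 : t ≤ 400 + 300 * (j - i) + 300 * L.cl := by omega
      have h4 : (t : ℝ) ≤ 400 + 300 * ((j - i : ℕ) : ℝ) + 300 * L.cl := by exact_mod_cast h3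
      have h5 : (0 : ℝ) ≤ ((j - i : ℕ) : ℝ) := Nat.cast_nonneg _
      have h6 : (0 : ℝ) ≤ c * (1 + lg + ((j - i : ℕ) : ℝ)) := by positivity
      push_cast
      linarith
    · obtain ⟨t, σ', ho, ht, ⟨hs, hs'⟩, -⟩ := RAM.WP.outputs hword hargs (RAM.args_getD i j)
        (RAM.wp_fprint hL.good hfit (fun _ => rfl) hi (by omega) (by omega) hLn.symm hL.text
          hL.inv)
      rw [hs, hL.p_eq, hL.r_eq] at ho
      refine ⟨t, ho, ?_⟩
      have h3 : t ≤ 400 + 200 * L.cl := by omega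
      have h4 : (t : ℝ) ≤ 400 + 200 * L.cl := by exact_mod_cast h3
      have h6 : (0 : ℝ) ≤ c * (1 + lg) := by positivity
      push_cast
      linarith
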